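/- Let $Y\subset\mathbb P^N$ be an irreducible complex projective variety, let $p_1,\dots,p_k\in\mathbb P^N$ ($k\ge 0$) be distinct points, and suppose that $Y^{\circ}:=Y\setminus\{p_1,\dots,p_k\}$ is an $n$-dimensional complex submanifold of $\mathbb P^N$. Let $m_j,l_j\ge 1$ with $m_j+l_j+1=n$, and let $$C_{m,l}=\{(Z_aW_b)_{a,b}\;:\;Z\in\mathbb C^{m+1},\,W\in\mathbb C^{l+1}\}\subset\mathbb C^{(m+1)(l+1)}$$ be the affine cone over $\mathbb P^{m}\times\mathbb P^{l}$ in its Segre embedding. Suppose that for each $j$ a neighbourhood of $p_j\in Y$ in $Y$, containing no other $p_i$, is identified by a map $\psi_j$ with a neighbourhood of the vertex $0$ of $C_{m_j,l_j}$, where $\psi_j(p_j)=0$ and $\psi_j$ is a homeomorphism that is biholomorphic away from $p_j$ (for normal $Y$: an isomorphism of complex spaces). Let $\tilde\phi:\tilde X\to Y$ denote the resolution that is biholomorphic over $Y^\circ$ and that over a neighbourhood of $p_j$ is identified through $\psi_j$ with the contraction to $C_{m_j,l_j}$ of $$\tilde{\mathcal E}_{j}=\{(x,[Z],[W])\in\mathbb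 C^{(m_j+1)(l_j+1)}\times\mathbb P^{m_j}\times\mathbb P^{l_j}\;:\;x\in\mathbb C\cdot Z\otimes W\},\qquad (x,[Z],[W])\mapsto x .$$ Here $\tilde{\mathcal E}_j$ is the blow-up along the zero section both of $\mathcal O_{\mathbb P^{m_j}}(-1)^{\oplus(l_j+1)}$ and of $\mathcal O_{\mathbb P^{l_j}}(-1)^{\oplus(m_j+1)}$, and $\tilde\phi^{-1}(p_j)\cong\mathbb P^{m_j}\times\mathbb P^{l_j}$ is the exceptional divisor. Let $g$ be a smooth Kähler metric on $Y^\circ$ such that, near each $p_j$, $g$ is the restriction by $\psi_j$ of a smooth Kähler metric defined on a neighbourhood of $0$ in $\mathbb C^{(m_j+1)(l_j+1)}$. Then $\tilde X$ exists as a compact complex manifold, and there is $\epsilon_0>0$ such that for every $\epsilon\in(0,\epsilon_0)$: 1. $g-\epsilon\,\mathrm{Ric}(g)$ is a smooth Kähler metric on $Y^\circ$, where $\mathrm{Ric}(g)_{a\bar b}=-\partial_a\partial_{\bar b}\log\det(g_{i\bar j})$; 2. there is a smooth Kähler metric $\tilde g_\epsilon$ on $\tilde X$ that extends $g-\epsilon\,\mathrm{Ric}(g)$,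 i.e. $\tilde g_\epsilon=\tilde\phi^*(g-\epsilon\,\mathrm{Ric}(g))$ on $\tilde\phi^{-1}(Y^\circ)$, and $\tilde X$ with the Riemannian distance of $\tilde g_\epsilon$ is the metric completion of $Y^\circ$ with the Riemannian distance of $g-\epsilon\,\mathrm{Ric}(g)$, through the inclusion $\tilde\phi^{-1}:Y^\circ\to\tilde X$. -/

import Mathlib

open Set Filter Topology
open scoped Manifold ContDiff ENNReal ComplexConjugate ComplexOrder LinearAlgebra.Projectivization

noncomputable section

namespace SegreCone

/-! ### Kähler forms and Ricci curvature in coordinates -/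

/-- The model space `ℂ^ι` with its Euclidean norm. -/
abbrev Cn (ι : Type) [Fintype ι] : Type := EuclideanSpace ℂ ι

section Coordinates

variable {ι : Type} [Fintype ι] [DecidableEq ι]

/-- The Wirtinger derivative `∂f/∂z_a`. -/
def wirt (a : ι) (f : Cn ι → ℂ) (z : Cn ι) : ℂ :=
  (1 / 2) * (fderiv ℝ f z (EuclideanSpace.single a 1)
    - Complex.I * fderiv ℝ f z (EuclideanSpace.single a Complex.I))

/-- The Wirtinger derivative `∂f/∂z̄_a`. -/
def wirtBar (a : ι) (f : Cn ι → ℂ) (z : Cn ι) : ℂ :=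
  (1 / 2) * (fderiv ℝ f z (EuclideanSpace.single a 1)
    + Complex.I * fderiv ℝ f z (EuclideanSpace.single a Complex.I))

/-- `G = (g_{a b̄})` is a smooth Kähler metric on the open set `Ω ⊆ ℂ^ι`: its entries are smooth,
it is Hermitian positive definite, and the form `√-1 ∑ g_{a b̄} dz_a ∧ dz̄_b` is closed. -/
structure IsKahlerOn (Ω : Set (Cn ι)) (G : Cn ι → Matrix ι ι ℂ) : Prop where
  smooth : ∀ a b, ContDiffOn ℝ ∞ (fun z => G z a b) Ω
  posDef : ∀ z ∈ Ω, (G z).PosDef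
  closed : ∀ z ∈ Ω, ∀ a b c, wirt c (fun w => G w a b) z = wirt a (fun w => G w c b) z

/-- The Ricci curvature `R_{a b̄} = - ∂_a ∂_b̄ log det (g_{i j̄})`. -/
def ricciCoord (G : Cn ι → Matrix ι ι ℂ) (z : Cn ι) (a b : ι) : ℂ :=
  - wirt a (wirtBar b (fun w => ((Real.log (G w).det.re : ℝ) : ℂ))) z

end Coordinates

/-! ### Kähler metrics on complex manifolds -/

section Manifolds

variable (n : ℕ) (M : Type) [TopologicalSpace M] [ChartedSpace (Cn (Fin n)) M]

/-- The holomorphic tangent space at `x`. -/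
abbrev Tan (x : M) : Type := TangentSpace 𝓘(ℂ, Cn (Fin n)) x

/-- A field of sesquilinear forms on the tangent spaces, linear in the first variable and
conjugate linear in the second. -/
abbrev SesqField : Type := ∀ x : M, Tan n M x →ₗ[ℂ] Tan n M x →ₗ⋆[ℂ] ℂ

variable {n M}

/-- The coefficients `g_{a b̄} = g(∂_a, ∂_b)` of `g` in the chart `φ`. -/
def coeff (g : SesqField n M) (φ : OpenPartialHomeomorph M (Cn (Fin n))) (z : Cn (Fin n)) :
    Matrix (Fin n) (Fin n) ℂ := fun a b =>
  g (φ.symm z)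
    (mfderiv 𝓘(ℂ, Cn (Fin n)) 𝓘(ℂ, Cn (Fin n)) φ.symm z (EuclideanSpace.single a (1 : ℂ)))
    (mfderiv 𝓘(ℂ, Cn (Fin n)) 𝓘(ℂ, Cn (Fin n)) φ.symm z (EuclideanSpace.single b (1 : ℂ)))

/-- `g` is a smooth Kähler metric on the complex manifold `M`. -/
def IsKahler (g : SesqField n M) : Prop :=
  ∀ φ ∈ atlas (Cn (Fin n)) M, IsKahlerOn φ.target (coeff g φ)

/-- The Ricci curvature `Ric(g) = - √-1 ∂∂̄ log det g`, as a sesquilinear form on each tangent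
space; at `x` it is computed in the preferred chart at `x`. -/
def ricci (g : SesqField n M) : SesqField n M := fun x =>
  let φ := chartAt (Cn (Fin n)) x
  let d : Tan n M x →L[ℂ] Cn (Fin n) := mfderiv 𝓘(ℂ, Cn (Fin n)) 𝓘(ℂ, Cn (Fin n)) φ x
  LinearMap.mk₂'ₛₗ (RingHom.id ℂ) (starRingEnd ℂ)
    (fun v w => ∑ a, ∑ b, ricciCoord (coeff g φ) (φ x) a b * d v a * conj (d w b))
    (fun v v' w => by simp [mul_add, add_mul, Finset.sum_add_distrib])
    (fun c v w => by
      simp only [map_smul, PiLp.smul_apply, smul_eq_mul, RingHom.id_apply, Finset.mul_sum]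
      exact Finset.sum_congr rfl fun a _ => Finset.sum_congr rfl fun b _ => by ring)
    (fun v w w' => by simp [mul_add, Finset.sum_add_distrib])
    (fun c v w => by
      simp only [map_smul, PiLp.smul_apply, smul_eq_mul, map_mul, Finset.mul_sum]
      exact Finset.sum_congr rfl fun a _ => Finset.sum_congr rfl fun b _ => by ring)

/-- `g - ε Ric(g)`. -/
def subRicci (g : SesqField n M) (ε : ℝ) : SesqField n M := fun x => g x - (ε : ℂ) • ricci g x

/-- The norm `|v|_g = g(v,v)^{1/2}` on real tangent vectors. -/
@[reducible] def hermENorm (g : SesqField n M) (x : M) : ENorm (TangentSpace 𝓘(ℝ, Cn (Fin n)) x) where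
  enorm v := ENNReal.ofReal (Real.sqrt (g x (v : Cn (Fin n)) (v : Cn (Fin n))).re)

/-- The Riemannian distance of the Hermitian metric `g`: the infimum of the `g`-lengths of `C^1`
paths (`∞` for points in different components). -/
def hermDist (g : SesqField n M) (x y : M) : ℝ≥0∞ :=
  letI := hermENorm g
  Manifold.riemannianEDist 𝓘(ℝ, Cn (Fin n)) x y

/-- `f` is a holomorphic immersion on the open set `s`. -/
def IsHolImmersionOn {F H : Type} [NormedAddCommGroup F] [NormedSpace ℂ F]
    [TopologicalSpace H] (J : ModelWithCorners ℂ F H) {N : Type} [TopologicalSpace N]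
    [ChartedSpace H N] (f : M → N) (s : Set M) : Prop :=
  ContMDiffOn 𝓘(ℂ, Cn (Fin n)) J ω f s ∧
    ∀ x ∈ s, Function.Injective (mfderiv 𝓘(ℂ, Cn (Fin n)) J f x)

end Manifolds

/-- `(B, dB)` is the metric completion of `(A, dA)` through the map `ι : A → B`: `(B, dB)` is
separated and complete, and `ι` is distance preserving with dense image. -/
structure IsMetricCompletion {A B : Type} (dA : A → A → ℝ≥0∞) (dB : B → B → ℝ≥0∞)
    (ι : A → B) : Prop where
  isometric : ∀ x y, dB (ι x) (ι y) = dA x y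
  dense : ∀ b : B, ∀ δ : ℝ≥0∞, 0 < δ → ∃ a : A, dB b (ι a) < δ
  separated : ∀ b b' : B, dB b b' = 0 → b = b'
  complete : ∀ u : ℕ → B,
    (∀ δ : ℝ≥0∞, 0 < δ → ∃ K : ℕ, ∀ p ≥ K, ∀ q ≥ K, dB (u p) (u q) < δ) →
    ∃ b : B, Tendsto (fun p => dB (u p) b) atTop (𝓝 0)

/-! ### Projective varieties -/

/-- The complex projective space `ℙ^N`. -/
def CP (N : ℕ) : Type := ℙ ℂ (Fin (N + 1) → ℂ)

/-- The classical (quotient) topology of `ℙ^N`. -/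
instance (N : ℕ) : TopologicalSpace (CP N) :=
  inferInstanceAs (TopologicalSpace
    (Quotient (projectivizationSetoid ℂ (Fin (N + 1) → ℂ))))

/-- A choice of homogeneous coordinates of a point of `ℙ^N`. -/
def CP.rep {N : ℕ} (y : CP N) : Fin (N + 1) → ℂ := Projectivization.rep (K := ℂ) y

/-- The affine coordinates `(y_a / y_i)_a`, used where `y_i ≠ 0`. -/
def CP.affine {N : ℕ} (i : Fin (N + 1)) (y : CP N) : Fin (N + 1) → ℂ := fun a => y.rep a / y.rep i

/-- `Y ⊆ ℙ^N` is an irreducible projective variety: the nonempty zero locus of a homogeneous prime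
ideal. -/
def IsProjectiveVariety {N : ℕ} (Y : Set (CP N)) : Prop :=
  Y.Nonempty ∧ ∃ I : Ideal (MvPolynomial (Fin (N + 1)) ℂ), I.IsPrime ∧
    (∀ f ∈ I, ∀ d : ℕ, MvPolynomial.homogeneousComponent d f ∈ I) ∧
    Y = {y | ∀ f ∈ I, MvPolynomial.eval y.rep f = 0}

/-- The complex structure on the set `R ⊆ ℙ^N`, with its subspace topology, is the one of an
`n`-dimensional complex submanifold of `ℙ^N`: the inclusion is a holomorphic immersion in each
affine chart of `ℙ^N`. -/
def IsComplexSubmanifold {N : ℕ} (n : ℕ) (R : Set (CP N)) [ChartedSpace (Cn (Fin n)) ↥R] : Prop :=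
  ∀ i, IsHolImmersionOn (n := n) 𝓘(ℂ, Fin (N + 1) → ℂ)
    (fun y : ↥R => CP.affine i (y : CP N)) {y | (y : CP N).rep i ≠ 0}

/-! ### Segre cones and their blow-up -/

/-- The space `ℂ^{(m+1)(l+1)}` with coordinates `x_{ab}`, `0 ≤ a ≤ m`, `0 ≤ b ≤ l`. -/
abbrev SegreSpace (m l : ℕ) : Type := Cn (Fin (m + 1) × Fin (l + 1))

/-- The affine cone over the image of the Segre embedding
`ℙ^m × ℙ^l → ℙ^{(m+1)(l+1)-1}`, `([Z],[W]) ↦ [Z_a W_b]`. -/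
def cone (m l : ℕ) : Set (SegreSpace m l) :=
  {x | ∃ (Z : Fin (m + 1) → ℂ) (W : Fin (l + 1) → ℂ), ∀ a b, x (a, b) = Z a * W b}

/-- The total space of `𝒪(-1,-1)` over `ℙ^m × ℙ^l`: the triples `(x, [Z], [W])` with `x` on the line
spanned by `Z ⊗ W`. It is the blow-up along the zero section of
`𝒪_{ℙ^m}(-1)^{⊕(l+1)} = {(x, [Z]) | x = Z ⊗ ξ}` (with `W` the direction of `ξ`), as well as of
`𝒪_{ℙ^l}(-1)^{⊕(m+1)}`, and `(x, [Z], [W]) ↦ x` maps it onto the cone, with fibre `ℙ^m × ℙ^l`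
over the vertex. -/
def blowUp (m l : ℕ) : Set (SegreSpace m l × CP m × CP l) :=
  {p | ∃ t : ℂ, ∀ a b, p.1 (a, b) = t * (p.2.1.rep a * p.2.2.rep b)}

/-- The inclusion of the regular part `Y \ S` into `Y`. -/
def incl {N : ℕ} {Y S : Set (CP N)} (y : ↥(Y \ S)) : ↥Y := ⟨y, y.2.1⟩

/-- An isomorphism of a neighbourhood of `q` in `Y` with a neighbourhood of the vertex in the cone
over `ℙ^m × ℙ^l`: a homeomorphism taking `q` to the vertex that is biholomorphic away from `q`. -/
structure ConeChart {N n : ℕ} (Y S : Set (CP N)) [ChartedSpace (Cn (Fin n)) ↥(Y \ S)]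
    (q : CP N) (m l : ℕ) where
  toHomeo : OpenPartialHomeomorph ↥Y ↥(cone m l)
  center : ∃ h : q ∈ Y, (⟨q, h⟩ : ↥Y) ∈ toHomeo.source ∧
    ((toHomeo ⟨q, h⟩ : ↥(cone m l)) : SegreSpace m l) = 0
  isolated : ∀ y ∈ toHomeo.source, (y : CP N) ∈ S → (y : CP N) = q
  biholomorphic : IsHolImmersionOn (n := n) 𝓘(ℂ, SegreSpace m l)
    (fun y : ↥(Y \ S) => ((toHomeo (incl y) : ↥(cone m l)) : SegreSpace m l))
    {y | incl y ∈ toHomeo.source}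

section ConeChart

variable {N n : ℕ} {Y S : Set (CP N)} [ChartedSpace (Cn (Fin n)) ↥(Y \ S)]
  {q : CP N} {m l : ℕ}

/-- The local embedding into `ℂ^{(m+1)(l+1)}` given by a cone chart. -/
def ConeChart.emb (ψ : ConeChart (n := n) Y S q m l) (y : ↥Y) : SegreSpace m l :=
  ((ψ.toHomeo y : ↥(cone m l)) : SegreSpace m l)

/-- Near `q` the metric `g` is the restriction, by the local embedding `ψ`, of a smooth Kähler metric
`H` on a neighbourhood `Ω` of the vertex in `ℂ^{(m+1)(l+1)}`. -/
def ConeChart.IsRestriction (ψ : ConeChart (n := n) Y S q m l) (g : SesqField n ↥(Y \ S)) : Prop :=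
  ∃ (Ω : Set (SegreSpace m l))
    (H : SegreSpace m l → Matrix (Fin (m + 1) × Fin (l + 1)) (Fin (m + 1) × Fin (l + 1)) ℂ),
    IsOpen Ω ∧ 0 ∈ Ω ∧ IsKahlerOn Ω H ∧
    ∀ y : ↥(Y \ S), incl y ∈ ψ.toHomeo.source → ψ.emb (incl y) ∈ Ω →
      ∀ v w : Tan n ↥(Y \ S) y,
        let d : Tan n ↥(Y \ S) y →L[ℂ] SegreSpace m l :=
          mfderiv 𝓘(ℂ, Cn (Fin n)) 𝓘(ℂ, SegreSpace m l) (fun y' => ψ.emb (incl y')) y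
        g y v w = ∑ α, ∑ β, H (ψ.emb (incl y)) α β * d v α * conj (d w β)

/-- Over the domain of the cone chart `ψ`, the map `φ : X → Y` is identified with the contraction of
`blowUp m l` to the cone: there is `Θ = ([Z],[W])` such that `(ψ ∘ φ, Θ)` is biholomorphic from the
preimage of the domain onto the part of `blowUp m l` over the image of `ψ`. -/
def ConeChart.IsBlowUp (ψ : ConeChart (n := n) Y S q m l) {X : Type} [TopologicalSpace X]
    [ChartedSpace (Cn (Fin n)) X] (φ : X → ↥Y) : Prop :=
  ∃ Θ : X → CP m × CP l,
    ContinuousOn Θ (φ ⁻¹' ψ.toHomeo.source) ∧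
    BijOn (fun x => (ψ.emb (φ x), Θ x)) (φ ⁻¹' ψ.toHomeo.source)
      {p | p ∈ blowUp m l ∧ p.1 ∈ Subtype.val '' ψ.toHomeo.target} ∧
    ∀ a b, IsHolImmersionOn (n := n)
      𝓘(ℂ, SegreSpace m l × (Fin (m + 1) → ℂ) × (Fin (l + 1) → ℂ))
      (fun x => (ψ.emb (φ x), CP.affine a (Θ x).1, CP.affine b (Θ x).2))
      {x | φ x ∈ ψ.toHomeo.source ∧ (Θ x).1.rep a ≠ 0 ∧ (Θ x).2.rep b ≠ 0}

end ConeChart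

/-- `φ : X → Y` is the resolution of `Y` obtained by blowing up the cone points `p_j`, and `ι` is the
inverse of `φ` over the regular part: `φ` is biholomorphic over the regular part, and near `p_j` it
is the contraction of `𝒪(-1,-1)` over `ℙ^{m_j} × ℙ^{l_j}` to the cone. -/
structure IsResolution {N n k : ℕ} {Y : Set (CP N)} {p : Fin k → CP N}
    [ChartedSpace (Cn (Fin n)) ↥(Y \ range p)] {m l : Fin k → ℕ}
    (ψ : ∀ j, ConeChart (n := n) Y (range p) (p j) (m j) (l j))
    {X : Type} [TopologicalSpace X] [ChartedSpace (Cn (Fin n)) X]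
    (φ : X → ↥Y) (ι : ↥(Y \ range p) → X) : Prop where
  continuous : Continuous φ
  section_eq : ∀ y, φ (ι y) = incl y
  range_eq : range ι = {x | (φ x : CP N) ∉ range p}
  isOpenEmbedding : IsOpenEmbedding ι
  biholomorphic : IsHolImmersionOn (n := n) 𝓘(ℂ, Cn (Fin n)) ι univ
  blowUp : ∀ j, (ψ j).IsBlowUp φ

end SegreCone

end

noncomputable section

namespace SegreCone

set_option linter.unusedSectionVars false

/-! ### The Levi form -/

section Levi

variable {E F : Type*} [NormedAddCommGroup E] [NormedSpace ℂ E] [NormedSpace ℝ E]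
  [IsScalarTower ℝ ℂ E] [NormedAddCommGroup F] [NormedSpace ℂ F] [NormedSpace ℝ F]
  [IsScalarTower ℝ ℂ F]

/-- The complex Hessian `∂∂̄f(v, w̄)`. -/
def levi (f : E → ℂ) (z v w : E) : ℂ :=
  (1 / 4) * (fderiv ℝ (fderiv ℝ f) z v w
    + fderiv ℝ (fderiv ℝ f) z (Complex.I • v) (Complex.I • w)
    + Complex.I * (fderiv ℝ (fderiv ℝ f) z v (Complex.I • w)
      - fderiv ℝ (fderiv ℝ f) z (Complex.I • v) w))

/-- The complex linear part of the derivative. -/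
def delC (f : E → ℂ) (z v : E) : ℂ :=
  (1 / 2) * (fderiv ℝ f z v - Complex.I * fderiv ℝ f z (Complex.I • v))

lemma levi_congr {f g : E → ℂ} {z : E} (h : f =ᶠ[𝓝 z] g) (v w : E) :
    levi f z v w = levi g z v w := by
  have : fderiv ℝ f =ᶠ[𝓝 z] fderiv ℝ g := h.fderiv
  simp only [levi, this.fderiv_eq]

lemma delC_congr {f g : E → ℂ} {z : E} (h : f =ᶠ[𝓝 z] g) (v : E) :
    delC f z v = delC g z v := by
  simp only [delC, h.fderiv_eq]

lemma real_smul_apply_eq {f : E →L[ℝ] ℂ} (a b : ℝ) (v : E) :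
    f (((a : ℂ) + b * Complex.I) • v) = a * f v + b * f (Complex.I • v) := by
  have h1 : ((a : ℂ) + b * Complex.I) • v = a • v + b • (Complex.I • v) := by
    rw [add_smul, mul_smul, ← IsScalarTower.algebraMap_smul ℂ a v,
      ← IsScalarTower.algebraMap_smul ℂ b (Complex.I • v)]; rfl
  rw [h1, map_add, map_smul, map_smul, Complex.real_smul, Complex.real_smul]

lemma delC_add_right (f : E → ℂ) (z v v' : E) : delC f z (v + v') = delC f z v + delC f z v' := by
  simp only [delC, smul_add, map_add]; ring

lemma I_smul_I_smul (v : E) : Complex.I • Complex.I • v = -v := by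
  rw [smul_smul, Complex.I_mul_I, neg_one_smul]

lemma delC_smul_right (f : E → ℂ) (z : E) (c : ℂ) (v : E) :
    delC f z (c • v) = c * delC f z v := by
  have h : ∀ v, fderiv ℝ f z (c • v) = c.re * fderiv ℝ f z v + c.im * fderiv ℝ f z (Complex.I • v) :=
    fun v => by conv_lhs => rw [← Complex.re_add_im c]; exact real_smul_apply_eq _ _ _
  have h2 : Complex.I • c • v = c • Complex.I • v := smul_comm _ _ _
  simp only [delC, h2, h, I_smul_I_smul, map_neg]
  conv_rhs => rw [← Complex.re_add_im c]
  linear_combination (1/2 * (c.im : ℂ) * fderiv ℝ f z (Complex.I • v)) * Complex.I_mul_I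

lemma levi_add_left (f : E → ℂ) (z v v' w : E) :
    levi f z (v + v') w = levi f z v w + levi f z v' w := by
  simp only [levi, smul_add, map_add, _root_.add_apply]; ring

lemma levi_add_right (f : E → ℂ) (z v w w' : E) :
    levi f z v (w + w') = levi f z v w + levi f z v w' := by
  simp only [levi, smul_add, map_add]; ring

lemma levi_smul_left (f : E → ℂ) (z : E) (c : ℂ) (v w : E) :
    levi f z (c • v) w = c * levi f z v w := by
  have h : ∀ v w, fderiv ℝ (fderiv ℝ f) z (c • v) w
      = c.re * fderiv ℝ (fderiv ℝ f) z v w + c.im * fderiv ℝ (fderiv ℝ f) z (Complex.I • v) w :=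
    fun v w => by
      conv_lhs => rw [← Complex.re_add_im c]
      exact real_smul_apply_eq (f := (fderiv ℝ (fderiv ℝ f) z).flip w) _ _ _
  have h2 : Complex.I • c • v = c • Complex.I • v := smul_comm _ _ _
  simp only [levi, h2, h, I_smul_I_smul, map_neg, _root_.neg_apply]
  conv_rhs => rw [← Complex.re_add_im c]
  linear_combination (-1/4 * (c.im : ℂ) * (fderiv ℝ (fderiv ℝ f) z v (Complex.I • w)
    - fderiv ℝ (fderiv ℝ f) z (Complex.I • v) w)) * Complex.I_mul_I

lemma levi_smul_right (f : E → ℂ) (z : E) (c : ℂ) (v w : E) :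
    levi f z v (c • w) = conj c * levi f z v w := by
  have h : ∀ v w, fderiv ℝ (fderiv ℝ f) z v (c • w)
      = c.re * fderiv ℝ (fderiv ℝ f) z v w + c.im * fderiv ℝ (fderiv ℝ f) z v (Complex.I • w) :=
    fun v w => by
      conv_lhs => rw [← Complex.re_add_im c]
      exact real_smul_apply_eq _ _ _
  have h2 : Complex.I • c • w = c • Complex.I • w := smul_comm _ _ _
  have h3 : conj c = (c.re : ℂ) - c.im * Complex.I := by
    apply Complex.ext <;> simp
  simp only [levi, h2, h, I_smul_I_smul, map_neg, h3]
  linear_combination (1/4 * (c.im : ℂ) * (fderiv ℝ (fderiv ℝ f) z v (Complex.I • w)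
    - fderiv ℝ (fderiv ℝ f) z (Complex.I • v) w)) * Complex.I_mul_I

lemma fderiv_fderiv_apply {f : E → ℂ} {z : E} (hf : ContDiffAt ℝ 2 f z) (v w : E) :
    fderiv ℝ (fun z' => fderiv ℝ f z' w) z v = fderiv ℝ (fderiv ℝ f) z v w := by
  have h1 : DifferentiableAt ℝ (fderiv ℝ f) z :=
    (hf.fderiv_right (m := 1) le_rfl).differentiableAt one_ne_zero
  have h2 := h1.hasFDerivAt.clm_apply (hasFDerivAt_const w z)
  rw [h2.fderiv]; simp

lemma fderiv_fderiv_comm {f : E → ℂ} {z : E} (hf : ContDiffAt ℝ 2 f z) (v w : E) :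
    fderiv ℝ (fderiv ℝ f) z v w = fderiv ℝ (fderiv ℝ f) z w v :=
  (hf.isSymmSndFDerivAt (by simp)).eq v w

lemma delC_dbarC {f : E → ℂ} {z : E} (hf : ContDiffAt ℝ 2 f z) (v w : E) :
    delC (fun z' => (1 / 2) * (fderiv ℝ f z' w + Complex.I * fderiv ℝ f z' (Complex.I • w))) z v
      = levi f z v w := by
  have h1 : DifferentiableAt ℝ (fderiv ℝ f) z :=
    (hf.fderiv_right (m := 1) le_rfl).differentiableAt one_ne_zero
  have hd : ∀ w, HasFDerivAt (fun z' => fderiv ℝ f z' w) (fderiv ℝ (fun z' => fderiv ℝ f z' w) z) z :=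
    fun w => (h1.clm_apply (differentiableAt_const w)).hasFDerivAt
  have h2 := ((hd w).add ((hd (Complex.I • w)).const_mul Complex.I)).const_mul (1 / 2 : ℂ)
  have h3 : ∀ u, fderiv ℝ (fun z' => (1 / 2 : ℂ) * (fderiv ℝ f z' w
      + Complex.I * fderiv ℝ f z' (Complex.I • w))) z u = (1 / 2) * (fderiv ℝ (fderiv ℝ f) z u w
      + Complex.I * fderiv ℝ (fderiv ℝ f) z u (Complex.I • w)) := by
    intro u
    have := congrArg (fun L => L u) h2.fderiv
    simp only [_root_.smul_apply, _root_.add_apply, smul_eq_mul,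
      fderiv_fderiv_apply hf] at this
    exact this
  simp only [delC, h3, levi]
  linear_combination (-1/4 * fderiv ℝ (fderiv ℝ f) z (Complex.I • v) (Complex.I • w)) *
    Complex.I_mul_I

lemma levi_symm {f : E → ℂ} {z : E} (hf : ContDiffAt ℝ 2 f z) (hr : ∀ᶠ z' in 𝓝 z, conj (f z') = f z')
    (v w : E) : conj (levi f z v w) = levi f z w v := by
  have h1 : fderiv ℝ f =ᶠ[𝓝 z] fun z' => (Complex.conjCLE : ℂ →L[ℝ] ℂ).comp (fderiv ℝ f z') := by
    have h0 : ∀ᶠ z' in 𝓝 z, ContDiffAt ℝ 2 f z' := hf.eventually (by simp)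
    filter_upwards [hr.eventually_nhds, h0] with z' h h'
    have h2 : f =ᶠ[𝓝 z'] fun y => Complex.conjCLE (f y) := h.mono fun y hy => hy.symm
    refine h2.fderiv_eq.trans ?_
    exact ((Complex.conjCLE : ℂ →L[ℝ] ℂ).hasFDerivAt.comp z'
      (h'.differentiableAt two_ne_zero).hasFDerivAt).fderiv
  have hd : DifferentiableAt ℝ (fderiv ℝ f) z :=
    (hf.fderiv_right (m := 1) le_rfl).differentiableAt one_ne_zero
  have h2 : ∀ v w, conj (fderiv ℝ (fderiv ℝ f) z v w) = fderiv ℝ (fderiv ℝ f) z v w := by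
    intro v w
    have h3 := (hasFDerivAt_const (Complex.conjCLE : ℂ →L[ℝ] ℂ) z).clm_comp hd.hasFDerivAt
    have := congrArg (fun L => L v w) (h1.fderiv_eq.trans h3.fderiv)
    simpa using this.symm
  simp only [levi, map_mul, map_add, map_sub, h2, Complex.conj_I, map_div₀, map_one, map_ofNat]
  rw [fderiv_fderiv_comm hf v w, fderiv_fderiv_comm hf (Complex.I • v) (Complex.I • w),
    fderiv_fderiv_comm hf v (Complex.I • w), fderiv_fderiv_comm hf (Complex.I • v) w]
  ring

lemma delC_comm {f : E → ℂ} {z : E} (hf : ContDiffAt ℝ 2 f z) (v w : E) :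
    delC (fun z' => delC f z' v) z w = delC (fun z' => delC f z' w) z v := by
  have h1 : DifferentiableAt ℝ (fderiv ℝ f) z :=
    (hf.fderiv_right (m := 1) le_rfl).differentiableAt one_ne_zero
  have hd : ∀ w, HasFDerivAt (fun z' => fderiv ℝ f z' w) (fderiv ℝ (fun z' => fderiv ℝ f z' w) z) z :=
    fun w => (h1.clm_apply (differentiableAt_const w)).hasFDerivAt
  have h3 : ∀ w u, fderiv ℝ (fun z' => delC f z' w) z u = (1 / 2) * (fderiv ℝ (fderiv ℝ f) z u w
      - Complex.I * fderiv ℝ (fderiv ℝ f) z u (Complex.I • w)) := by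
    intro w u
    have h2 := ((hd w).sub ((hd (Complex.I • w)).const_mul Complex.I)).const_mul (1 / 2 : ℂ)
    have := congrArg (fun L => L u) h2.fderiv
    simp only [_root_.smul_apply, _root_.sub_apply, smul_eq_mul,
      fderiv_fderiv_apply hf] at this
    exact this
  rw [delC, delC, h3, h3, h3, h3]
  rw [fderiv_fderiv_comm hf v w, fderiv_fderiv_comm hf (Complex.I • v) (Complex.I • w),
    fderiv_fderiv_comm hf v (Complex.I • w), fderiv_fderiv_comm hf (Complex.I • v) w]
  ring

lemma fderiv_real_eq {h : E → F} {z : E} (hh : DifferentiableAt ℂ h z) :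
    fderiv ℝ h z = (fderiv ℂ h z).restrictScalars ℝ :=
  (hh.hasFDerivAt.restrictScalars ℝ).fderiv

lemma delC_comp {f : F → ℂ} {h : E → F} {z : E} (hf : DifferentiableAt ℝ f (h z))
    (hh : DifferentiableAt ℂ h z) (v : E) :
    delC (fun z => f (h z)) z v = delC f (h z) (fderiv ℂ h z v) := by
  have h1 := (hf.hasFDerivAt.comp z (hh.hasFDerivAt.restrictScalars ℝ)).fderiv
  have h2 : fderiv ℝ (fun z => f (h z)) z
    = (fderiv ℝ f (h z)).comp ((fderiv ℂ h z).restrictScalars ℝ) := h1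
  simp [delC, h2]

lemma delC_holo {h : E → ℂ} {z : E} (hh : DifferentiableAt ℂ h z) (v : E) :
    delC h z v = fderiv ℂ h z v := by
  simp only [delC, fderiv_real_eq hh, ContinuousLinearMap.coe_restrictScalars', map_smul, smul_eq_mul]
  linear_combination (-1/2 * fderiv ℂ h z v) * Complex.I_mul_I

lemma delC_conj_holo {h : E → ℂ} {z : E} (hh : DifferentiableAt ℂ h z) (v : E) :
    delC (fun z => conj (h z)) z v = 0 := by
  have h1 := ((Complex.conjCLE : ℂ →L[ℝ] ℂ).hasFDerivAt.comp z
    (hh.hasFDerivAt.restrictScalars ℝ)).fderiv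
  have h2 : fderiv ℝ (fun z => conj (h z)) z
    = (Complex.conjCLE : ℂ →L[ℝ] ℂ).comp ((fderiv ℂ h z).restrictScalars ℝ) := h1
  simp [delC, h2]
  linear_combination (conj (fderiv ℂ h z v)) * Complex.I_mul_I

lemma delC_mul {f g : E → ℂ} {z : E} (hf : DifferentiableAt ℝ f z) (hg : DifferentiableAt ℝ g z)
    (v : E) : delC (fun z => f z * g z) z v = delC f z v * g z + f z * delC g z v := by
  have := (hf.hasFDerivAt.mul hg.hasFDerivAt).fderiv
  have h2 : fderiv ℝ (fun z => f z * g z) z = f z • fderiv ℝ g z + g z • fderiv ℝ f z := this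
  simp only [delC, h2, _root_.add_apply, _root_.smul_apply, smul_eq_mul]
  ring

lemma delC_sum {κ : Type*} (s : Finset κ) {f : κ → E → ℂ} {z : E}
    (hf : ∀ i ∈ s, DifferentiableAt ℝ (f i) z) (v : E) :
    delC (fun z => ∑ i ∈ s, f i z) z v = ∑ i ∈ s, delC (f i) z v := by
  simp only [delC, fderiv_fun_sum hf, _root_.sum_apply, Finset.mul_sum,
    ← Finset.sum_sub_distrib]

lemma levi_comp {f : F → ℂ} {h : E → F} {z : E} (hf : ContDiffAt ℝ 2 f (h z))
    (hh : ContDiffAt ℂ 2 h z) (v w : E) :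
    levi (fun z => f (h z)) z v w = levi f (h z) (fderiv ℂ h z v) (fderiv ℂ h z w) := by
  have e1 : fderiv ℝ (fun z => f (h z)) =ᶠ[𝓝 z]
      fun z' => (fderiv ℝ f (h z')).comp ((fderiv ℂ h z').restrictScalars ℝ) := by
    have h0 : ∀ᶠ z' in 𝓝 z, ContDiffAt ℝ 2 f (h z') :=
      hh.continuousAt.eventually (hf.eventually (by simp))
    filter_upwards [h0, hh.eventually (by simp)] with z' h1 h2
    exact ((h1.differentiableAt two_ne_zero).hasFDerivAt.comp z'
      ((h2.differentiableAt two_ne_zero).hasFDerivAt.restrictScalars ℝ)).fderiv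
  have d1 : DifferentiableAt ℝ (fderiv ℝ f) (h z) :=
    (hf.fderiv_right (m := 1) le_rfl).differentiableAt one_ne_zero
  have d2 : DifferentiableAt ℂ (fderiv ℂ h) z :=
    (hh.fderiv_right (m := 1) le_rfl).differentiableAt one_ne_zero
  have d3 : HasFDerivAt h ((fderiv ℂ h z).restrictScalars ℝ) z :=
    (hh.differentiableAt two_ne_zero).hasFDerivAt.restrictScalars ℝ
  have key : ∀ v w, fderiv ℝ (fderiv ℝ (fun z => f (h z))) z v w
      = fderiv ℝ (fderiv ℝ f) (h z) (fderiv ℂ h z v) (fderiv ℂ h z w)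
        + fderiv ℝ f (h z) (fderiv ℂ (fderiv ℂ h) z v w) := by
    intro v w
    have e2 : ∀ᶠ z' in 𝓝 z, fderiv ℝ (fun z => f (h z)) z' w
        = fderiv ℝ f (h z') (fderiv ℂ h z' w) := e1.mono fun z' hz' => by rw [hz']; rfl
    have hC : ContDiffAt ℝ 2 (fun z => f (h z)) z := hf.comp z (hh.restrict_scalars ℝ)
    rw [← fderiv_fderiv_apply hC]
    rw [Filter.EventuallyEq.fderiv_eq e2]
    have h4 : HasFDerivAt (fun z' => fderiv ℂ h z' w)
        (((fderiv ℂ (fderiv ℂ h) z).flip w).restrictScalars ℝ) z := by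
      have := (d2.hasFDerivAt.clm_apply (hasFDerivAt_const w z)).restrictScalars ℝ
      refine this.congr_fderiv ?_
      ext v; simp
    have h5 := (d1.hasFDerivAt.comp z d3).clm_apply h4
    have h6 : fderiv ℝ (fun z' => fderiv ℝ f (h z') (fderiv ℂ h z' w)) z = _ := h5.fderiv
    rw [h6]
    simp [add_comm]
  simp only [levi, key, map_smul, _root_.smul_apply, I_smul_I_smul, map_neg]
  ring

lemma levi_re_holo {h : E → ℂ} {z : E} (hh : ContDiffAt ℂ 2 h z) (c d : ℝ) (v w : E) :
    levi (fun z => ((c + d * (h z).re : ℝ) : ℂ)) z v w = 0 := by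
  have hL : ∀ y : ℂ, HasFDerivAt (fun y : ℂ => ((c + d * y.re : ℝ) : ℂ))
      (d • (Complex.ofRealCLM.comp Complex.reCLM)) y := by
    intro y
    have h1 : HasFDerivAt (fun y : ℂ => c + d * y.re) (d • Complex.reCLM) y :=
      (Complex.reCLM.hasFDerivAt.const_mul d).const_add c
    refine (Complex.ofRealCLM.hasFDerivAt.comp y h1).congr_fderiv ?_
    ext v; simp
  have h1 : ContDiff ℝ 2 (fun y : ℂ => ((c + d * y.re : ℝ) : ℂ)) := by
    refine Complex.ofRealCLM.contDiff.comp (contDiff_const.add (contDiff_const.mul Complex.reCLM.contDiff))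
  have h2 := levi_comp (h1.contDiffAt (x := h z)) hh v w
  rw [h2]
  have h3 : fderiv ℝ (fun y : ℂ => ((c + d * y.re : ℝ) : ℂ))
      = fun _ => d • (Complex.ofRealCLM.comp Complex.reCLM) := funext fun y => (hL y).fderiv
  simp only [levi, h3]
  simp

lemma levi_log_normSq {h : E → ℂ} {z : E} (hh : ContDiffAt ℂ 2 h z) (h0 : h z ≠ 0) (v w : E) :
    levi (fun z => ((Real.log (Complex.normSq (h z)) : ℝ) : ℂ)) z v w = 0 := by
  have hq : ContDiffAt ℂ 2 (fun z' => Complex.log (h z' / h z)) z := by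
    refine ContDiffAt.comp (g := Complex.log) z (Complex.contDiffAt_log ?_) (hh.div_const (h z))
    simp [h0]
  have h1 : (fun z' => ((Real.log (Complex.normSq (h z')) : ℝ) : ℂ)) =ᶠ[𝓝 z]
      fun z' => ((Real.log (Complex.normSq (h z)) + 2 * (Complex.log (h z' / h z)).re : ℝ) : ℂ) := by
    filter_upwards [hh.continuousAt.eventually_ne h0] with z' hz'
    rw [Complex.log_re, norm_div, Real.log_div (by simpa using hz') (by simpa using h0),
      Complex.normSq_eq_norm_sq, Complex.normSq_eq_norm_sq, Real.log_pow, Real.log_pow]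
    congr 1; push_cast; ring
  rw [levi_congr h1]
  exact levi_re_holo hq _ _ v w

lemma levi_add {f g : E → ℂ} {z : E} (hf : ContDiffAt ℝ 2 f z) (hg : ContDiffAt ℝ 2 g z) (v w : E) :
    levi (fun z => f z + g z) z v w = levi f z v w + levi g z v w := by
  have e1 : fderiv ℝ (fun z => f z + g z) =ᶠ[𝓝 z] fun z' => fderiv ℝ f z' + fderiv ℝ g z' := by
    filter_upwards [hf.eventually (by simp), hg.eventually (by simp)] with z' h1 h2
    exact fderiv_fun_add (h1.differentiableAt two_ne_zero) (h2.differentiableAt two_ne_zero)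
  have d1 : DifferentiableAt ℝ (fderiv ℝ f) z :=
    (hf.fderiv_right (m := 1) le_rfl).differentiableAt one_ne_zero
  have d2 : DifferentiableAt ℝ (fderiv ℝ g) z :=
    (hg.fderiv_right (m := 1) le_rfl).differentiableAt one_ne_zero
  simp only [levi, e1.fderiv_eq, fderiv_fun_add d1 d2, _root_.add_apply]
  ring

lemma ContDiffAt.levi {f : E → ℂ} {z : E} (hf : ContDiffAt ℝ ∞ f z) (v w : E) :
    ContDiffAt ℝ ∞ (fun z => levi f z v w) z := by
  have h1 : ContDiffAt ℝ ∞ (fderiv ℝ (fderiv ℝ f)) z :=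
    (hf.fderiv_right (m := ∞) le_rfl).fderiv_right (m := ∞) le_rfl
  have h2 : ∀ v w, ContDiffAt ℝ ∞ (fun z => fderiv ℝ (fderiv ℝ f) z v w) z := fun v w =>
    (h1.clm_apply contDiffAt_const).clm_apply contDiffAt_const
  unfold SegreCone.levi
  exact contDiffAt_const.mul (((h2 _ _).add (h2 _ _)).add
    (contDiffAt_const.mul ((h2 _ _).sub (h2 _ _))))

end Levi

section Wirtinger

variable {ι : Type} [Fintype ι] [DecidableEq ι]

lemma single_I (a : ι) : (EuclideanSpace.single a Complex.I : Cn ι)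
    = Complex.I • EuclideanSpace.single a (1 : ℂ) := by
  ext b; by_cases h : b = a <;> simp [h]

lemma wirt_eq_delC (a : ι) (f : Cn ι → ℂ) (z : Cn ι) :
    wirt a f z = delC f z (EuclideanSpace.single a 1) := by
  rw [wirt, delC, single_I]

lemma wirt_wirtBar {f : Cn ι → ℂ} {z : Cn ι} (hf : ContDiffAt ℝ 2 f z) (a b : ι) :
    wirt a (wirtBar b f) z
      = levi f z (EuclideanSpace.single a 1) (EuclideanSpace.single b 1) := by
  rw [wirt_eq_delC, ← delC_dbarC hf]
  congr 1
  ext z'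
  rw [wirtBar, single_I]

end Wirtinger

/-! ### Kähler metrics in coordinates and their pullbacks -/

section Pullback

variable {ι κ : Type} [Fintype ι] [Fintype κ]

/-- The coordinate functional. -/
def coordCLM (a : ι) : Cn ι →L[ℂ] ℂ := EuclideanSpace.proj a

@[simp] lemma coordCLM_apply (a : ι) (v : Cn ι) : coordCLM a v = v a := rfl

/-- The sesquilinear form with matrix `G`. -/
def sesq (G : Matrix ι ι ℂ) (v w : Cn ι) : ℂ := ∑ a, ∑ b, G a b * v a * conj (w b)

lemma sesq_add_left (G : Matrix ι ι ℂ) (v v' w : Cn ι) :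
    sesq G (v + v') w = sesq G v w + sesq G v' w := by
  simp only [sesq, PiLp.add_apply, mul_add, add_mul, Finset.sum_add_distrib]

lemma sesq_add_right (G : Matrix ι ι ℂ) (v w w' : Cn ι) :
    sesq G v (w + w') = sesq G v w + sesq G v w' := by
  simp only [sesq, PiLp.add_apply, map_add, mul_add, Finset.sum_add_distrib]

lemma sesq_smul_left (G : Matrix ι ι ℂ) (c : ℂ) (v w : Cn ι) :
    sesq G (c • v) w = c * sesq G v w := by
  simp only [sesq, PiLp.smul_apply, smul_eq_mul, Finset.mul_sum]
  exact Finset.sum_congr rfl fun a _ => Finset.sum_congr rfl fun b _ => by ring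

lemma sesq_smul_right (G : Matrix ι ι ℂ) (c : ℂ) (v w : Cn ι) :
    sesq G v (c • w) = conj c * sesq G v w := by
  simp only [sesq, PiLp.smul_apply, smul_eq_mul, Finset.mul_sum, map_mul]
  exact Finset.sum_congr rfl fun a _ => Finset.sum_congr rfl fun b _ => by ring

lemma sesq_add_matrix (G H : Matrix ι ι ℂ) (v w : Cn ι) :
    sesq (G + H) v w = sesq G v w + sesq H v w := by
  simp only [sesq, Matrix.add_apply, add_mul, Finset.sum_add_distrib]

lemma sesq_smul_matrix (c : ℂ) (G : Matrix ι ι ℂ) (v w : Cn ι) :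
    sesq (c • G) v w = c * sesq G v w := by
  simp only [sesq, Matrix.smul_apply, smul_eq_mul, Finset.mul_sum]
  exact Finset.sum_congr rfl fun a _ => Finset.sum_congr rfl fun b _ => by ring

variable [DecidableEq ι] [DecidableEq κ]

lemma sesq_single (G : Matrix ι ι ℂ) (a b : ι) :
    sesq G (EuclideanSpace.single a 1) (EuclideanSpace.single b 1) = G a b := by
  simp [sesq, Finset.sum_ite_eq', apply_ite]

lemma euclidean_sum_single (v : Cn ι) : ∑ a, v a • EuclideanSpace.single a (1 : ℂ) = v := by
  ext b
  simp [Finset.sum_apply, Pi.single_apply]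

/-- A sesquilinear function is determined by its matrix. -/
lemma sesq_of_sesquilinear (f : Cn ι → Cn ι → ℂ)
    (h1 : ∀ v v' w, f (v + v') w = f v w + f v' w) (h2 : ∀ c v w, f (c • v) w = c * f v w)
    (h3 : ∀ v w w', f v (w + w') = f v w + f v w') (h4 : ∀ c v w, f v (c • w) = conj c * f v w)
    (v w : Cn ι) :
    f v w = sesq (fun a b => f (EuclideanSpace.single a 1) (EuclideanSpace.single b 1)) v w := by
  have z1 : ∀ w, f 0 w = 0 := fun w => by simpa using h2 0 0 w
  have z2 : ∀ v, f v 0 = 0 := fun v => by simpa using h4 0 v 0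
  have s1 : ∀ (s : Finset ι) (u : ι → Cn ι) w, f (∑ i ∈ s, u i) w = ∑ i ∈ s, f (u i) w := by
    intro s u w
    induction s using Finset.induction_on with
    | empty => simpa using z1 w
    | insert a s ha ih => rw [Finset.sum_insert ha, Finset.sum_insert ha, h1, ih]
  have s2 : ∀ (s : Finset ι) v (u : ι → Cn ι), f v (∑ i ∈ s, u i) = ∑ i ∈ s, f v (u i) := by
    intro s v u
    induction s using Finset.induction_on with
    | empty => simpa using z2 v
    | insert a s ha ih => rw [Finset.sum_insert ha, Finset.sum_insert ha, h3, ih]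
  conv_lhs => rw [← euclidean_sum_single v, ← euclidean_sum_single w]
  rw [s1]
  refine Finset.sum_congr rfl fun a _ => ?_
  rw [s2]
  refine Finset.sum_congr rfl fun b _ => ?_
  rw [h2, h4]; ring

lemma posDef_iff_sesq {G : Matrix ι ι ℂ} :
    G.PosDef ↔ G.IsHermitian ∧ ∀ v : Cn ι, v ≠ 0 → 0 < (sesq G v v).re := by
  have key : ∀ v : Cn ι, star (star (v : ι → ℂ)) ⬝ᵥ (G.mulVec (star (v : ι → ℂ))) = sesq G v v := by
    intro v
    simp only [star_star, dotProduct, Matrix.mulVec, sesq, Finset.mul_sum, Pi.star_apply]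
    exact Finset.sum_congr rfl fun a _ => Finset.sum_congr rfl fun b _ => by
      rw [starRingEnd_apply]; ring
  rw [Matrix.posDef_iff_dotProduct_mulVec]
  refine and_congr_right fun hH => ⟨fun h v hv => ?_, fun h x hx => ?_⟩
  · have h1 : star (v : ι → ℂ) ≠ 0 := by
      rw [Ne, star_eq_zero]
      exact fun h0 => hv (by ext a; exact congrFun h0 a)
    have h2 := h h1
    rw [key] at h2
    exact (Complex.pos_iff.1 h2).1
  · have h1 : (WithLp.toLp 2 (star x) : Cn ι) ≠ 0 := by
      intro h0
      apply hx
      have : star x = 0 := by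
        ext a; exact congrArg (fun u : Cn ι => u a) h0
      exact star_eq_zero.1 this
    have h2 := h _ h1
    rw [← key] at h2
    simp only [star_star] at h2
    have h3 : (star x ⬝ᵥ G.mulVec x).im = 0 := by
      have := hH.im_star_dotProduct_mulVec_self x
      simpa using this
    exact Complex.pos_iff.2 ⟨h2, h3.symm⟩

lemma sesq_conj {G : Matrix ι ι ℂ} (hG : G.IsHermitian) (v w : Cn ι) :
    conj (sesq G v w) = sesq G w v := by
  simp only [sesq, map_sum, map_mul, Complex.conj_conj]
  rw [Finset.sum_comm]
  refine Finset.sum_congr rfl fun a _ => Finset.sum_congr rfl fun b _ => ?_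
  have : conj (G b a) = G a b := hG.apply a b
  rw [this]; ring

/-- The pullback of the matrix field `G` by `h`. -/
def pullMat (G : Cn κ → Matrix κ κ ℂ) (h : Cn ι → Cn κ) (z : Cn ι) : Matrix ι ι ℂ := fun a b =>
  sesq (G (h z)) (fderiv ℂ h z (EuclideanSpace.single a 1))
    (fderiv ℂ h z (EuclideanSpace.single b 1))

lemma sesq_pullMat (G : Cn κ → Matrix κ κ ℂ) (h : Cn ι → Cn κ) (z v w : Cn ι) :
    sesq (pullMat G h z) v w = sesq (G (h z)) (fderiv ℂ h z v) (fderiv ℂ h z w) := by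
  symm
  refine sesq_of_sesquilinear (fun v w => sesq (G (h z)) (fderiv ℂ h z v) (fderiv ℂ h z w))
    ?_ ?_ ?_ ?_ v w
  · intro v v' w; simp only [map_add, sesq_add_left]
  · intro c v w; simp only [map_smul, sesq_smul_left]
  · intro v w w'; simp only [map_add, sesq_add_right]
  · intro c v w; simp only [map_smul, sesq_smul_right]

/-- `G` is a Kähler metric at the point `z`. -/
structure IsKahlerAt (G : Cn ι → Matrix ι ι ℂ) (z : Cn ι) : Prop where
  smooth : ∀ a b, ContDiffAt ℝ ∞ (fun z => G z a b) z
  posDef : (G z).PosDef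
  closed : ∀ a b c, wirt c (fun w => G w a b) z = wirt a (fun w => G w c b) z

lemma isKahlerOn_iff {Ω : Set (Cn ι)} (hΩ : IsOpen Ω) {G : Cn ι → Matrix ι ι ℂ} :
    IsKahlerOn Ω G ↔ ∀ z ∈ Ω, IsKahlerAt G z :=
  ⟨fun h z hz => ⟨fun a b => (h.smooth a b).contDiffAt (hΩ.mem_nhds hz), h.posDef z hz,
    h.closed z hz⟩, fun h => ⟨fun a b z hz => ((h z hz).smooth a b).contDiffWithinAt,
    fun z hz => (h z hz).posDef, fun z hz => (h z hz).closed⟩⟩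

lemma IsKahlerAt.congr {G G' : Cn ι → Matrix ι ι ℂ} {z : Cn ι} (h : IsKahlerAt G z)
    (hG : G' =ᶠ[𝓝 z] G) : IsKahlerAt G' z where
  smooth a b := (h.smooth a b).congr_of_eventuallyEq (hG.mono fun w hw => by simp only [hw])
  posDef := by rw [hG.self_of_nhds]; exact h.posDef
  closed a b c := by
    have e : ∀ a b, (fun w => G' w a b) =ᶠ[𝓝 z] fun w => G w a b :=
      fun a b => hG.mono fun w hw => by simp only [hw]
    rw [wirt_eq_delC, wirt_eq_delC, delC_congr (e a b), delC_congr (e c b), ← wirt_eq_delC,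
      ← wirt_eq_delC]
    exact h.closed a b c

lemma ContDiffAt.sesq {E : Type*} [NormedAddCommGroup E] [NormedSpace ℝ E] {n : WithTop ℕ∞}
    {G : E → Matrix ι ι ℂ} {v w : E → Cn ι} {z : E} (hG : ∀ a b, ContDiffAt ℝ n (fun z => G z a b) z)
    (hv : ContDiffAt ℝ n v z) (hw : ContDiffAt ℝ n w z) :
    ContDiffAt ℝ n (fun z => sesq (G z) (v z) (w z)) z := by
  have hv' : ∀ a, ContDiffAt ℝ n (fun z => v z a) z := fun a =>
    ((coordCLM a).restrictScalars ℝ).contDiff.contDiffAt.comp z hv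
  have hw' : ∀ a, ContDiffAt ℝ n (fun z => (starRingEnd ℂ) (w z a)) z := fun a =>
    (Complex.conjCLE : ℂ →L[ℝ] ℂ).contDiff.contDiffAt.comp z
    (((coordCLM a).restrictScalars ℝ).contDiff.contDiffAt.comp z hw)
  exact ContDiffAt.sum fun a _ => ContDiffAt.sum fun b _ => ((hG a b).mul (hv' a)).mul (hw' b)

lemma contDiffAt_fderiv_apply {E F : Type*} [NormedAddCommGroup E] [NormedSpace ℂ E]
    [NormedAddCommGroup F] [NormedSpace ℂ F] [CompleteSpace F]
    {h : E → F} {z : E} (hh : ContDiffAt ℂ ω h z) (v : E) :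
    ContDiffAt ℂ ω (fun z => fderiv ℂ h z v) z :=
  (hh.fderiv_right (m := ω) le_rfl).clm_apply contDiffAt_const

lemma contDiffAt_pullMat {G : Cn κ → Matrix κ κ ℂ} {h : Cn ι → Cn κ} {z : Cn ι}
    (hG : ∀ a b, ContDiffAt ℝ ∞ (fun z => G z a b) (h z)) (hh : ContDiffAt ℂ ω h z) (a b : ι) :
    ContDiffAt ℝ ∞ (fun z => pullMat G h z a b) z :=
  ContDiffAt.sesq
    (fun a b => (hG a b).comp z ((hh.restrict_scalars ℝ).of_le le_top))
    (((contDiffAt_fderiv_apply hh _).restrict_scalars ℝ).of_le le_top)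
    (((contDiffAt_fderiv_apply hh _).restrict_scalars ℝ).of_le le_top)

lemma posDef_pullMat {G : Cn κ → Matrix κ κ ℂ} {h : Cn ι → Cn κ} {z : Cn ι}
    (hG : (G (h z)).PosDef) (hi : Function.Injective (fderiv ℂ h z)) : (pullMat G h z).PosDef := by
  rw [posDef_iff_sesq] at hG ⊢
  refine ⟨?_, fun v hv => ?_⟩
  · ext a b
    simp only [Matrix.conjTranspose_apply, pullMat]
    exact sesq_conj hG.1 _ _
  · rw [sesq_pullMat]
    exact hG.2 _ fun h0 => hv (hi (by rw [h0, map_zero]))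

lemma closed_sesq {G : Cn ι → Matrix ι ι ℂ} {z : Cn ι}
    (hG : ∀ a b c, wirt c (fun w => G w a b) z = wirt a (fun w => G w c b) z) (u v w : Cn ι) :
    ∑ a, ∑ b, delC (fun w => G w a b) z u * v a * conj (w b)
      = ∑ a, ∑ b, delC (fun w => G w a b) z v * u a * conj (w b) := by
  have key : ∀ (u v : Cn ι) (b : ι), ∑ a, delC (fun w => G w a b) z u * v a
      = ∑ a, ∑ c, u c * v a * wirt c (fun w => G w a b) z := by
    intro u v b
    refine Finset.sum_congr rfl fun a _ => ?_
    have : delC (fun w => G w a b) z u = ∑ c, u c * wirt c (fun w => G w a b) z := by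
      conv_lhs => rw [← euclidean_sum_single u]
      have hs : ∀ s : Finset ι, delC (fun w => G w a b) z
          (∑ c ∈ s, u c • EuclideanSpace.single c (1 : ℂ))
          = ∑ c ∈ s, u c * wirt c (fun w => G w a b) z := by
        intro s
        induction s using Finset.induction_on with
        | empty => simpa using delC_smul_right (fun w => G w a b) z 0 0
        | insert c s hc ih =>
          rw [Finset.sum_insert hc, Finset.sum_insert hc, delC_add_right, ih, delC_smul_right,
            wirt_eq_delC]
      exact hs _
    rw [this, Finset.sum_mul]
    exact Finset.sum_congr rfl fun c _ => by ring
  rw [Finset.sum_comm, Finset.sum_comm (s := Finset.univ) (t := Finset.univ)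
    (f := fun a b => delC (fun w => G w a b) z v * u a * conj (w b))]
  refine Finset.sum_congr rfl fun b _ => ?_
  rw [← Finset.sum_mul, ← Finset.sum_mul, key, key, Finset.sum_comm]
  congr 1
  refine Finset.sum_congr rfl fun a _ => Finset.sum_congr rfl fun c _ => ?_
  rw [hG c b a]; ring

lemma closed_pullMat {G : Cn κ → Matrix κ κ ℂ} {h : Cn ι → Cn κ} {z : Cn ι}
    (hs : ∀ a b, ContDiffAt ℝ ∞ (fun z => G z a b) (h z))
    (hG : ∀ a b c, wirt c (fun w => G w a b) (h z) = wirt a (fun w => G w c b) (h z))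
    (hh : ContDiffAt ℂ ω h z) (a b c : ι) :
    wirt c (fun w => pullMat G h w a b) z = wirt a (fun w => pullMat G h w c b) z := by
  have hd : DifferentiableAt ℂ h z := hh.differentiableAt (by simp)
  have hdG : ∀ α β, DifferentiableAt ℝ (fun w => G w α β) (h z) :=
    fun α β => (hs α β).differentiableAt (by simp)
  have hdGh : ∀ α β, DifferentiableAt ℝ (fun w => G (h w) α β) z :=
    fun α β => (hdG α β).comp z (hd.restrictScalars ℝ)
  have d1 : ∀ v α, DifferentiableAt ℂ (fun w => fderiv ℂ h w v α) z := fun v α =>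
    (coordCLM α).differentiableAt.comp z
      ((contDiffAt_fderiv_apply hh v).differentiableAt (by simp))
  have d2 : ∀ v α, DifferentiableAt ℝ (fun w => (starRingEnd ℂ) (fderiv ℂ h w v α)) z := fun v α =>
    (Complex.conjCLE : ℂ →L[ℝ] ℂ).differentiableAt.comp z ((d1 v α).restrictScalars ℝ)
  have d3 : ∀ u v α, delC (fun w => fderiv ℂ h w v α) z u
      = (fderiv ℂ (fderiv ℂ h) z u v) α := by
    intro u v α
    rw [delC_holo (d1 v α)]
    have h1 : DifferentiableAt ℂ (fderiv ℂ h) z :=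
      (hh.fderiv_right (m := ω) le_rfl).differentiableAt (by simp)
    have h2 := (coordCLM α).hasFDerivAt.comp z
      (h1.hasFDerivAt.clm_apply (hasFDerivAt_const v z))
    have h3 : fderiv ℂ (fun w => fderiv ℂ h w v α) z = _ := h2.fderiv
    rw [h3]; simp
  have key : ∀ u v w : Cn ι, delC (fun y => sesq (G (h y)) (fderiv ℂ h y v) (fderiv ℂ h y w)) z u
      = (∑ α, ∑ β, delC (fun y => G y α β) (h z) (fderiv ℂ h z u) * fderiv ℂ h z v α
          * conj (fderiv ℂ h z w β))
        + ∑ α, ∑ β, G (h z) α β * (fderiv ℂ (fderiv ℂ h) z u v) α * conj (fderiv ℂ h z w β) := by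
    intro u v w
    have p1 : ∀ α β, DifferentiableAt ℝ (fun y => G (h y) α β * fderiv ℂ h y v α) z :=
      fun α β => (hdGh α β).mul ((d1 v α).restrictScalars ℝ)
    have p2 : ∀ α β, DifferentiableAt ℝ (fun y => G (h y) α β * fderiv ℂ h y v α
        * (starRingEnd ℂ) (fderiv ℂ h y w β)) z := fun α β => (p1 α β).mul (d2 w β)
    have p3 : ∀ α, DifferentiableAt ℝ (fun y => ∑ β, G (h y) α β * fderiv ℂ h y v α
        * (starRingEnd ℂ) (fderiv ℂ h y w β)) z := fun α =>
      DifferentiableAt.fun_sum fun β _ => p2 α β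
    simp only [sesq]
    rw [delC_sum _ (fun α _ => p3 α), ← Finset.sum_add_distrib]
    refine Finset.sum_congr rfl fun α _ => ?_
    rw [delC_sum _ (fun β _ => p2 α β), ← Finset.sum_add_distrib]
    refine Finset.sum_congr rfl fun β _ => ?_
    rw [delC_mul (p1 α β) (d2 w β),
      delC_mul (hdGh α β) ((d1 v α).restrictScalars ℝ), delC_conj_holo (d1 w β), d3,
      delC_comp (f := fun y => G y α β) (hdG α β) hd]
    ring
  rw [wirt_eq_delC, wirt_eq_delC]
  simp only [pullMat]
  rw [key, key, closed_sesq hG]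
  have hsym : fderiv ℂ (fderiv ℂ h) z (EuclideanSpace.single c 1) (EuclideanSpace.single a 1)
      = fderiv ℂ (fderiv ℂ h) z (EuclideanSpace.single a 1) (EuclideanSpace.single c 1) :=
    (hh.isSymmSndFDerivAt (by simp)).eq _ _
  rw [hsym]

lemma IsKahlerAt.pullMat {G : Cn κ → Matrix κ κ ℂ} {h : Cn ι → Cn κ} {z : Cn ι}
    (hG : IsKahlerAt G (h z)) (hh : ContDiffAt ℂ ω h z)
    (hi : Function.Injective (fderiv ℂ h z)) : IsKahlerAt (pullMat G h) z :=
  ⟨contDiffAt_pullMat hG.smooth hh, posDef_pullMat hG.posDef hi,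
    closed_pullMat hG.smooth hG.closed hh⟩

lemma two_le_infty : (2 : WithTop ℕ∞) ≤ (∞ : WithTop ℕ∞) := by
  exact WithTop.coe_le_coe.2 (le_top : (2 : ℕ∞) ≤ ⊤)

/-- The logarithm of the determinant. -/
def logDet (G : Cn ι → Matrix ι ι ℂ) (z : Cn ι) : ℂ := ((Real.log (G z).det.re : ℝ) : ℂ)

lemma contDiffAt_det {𝕜 E : Type*} [NontriviallyNormedField 𝕜] [NormedAddCommGroup E]
    [NormedSpace 𝕜 E] [NormedAlgebra 𝕜 ℂ] {n : WithTop ℕ∞} {G : E → Matrix ι ι ℂ} {z : E}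
    (hG : ∀ a b, ContDiffAt 𝕜 n (fun z => G z a b) z) :
    ContDiffAt 𝕜 n (fun z => (G z).det) z := by
  simp only [Matrix.det_apply']
  exact ContDiffAt.sum fun σ _ => contDiffAt_const.mul (contDiffAt_prod fun a _ => hG _ _)

lemma contDiffAt_logDet {n : WithTop ℕ∞} {G : Cn ι → Matrix ι ι ℂ} {z : Cn ι}
    (hG : ∀ a b, ContDiffAt ℝ n (fun z => G z a b) z) (h0 : 0 < (G z).det.re) :
    ContDiffAt ℝ n (logDet G) z := by
  have h1 : ContDiffAt ℝ n (fun z => (G z).det.re) z :=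
    Complex.reCLM.contDiff.contDiffAt.comp z (contDiffAt_det hG)
  exact Complex.ofRealCLM.contDiff.contDiffAt.comp z (h1.log h0.ne')

lemma ricciCoord_eq {G : Cn ι → Matrix ι ι ℂ} {z : Cn ι}
    (hG : ∀ a b, ContDiffAt ℝ ∞ (fun z => G z a b) z) (h0 : 0 < (G z).det.re) (a b : ι) :
    ricciCoord G z a b
      = - levi (logDet G) z (EuclideanSpace.single a 1) (EuclideanSpace.single b 1) := by
  rw [ricciCoord, ← wirt_wirtBar ((contDiffAt_logDet hG h0).of_le two_le_infty)]
  rfl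

lemma sesq_levi (f : Cn ι → ℂ) (z v w : Cn ι) :
    sesq (fun a b => levi f z (EuclideanSpace.single a 1) (EuclideanSpace.single b 1)) v w
      = levi f z v w :=
  (sesq_of_sesquilinear (levi f z) (levi_add_left f z) (fun c v w => levi_smul_left f z c v w)
    (levi_add_right f z) (fun c v w => levi_smul_right f z c v w) v w).symm

/-- The matrix of the form `G` pulled back by a linear map. -/
def pullLin (G : Matrix κ κ ℂ) (T : Cn ι →L[ℂ] Cn κ) : Matrix ι ι ℂ := fun a b =>
  sesq G (T (EuclideanSpace.single a 1)) (T (EuclideanSpace.single b 1))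

/-- The determinant of an endomorphism of `ℂ^ι`, by its standard matrix. -/
def detLin (T : Cn ι →L[ℂ] Cn ι) : ℂ :=
  (Matrix.of fun α a => T (EuclideanSpace.single a 1) α).det

lemma det_pullLin (G : Matrix ι ι ℂ) (T : Cn ι →L[ℂ] Cn ι) :
    (pullLin G T).det = G.det * Complex.normSq (detLin T) := by
  set J : Matrix ι ι ℂ := Matrix.of fun α a => T (EuclideanSpace.single a 1) α with hJ
  have : pullLin G T = J.transpose * G * J.map (starRingEnd ℂ) := by
    ext a b
    simp only [pullLin, sesq, Matrix.mul_apply, Matrix.transpose_apply, Matrix.map_apply, J,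
      Matrix.of_apply, Finset.sum_mul]
    rw [Finset.sum_comm]
    exact Finset.sum_congr rfl fun α _ => Finset.sum_congr rfl fun β _ => by ring
  have h2 : (J.map (starRingEnd ℂ)).det = conj J.det := by
    rw [RingHom.map_det]; rfl
  rw [this, Matrix.det_mul, Matrix.det_mul, Matrix.det_transpose, h2, ← Complex.mul_conj, detLin,
    ← hJ]
  ring

lemma detLin_ne_zero {T : Cn ι →L[ℂ] Cn ι} (hi : Function.Injective T) : detLin T ≠ 0 := by
  intro h0
  obtain ⟨v, hv, hv0⟩ := Matrix.exists_mulVec_eq_zero_iff.2 h0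
  apply hv
  have h1 : T (WithLp.toLp 2 v) = 0 := by
    rw [← euclidean_sum_single (WithLp.toLp 2 v : Cn ι), map_sum]
    ext α
    have := congrFun hv0 α
    simp only [Matrix.mulVec, dotProduct, Matrix.of_apply, Pi.zero_apply] at this
    simp only [map_smul, WithLp.ofLp_sum, PiLp.smul_apply, smul_eq_mul, Finset.sum_apply]
    rw [PiLp.zero_apply, ← this]
    exact Finset.sum_congr rfl fun a _ => mul_comm _ _
  have h2 : (WithLp.toLp 2 v : Cn ι) = 0 := hi (by rw [h1, map_zero])
  ext a; exact congrArg (fun u : Cn ι => u a) h2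

/-- Multiplying the determinant by `|J|²` with `J` holomorphic does not change `∂∂̄ log det`. -/
lemma levi_log_re_mul_normSq {E : Type*} [NormedAddCommGroup E] [NormedSpace ℂ E] [NormedSpace ℝ E]
    [IsScalarTower ℝ ℂ E] {f g J : E → ℂ} {z : E} (hg : ContDiffAt ℝ 2 g z) (h0 : 0 < (g z).re)
    (hJ : ContDiffAt ℂ 2 J z) (hJ0 : J z ≠ 0)
    (h : ∀ᶠ z' in 𝓝 z, (f z').re = (g z').re * Complex.normSq (J z')) (v w : E) :
    levi (fun z => ((Real.log (f z).re : ℝ) : ℂ)) z v w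
      = levi (fun z => ((Real.log (g z).re : ℝ) : ℂ)) z v w := by
  have hre : ContDiffAt ℝ 2 (fun z => (g z).re) z :=
    Complex.reCLM.contDiff.contDiffAt.comp z hg
  have e1 : (fun z => ((Real.log (f z).re : ℝ) : ℂ)) =ᶠ[𝓝 z]
      fun z' => ((Real.log (g z').re : ℝ) : ℂ) + ((Real.log (Complex.normSq (J z')) : ℝ) : ℂ) := by
    filter_upwards [hJ.continuousAt.eventually_ne hJ0, hre.continuousAt.eventually (lt_mem_nhds h0), h]
      with z' h1 h2 h3
    rw [h3, Real.log_mul h2.ne' (by simpa using h1), Complex.ofReal_add]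
  have hl2 : ContDiffAt ℝ 2 (fun z => ((Real.log (g z).re : ℝ) : ℂ)) z :=
    Complex.ofRealCLM.contDiff.contDiffAt.comp z (hre.log h0.ne')
  have hJ2 : ContDiffAt ℝ 2 (fun z' => ((Real.log (Complex.normSq (J z')) : ℝ) : ℂ)) z := by
    have h1 : ContDiffAt ℝ 2 (fun z' => Complex.normSq (J z')) z := by
      have := (hJ.restrict_scalars ℝ).norm_sq ℝ
      simpa only [Complex.normSq_eq_norm_sq] using this
    exact Complex.ofRealCLM.contDiff.contDiffAt.comp z (h1.log (by simpa using hJ0))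
  rw [levi_congr e1, levi_add hl2 hJ2, levi_log_normSq hJ hJ0, add_zero]

lemma levi_logDet_pullMat {G : Cn ι → Matrix ι ι ℂ} {h : Cn ι → Cn ι} {z : Cn ι}
    (hG : ∀ a b, ContDiffAt ℝ ∞ (fun z => G z a b) (h z)) (h0 : 0 < (G (h z)).det.re)
    (hh : ContDiffAt ℂ ω h z) (hi : Function.Injective (fderiv ℂ h z)) (v w : Cn ι) :
    levi (logDet (pullMat G h)) z v w
      = levi (logDet G) (h z) (fderiv ℂ h z v) (fderiv ℂ h z w) := by
  have hJs : ContDiffAt ℂ ω (fun z => detLin (fderiv ℂ h z)) z := contDiffAt_det fun α a =>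
    (coordCLM α).contDiff.contDiffAt.comp z (contDiffAt_fderiv_apply hh _)
  have hd : ContDiffAt ℝ 2 (fun z => (G (h z)).det) z := contDiffAt_det fun a b =>
    ((hG a b).of_le two_le_infty).comp z ((hh.restrict_scalars ℝ).of_le le_top)
  have h1 : levi (logDet (pullMat G h)) z v w = levi (fun z => logDet G (h z)) z v w :=
    levi_log_re_mul_normSq hd h0 (hJs.of_le le_top) (detLin_ne_zero hi)
      (Eventually.of_forall fun z' => by
        have : (pullMat G h z').det = _ := det_pullLin (G (h z')) (fderiv ℂ h z')
        rw [this, Complex.re_mul_ofReal]) v w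
  rw [h1, levi_comp ((contDiffAt_logDet hG h0).of_le two_le_infty) (hh.of_le le_top)]

lemma det_re_pos {G : Matrix ι ι ℂ} (hG : G.PosDef) : 0 < G.det.re :=
  (Complex.pos_iff.1 hG.det_pos).1

end Pullback

/-! ### Kähler metrics and Ricci curvature along holomorphic parametrizations -/

section Parametrization

variable {n : ℕ} {M : Type} [TopologicalSpace M] [ChartedSpace (Cn (Fin n)) M]

/-- The value of a field of sesquilinear forms, on vectors of the model space. -/
def SesqField.ev (g : SesqField n M) (x : M) (v w : Cn (Fin n)) : ℂ :=
  g x (v : Tan n M x) (w : Tan n M x)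

lemma SesqField.ev_add_left (g : SesqField n M) (x : M) (v v' w : Cn (Fin n)) :
    g.ev x (v + v') w = g.ev x v w + g.ev x v' w := by
  have : g x (v + v' : Tan n M x) = g x (v : Tan n M x) + g x (v' : Tan n M x) := map_add (g x) _ _
  exact congrArg (fun L => L (w : Tan n M x)) this

lemma SesqField.ev_smul_left (g : SesqField n M) (x : M) (c : ℂ) (v w : Cn (Fin n)) :
    g.ev x (c • v) w = c * g.ev x v w := by
  have : g x (c • (v : Tan n M x)) = c • g x (v : Tan n M x) := map_smul (g x) _ _
  exact congrArg (fun L => L (w : Tan n M x)) this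

lemma SesqField.ev_add_right (g : SesqField n M) (x : M) (v w w' : Cn (Fin n)) :
    g.ev x v (w + w') = g.ev x v w + g.ev x v w' :=
  map_add (g x (v : Tan n M x)) _ _

lemma SesqField.ev_smul_right (g : SesqField n M) (x : M) (c : ℂ) (v w : Cn (Fin n)) :
    g.ev x v (c • w) = conj c * g.ev x v w :=
  (g x (v : Tan n M x)).map_smulₛₗ c _

/-- The derivative of a parametrization, as a linear map of model spaces. -/
def mder (σ : Cn (Fin n) → M) (z : Cn (Fin n)) : Cn (Fin n) →L[ℂ] Cn (Fin n) :=
  mfderiv 𝓘(ℂ, Cn (Fin n)) 𝓘(ℂ, Cn (Fin n)) σ z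

/-- The matrix of the pullback of `g` by `σ`. -/
def pb (g : SesqField n M) (σ : Cn (Fin n) → M) (z : Cn (Fin n)) : Matrix (Fin n) (Fin n) ℂ :=
  fun a b => g.ev (σ z) (mder σ z (EuclideanSpace.single a 1)) (mder σ z (EuclideanSpace.single b 1))

lemma coeff_eq_pb (g : SesqField n M) (φ : OpenPartialHomeomorph M (Cn (Fin n))) :
    coeff g φ = pb g φ.symm := rfl

lemma sesq_pb (g : SesqField n M) (σ : Cn (Fin n) → M) (z v w : Cn (Fin n)) :
    sesq (pb g σ z) v w = g.ev (σ z) (mder σ z v) (mder σ z w) :=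
  (sesq_of_sesquilinear (fun v w => g.ev (σ z) (mder σ z v) (mder σ z w))
    (fun v v' w => by simp only [map_add, SesqField.ev_add_left])
    (fun c v w => by simp only [map_smul, SesqField.ev_smul_left])
    (fun v w w' => by simp only [map_add, SesqField.ev_add_right])
    (fun c v w => by simp only [map_smul, SesqField.ev_smul_right]) v w).symm

variable [IsManifold 𝓘(ℂ, Cn (Fin n)) ω M]

lemma contMDiffAt_atlas {φ : OpenPartialHomeomorph M (Cn (Fin n))} (hφ : φ ∈ atlas (Cn (Fin n)) M)
    {x : M} (hx : x ∈ φ.source) : ContMDiffAt 𝓘(ℂ, Cn (Fin n)) 𝓘(ℂ, Cn (Fin n)) ω φ x :=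
  (contMDiffOn_of_mem_maximalAtlas (IsManifold.subset_maximalAtlas hφ)).contMDiffAt
    (φ.open_source.mem_nhds hx)

lemma contMDiffAt_atlas_symm {φ : OpenPartialHomeomorph M (Cn (Fin n))}
    (hφ : φ ∈ atlas (Cn (Fin n)) M) {z : Cn (Fin n)} (hz : z ∈ φ.target) :
    ContMDiffAt 𝓘(ℂ, Cn (Fin n)) 𝓘(ℂ, Cn (Fin n)) ω φ.symm z :=
  (contMDiffOn_symm_of_mem_maximalAtlas (IsManifold.subset_maximalAtlas hφ)).contMDiffAt
    (φ.open_target.mem_nhds hz)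

lemma mder_eq {φ : OpenPartialHomeomorph M (Cn (Fin n))} (hφ : φ ∈ atlas (Cn (Fin n)) M)
    {σ : Cn (Fin n) → M} {z : Cn (Fin n)}
    (hσ : ContMDiffAt 𝓘(ℂ, Cn (Fin n)) 𝓘(ℂ, Cn (Fin n)) ω σ z) (hz : σ z ∈ φ.source)
    (v : Cn (Fin n)) :
    mder σ z v = mder φ.symm (φ (σ z)) (fderiv ℂ (fun z => φ (σ z)) z v) := by
  have h1 : σ =ᶠ[𝓝 z] φ.symm ∘ (fun z => φ (σ z)) := by
    filter_upwards [hσ.continuousAt.eventually (φ.open_source.mem_nhds hz)] with z' hz'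
    exact (φ.left_inv hz').symm
  have h2 : MDifferentiableAt 𝓘(ℂ, Cn (Fin n)) 𝓘(ℂ, Cn (Fin n)) (fun z => φ (σ z)) z :=
    ((contMDiffAt_atlas hφ hz).comp z hσ).mdifferentiableAt (by simp)
  have h3 : MDifferentiableAt 𝓘(ℂ, Cn (Fin n)) 𝓘(ℂ, Cn (Fin n)) φ.symm (φ (σ z)) :=
    (contMDiffAt_atlas_symm hφ (φ.map_source hz)).mdifferentiableAt (by simp)
  have h4 := mfderiv_comp z (g := φ.symm) (f := fun z => φ (σ z)) h3 h2
  have h5 := h1.mfderiv_eq (I := 𝓘(ℂ, Cn (Fin n))) (I' := 𝓘(ℂ, Cn (Fin n)))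
  have h6 : mder σ z = mder (φ.symm ∘ fun z => φ (σ z)) z := h5
  have h7 : mder (φ.symm ∘ fun z => φ (σ z)) z
      = (mder φ.symm (φ (σ z))).comp (fderiv ℂ (fun z => φ (σ z)) z) := by
    rw [← mfderiv_eq_fderiv]; exact h4
  rw [h6, h7]; rfl

lemma contDiffAt_chart_comp {φ : OpenPartialHomeomorph M (Cn (Fin n))}
    (hφ : φ ∈ atlas (Cn (Fin n)) M) {σ : Cn (Fin n) → M} {z : Cn (Fin n)}
    (hσ : ContMDiffAt 𝓘(ℂ, Cn (Fin n)) 𝓘(ℂ, Cn (Fin n)) ω σ z) (hz : σ z ∈ φ.source) :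
    ContDiffAt ℂ ω (fun z => φ (σ z)) z :=
  contMDiffAt_iff_contDiffAt.1 ((contMDiffAt_atlas hφ hz).comp z hσ)

lemma injective_fderiv_chart_comp {φ : OpenPartialHomeomorph M (Cn (Fin n))}
    (hφ : φ ∈ atlas (Cn (Fin n)) M) {σ : Cn (Fin n) → M} {z : Cn (Fin n)}
    (hσ : ContMDiffAt 𝓘(ℂ, Cn (Fin n)) 𝓘(ℂ, Cn (Fin n)) ω σ z) (hz : σ z ∈ φ.source)
    (hi : Function.Injective (mder σ z)) : Function.Injective (fderiv ℂ (fun z => φ (σ z)) z) :=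
  fun v w h => hi (by rw [mder_eq hφ hσ hz, mder_eq hφ hσ hz, h])

lemma pb_eq_pullMat (g : SesqField n M) {φ : OpenPartialHomeomorph M (Cn (Fin n))}
    (hφ : φ ∈ atlas (Cn (Fin n)) M) {σ : Cn (Fin n) → M} {z : Cn (Fin n)}
    (hσ : ContMDiffAt 𝓘(ℂ, Cn (Fin n)) 𝓘(ℂ, Cn (Fin n)) ω σ z) (hz : σ z ∈ φ.source) :
    pb g σ z = pullMat (coeff g φ) (fun z => φ (σ z)) z := by
  ext a b
  rw [pullMat, coeff_eq_pb, sesq_pb, ← mder_eq hφ hσ hz, ← mder_eq hφ hσ hz, φ.left_inv hz]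
  rfl

lemma pb_eventuallyEq_pullMat (g : SesqField n M) {φ : OpenPartialHomeomorph M (Cn (Fin n))}
    (hφ : φ ∈ atlas (Cn (Fin n)) M) {σ : Cn (Fin n) → M} {Ω : Set (Cn (Fin n))} (hΩ : IsOpen Ω)
    (hσ : ContMDiffOn 𝓘(ℂ, Cn (Fin n)) 𝓘(ℂ, Cn (Fin n)) ω σ Ω) {z : Cn (Fin n)} (hzΩ : z ∈ Ω)
    (hz : σ z ∈ φ.source) :
    pb g σ =ᶠ[𝓝 z] pullMat (coeff g φ) (fun z => φ (σ z)) := by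
  have hc := (hσ.contMDiffAt (hΩ.mem_nhds hzΩ)).continuousAt
  filter_upwards [hΩ.mem_nhds hzΩ, hc.eventually (φ.open_source.mem_nhds hz)] with z' h1 h2
  exact pb_eq_pullMat g hφ (hσ.contMDiffAt (hΩ.mem_nhds h1)) h2

lemma IsKahler.isKahlerAt {g : SesqField n M} (hg : IsKahler g)
    {φ : OpenPartialHomeomorph M (Cn (Fin n))} (hφ : φ ∈ atlas (Cn (Fin n)) M) {z : Cn (Fin n)}
    (hz : z ∈ φ.target) : IsKahlerAt (coeff g φ) z :=
  (isKahlerOn_iff φ.open_target).1 (hg φ hφ) z hz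

lemma IsKahler.pb {g : SesqField n M} (hg : IsKahler g) {σ : Cn (Fin n) → M}
    {Ω : Set (Cn (Fin n))} (hΩ : IsOpen Ω)
    (hσ : ContMDiffOn 𝓘(ℂ, Cn (Fin n)) 𝓘(ℂ, Cn (Fin n)) ω σ Ω) {z : Cn (Fin n)} (hz : z ∈ Ω)
    (hi : Function.Injective (mder σ z)) : IsKahlerAt (pb g σ) z := by
  have hσz := hσ.contMDiffAt (hΩ.mem_nhds hz)
  have hφ := chart_mem_atlas (Cn (Fin n)) (σ z)
  have hs := mem_chart_source (Cn (Fin n)) (σ z)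
  refine IsKahlerAt.congr ?_ (pb_eventuallyEq_pullMat g hφ hΩ hσ hz hs)
  exact (hg.isKahlerAt hφ (OpenPartialHomeomorph.map_source _ hs)).pullMat
    (contDiffAt_chart_comp hφ hσz hs) (injective_fderiv_chart_comp hφ hσz hs hi)

lemma ev_ricci (g : SesqField n M) (x : M) (v w : Cn (Fin n)) :
    (ricci g).ev x v w = sesq (fun a b => ricciCoord (coeff g (chartAt (Cn (Fin n)) x))
      (chartAt (Cn (Fin n)) x x) a b)
      ((mfderiv 𝓘(ℂ, Cn (Fin n)) 𝓘(ℂ, Cn (Fin n)) (chartAt (Cn (Fin n)) x) x :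
        Tan n M x →L[ℂ] Cn (Fin n)) v)
      ((mfderiv 𝓘(ℂ, Cn (Fin n)) 𝓘(ℂ, Cn (Fin n)) (chartAt (Cn (Fin n)) x) x :
        Tan n M x →L[ℂ] Cn (Fin n)) w) := rfl

lemma mfderiv_chart_mder {φ : OpenPartialHomeomorph M (Cn (Fin n))}
    (hφ : φ ∈ atlas (Cn (Fin n)) M) {σ : Cn (Fin n) → M} {z : Cn (Fin n)}
    (hσ : ContMDiffAt 𝓘(ℂ, Cn (Fin n)) 𝓘(ℂ, Cn (Fin n)) ω σ z) (hz : σ z ∈ φ.source)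
    (v : Cn (Fin n)) :
    (mfderiv 𝓘(ℂ, Cn (Fin n)) 𝓘(ℂ, Cn (Fin n)) φ (σ z) : Tan n M (σ z) →L[ℂ] Cn (Fin n))
      (mder σ z v) = fderiv ℂ (fun z => φ (σ z)) z v := by
  have h := mfderiv_comp z (g := φ) (f := σ) ((contMDiffAt_atlas hφ hz).mdifferentiableAt (by simp))
    (hσ.mdifferentiableAt (by simp))
  rw [← mfderiv_eq_fderiv]
  exact (congrArg (fun L => L v) h).symm

/-- The matrix `∂∂̄ log det G`. -/
def leviMat (G : Cn (Fin n) → Matrix (Fin n) (Fin n) ℂ) (z : Cn (Fin n)) : Matrix (Fin n) (Fin n) ℂ :=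
  fun a b => levi (logDet G) z (EuclideanSpace.single a 1) (EuclideanSpace.single b 1)

lemma sesq_leviMat (G : Cn (Fin n) → Matrix (Fin n) (Fin n) ℂ) (z v w : Cn (Fin n)) :
    sesq (leviMat G z) v w = levi (logDet G) z v w := sesq_levi _ _ _ _

lemma pb_ricci {g : SesqField n M} (hg : IsKahler g) {σ : Cn (Fin n) → M}
    {Ω : Set (Cn (Fin n))} (hΩ : IsOpen Ω)
    (hσ : ContMDiffOn 𝓘(ℂ, Cn (Fin n)) 𝓘(ℂ, Cn (Fin n)) ω σ Ω) {z : Cn (Fin n)} (hz : z ∈ Ω)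
    (hi : Function.Injective (mder σ z)) (a b : Fin n) :
    pb (ricci g) σ z a b
      = - levi (logDet (pb g σ)) z (EuclideanSpace.single a 1) (EuclideanSpace.single b 1) := by
  have hσz := hσ.contMDiffAt (hΩ.mem_nhds hz)
  have hφ := chart_mem_atlas (Cn (Fin n)) (σ z)
  have hs := mem_chart_source (Cn (Fin n)) (σ z)
  have hK := hg.isKahlerAt hφ (OpenPartialHomeomorph.map_source _ hs)
  have e1 : logDet (pb g σ) =ᶠ[𝓝 z]
      logDet (pullMat (coeff g (chartAt (Cn (Fin n)) (σ z))) (fun y => chartAt (Cn (Fin n)) (σ z) (σ y))) :=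
    (pb_eventuallyEq_pullMat g hφ hΩ hσ hz hs).mono fun y hy => by simp only [logDet, hy]
  rw [levi_congr e1, levi_logDet_pullMat hK.smooth (det_re_pos hK.posDef)
    (contDiffAt_chart_comp hφ hσz hs) (injective_fderiv_chart_comp hφ hσz hs hi), pb, ev_ricci,
    mfderiv_chart_mder hφ hσz hs, mfderiv_chart_mder hφ hσz hs]
  have h2 : (fun a b => ricciCoord (coeff g (chartAt (Cn (Fin n)) (σ z)))
      (chartAt (Cn (Fin n)) (σ z) (σ z)) a b)
      = (-1 : ℂ) • leviMat (coeff g (chartAt (Cn (Fin n)) (σ z)))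
        (chartAt (Cn (Fin n)) (σ z) (σ z)) := by
    ext a b
    rw [ricciCoord_eq hK.smooth (det_re_pos hK.posDef)]
    simp [leviMat]
  rw [h2, sesq_smul_matrix, sesq_leviMat]
  ring

lemma ev_subRicci (g : SesqField n M) (ε : ℝ) (x : M) (v w : Cn (Fin n)) :
    (subRicci g ε).ev x v w = g.ev x v w - ε * (ricci g).ev x v w := rfl

lemma pb_subRicci {g : SesqField n M} (hg : IsKahler g) {σ : Cn (Fin n) → M}
    {Ω : Set (Cn (Fin n))} (hΩ : IsOpen Ω)
    (hσ : ContMDiffOn 𝓘(ℂ, Cn (Fin n)) 𝓘(ℂ, Cn (Fin n)) ω σ Ω) {z : Cn (Fin n)} (hz : z ∈ Ω)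
    (hi : Function.Injective (mder σ z)) (ε : ℝ) :
    pb (subRicci g ε) σ z = pb g σ z + (ε : ℂ) • leviMat (pb g σ) z := by
  ext a b
  have := pb_ricci hg hΩ hσ hz hi a b
  simp only [Matrix.add_apply, Matrix.smul_apply, smul_eq_mul, leviMat]
  rw [pb, ev_subRicci, ← neg_neg (levi _ _ _ _), ← this, pb, pb]
  ring

end Parametrization

/-! ### Smooth closed Hermitian matrix fields -/

section ClosedHermitian

variable {n : ℕ}

/-- Smooth at `z`, Hermitian and closed there. -/
structure IsClosedHermAt (G : Cn (Fin n) → Matrix (Fin n) (Fin n) ℂ) (z : Cn (Fin n)) : Prop where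
  smooth : ∀ a b, ContDiffAt ℝ ∞ (fun z => G z a b) z
  herm : (G z).IsHermitian
  closed : ∀ a b c, wirt c (fun w => G w a b) z = wirt a (fun w => G w c b) z

lemma IsKahlerAt.isClosedHermAt {G : Cn (Fin n) → Matrix (Fin n) (Fin n) ℂ} {z : Cn (Fin n)}
    (h : IsKahlerAt G z) : IsClosedHermAt G z := ⟨h.smooth, h.posDef.1, h.closed⟩

lemma IsClosedHermAt.add_smul {A B : Cn (Fin n) → Matrix (Fin n) (Fin n) ℂ} {z : Cn (Fin n)}
    (hA : IsClosedHermAt A z) (hB : IsClosedHermAt B z) (ε : ℝ) :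
    IsClosedHermAt (fun z => A z + (ε : ℂ) • B z) z where
  smooth a b := (hA.smooth a b).add (contDiffAt_const.mul (hB.smooth a b))
  herm := by
    refine hA.herm.add ?_
    ext a b
    simp only [Matrix.conjTranspose_apply, Matrix.smul_apply, smul_eq_mul, star_mul', ← hB.herm.apply a b]
    simp
  closed a b c := by
    have d : ∀ a b c, wirt c (fun w => (A w + (ε : ℂ) • B w) a b) z
        = wirt c (fun w => A w a b) z + ε * wirt c (fun w => B w a b) z := by
      intro a b c
      have hA' := (hA.smooth a b).differentiableAt (by simp)
      have hB' := (hB.smooth a b).differentiableAt (by simp)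
      have h1 := (hA'.hasFDerivAt.add (hB'.hasFDerivAt.const_mul (ε : ℂ))).fderiv
      have h2 : fderiv ℝ (fun w => (A w + (ε : ℂ) • B w) a b) z = _ := h1
      rw [wirt, wirt, wirt, h2]
      simp only [_root_.add_apply, _root_.smul_apply, smul_eq_mul]
      ring
    rw [d, d, hA.closed, hB.closed]

lemma isClosedHermAt_leviMat {G : Cn (Fin n) → Matrix (Fin n) (Fin n) ℂ} {z : Cn (Fin n)}
    (hs : ∀ a b, ContDiffAt ℝ ∞ (fun z => G z a b) z) (h0 : 0 < (G z).det.re) :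
    IsClosedHermAt (leviMat G) z := by
  have hl := contDiffAt_logDet hs h0
  have hl2 : ∀ᶠ z' in 𝓝 z, ContDiffAt ℝ 2 (logDet G) z' :=
    (hl.of_le two_le_infty).eventually (by simp)
  refine ⟨fun a b => ContDiffAt.levi hl _ _, ?_, fun a b c => ?_⟩
  · ext a b
    refine levi_symm (hl.of_le two_le_infty) (Eventually.of_forall fun z' => ?_) _ _
    simp [logDet]
  · set D : Fin n → Cn (Fin n) → ℂ := fun b z' => (1 / 2) * (fderiv ℝ (logDet G) z' (EuclideanSpace.single b 1)
      + Complex.I * fderiv ℝ (logDet G) z' (Complex.I • EuclideanSpace.single b 1)) with hD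
    have e1 : ∀ a, (fun w => leviMat G w a b) =ᶠ[𝓝 z] fun w => delC (D b) w (EuclideanSpace.single a 1) :=
      fun a => hl2.mono fun z' hz' => (delC_dbarC hz' _ _).symm
    rw [wirt_eq_delC, wirt_eq_delC, delC_congr (e1 a), delC_congr (e1 c)]
    refine delC_comm ?_ _ _
    have h1 : ∀ v, ContDiffAt ℝ 2 (fun z => fderiv ℝ (logDet G) z v) z := fun v =>
      ((hl.fderiv_right (m := ∞) le_rfl).clm_apply contDiffAt_const).of_le two_le_infty
    exact contDiffAt_const.mul ((h1 _).add (contDiffAt_const.mul (h1 _)))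

/-- Two continuous matrix fields that agree on a dense set near `z` agree near `z`; closedness and
the Hermitian property pass to the limit. -/
lemma IsClosedHermAt.of_dense {G : Cn (Fin n) → Matrix (Fin n) (Fin n) ℂ} {z : Cn (Fin n)}
    (hs : ∀ a b, ContDiffAt ℝ ∞ (fun z => G z a b) z) {S : Set (Cn (Fin n))} (hS : z ∈ closure S)
    (h : ∀ᶠ w in 𝓝[S] z, IsClosedHermAt G w) : IsClosedHermAt G z := by
  have : (𝓝[S] z).NeBot := mem_closure_iff_nhdsWithin_neBot.1 hS
  refine ⟨hs, ?_, fun a b c => ?_⟩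
  · ext a b
    have h1 : Tendsto (fun w => star (G w b a)) (𝓝[S] z) (𝓝 (star (G z b a))) :=
      ((hs b a).continuousAt.star).mono_left nhdsWithin_le_nhds
    have h2 : Tendsto (fun w => G w a b) (𝓝[S] z) (𝓝 (G z a b)) :=
      (hs a b).continuousAt.mono_left nhdsWithin_le_nhds
    refine tendsto_nhds_unique h1 (h2.congr' ?_)
    exact h.mono fun w hw => (hw.herm.apply a b).symm
  · have hc : ∀ a b c, ContinuousAt (wirt c (fun w => G w a b)) z := by
      intro a b c
      have h1 : ContDiffAt ℝ ∞ (fderiv ℝ (fun w => G w a b)) z := (hs a b).fderiv_right (m := ∞) le_rfl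
      have h2 : ∀ v, ContinuousAt (fun w => fderiv ℝ (fun w => G w a b) w v) z := fun v =>
        (h1.clm_apply contDiffAt_const).continuousAt
      exact continuousAt_const.mul ((h2 _).sub (continuousAt_const.mul (h2 _)))
    refine tendsto_nhds_unique ((hc a b c).mono_left nhdsWithin_le_nhds)
      (((hc c b a).mono_left (nhdsWithin_le_nhds (s := S))).congr' ?_)
    exact h.mono fun w hw => (hw.closed a b c).symm

end ClosedHermitian

/-! ### Strict positivity of the curvature of the determinant of a moving frame -/

section Frame

lemma levi_mul_of_fderiv_eq_zero {f g : ℂ → ℂ} {z : ℂ} (hf : ContDiffAt ℝ 2 f z)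
    (hg : ContDiffAt ℝ 2 g z) (f0 : fderiv ℝ f z = 0) (g0 : fderiv ℝ g z = 0) (v w : ℂ) :
    levi (fun z => f z * g z) z v w = levi f z v w * g z + f z * levi g z v w := by
  have e1 : fderiv ℝ (fun z => f z * g z) =ᶠ[𝓝 z]
      fun z' => f z' • fderiv ℝ g z' + g z' • fderiv ℝ f z' := by
    filter_upwards [hf.eventually (by simp), hg.eventually (by simp)] with z' h1 h2
    exact fderiv_fun_mul (h1.differentiableAt two_ne_zero) (h2.differentiableAt two_ne_zero)
  have d1 : HasFDerivAt (fderiv ℝ f) (fderiv ℝ (fderiv ℝ f) z) z :=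
    ((hf.fderiv_right (m := 1) le_rfl).differentiableAt one_ne_zero).hasFDerivAt
  have d2 : HasFDerivAt (fderiv ℝ g) (fderiv ℝ (fderiv ℝ g) z) z :=
    ((hg.fderiv_right (m := 1) le_rfl).differentiableAt one_ne_zero).hasFDerivAt
  have hf' := (hf.differentiableAt two_ne_zero).hasFDerivAt
  have hg' := (hg.differentiableAt two_ne_zero).hasFDerivAt
  have key : ∀ v w, fderiv ℝ (fderiv ℝ (fun z => f z * g z)) z v w
      = f z * fderiv ℝ (fderiv ℝ g) z v w + g z * fderiv ℝ (fderiv ℝ f) z v w := by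
    intro v w
    have h : fderiv ℝ (fun z' => f z' • fderiv ℝ g z' + g z' • fderiv ℝ f z') z = _ :=
      ((hf'.smul d2).add (hg'.smul d1)).fderiv
    rw [e1.fderiv_eq, h]
    simp [f0, g0]
  simp only [levi, key]; ring

lemma levi_prod_of_fderiv_eq_zero {κ : Type*} [DecidableEq κ] (s : Finset κ) {f : κ → ℂ → ℂ} {z : ℂ}
    (hf : ∀ i, ContDiffAt ℝ 2 (f i) z) (f0 : ∀ i, fderiv ℝ (f i) z = 0) (v w : ℂ) :
    fderiv ℝ (fun z => ∏ i ∈ s, f i z) z = 0 ∧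
    levi (fun z => ∏ i ∈ s, f i z) z v w
      = ∑ i ∈ s, levi (f i) z v w * ∏ j ∈ s.erase i, f j z := by
  induction s using Finset.induction_on with
  | empty => simp [levi]
  | insert a s ha ih =>
    have hp : ContDiffAt ℝ 2 (fun z => ∏ i ∈ s, f i z) z := contDiffAt_prod fun i _ => hf i
    simp only [Finset.prod_insert ha, Finset.sum_insert ha, Finset.erase_insert ha]
    refine ⟨?_, ?_⟩
    · rw [fderiv_fun_mul ((hf a).differentiableAt two_ne_zero) (hp.differentiableAt two_ne_zero),
        ih.1, f0 a]; simp
    · rw [levi_mul_of_fderiv_eq_zero (hf a) hp (f0 a) ih.1, ih.2, Finset.mul_sum]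
      congr 1
      refine Finset.sum_congr rfl fun i hi => ?_
      have hia : i ≠ a := fun h => ha (h ▸ hi)
      rw [Finset.erase_insert_of_ne hia.symm, Finset.prod_insert (fun h => ha (Finset.mem_of_mem_erase h))]
      ring

lemma levi_finset_sum {κ : Type*} (s : Finset κ) {f : κ → ℂ → ℂ} {z : ℂ}
    (hf : ∀ i, ContDiffAt ℝ 2 (f i) z) (v w : ℂ) :
    levi (fun z => ∑ i ∈ s, f i z) z v w = ∑ i ∈ s, levi (f i) z v w := by
  classical
  induction s using Finset.induction_on with
  | empty => simp [levi]
  | insert a s ha ih =>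
    simp only [Finset.sum_insert ha]
    rw [levi_add (hf a) (ContDiffAt.sum fun i _ => hf i), ih]

/-- At a point where the entries are critical and the matrix is the identity, `∂∂̄ det` is the
trace of `∂∂̄` of the entries. -/
lemma levi_det_of_eq_one {ι : Type} [Fintype ι] [DecidableEq ι] {M : ℂ → Matrix ι ι ℂ} {z : ℂ}
    (hM : ∀ a b, ContDiffAt ℝ 2 (fun z => M z a b) z) (h0 : ∀ a b, fderiv ℝ (fun z => M z a b) z = 0)
    (h1 : M z = 1) (v w : ℂ) :
    fderiv ℝ (fun z => (M z).det) z = 0 ∧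
    levi (fun z => (M z).det) z v w = ∑ a, levi (fun z => M z a a) z v w := by
  simp only [Matrix.det_apply']
  have hp : ∀ σ : Equiv.Perm ι, ContDiffAt ℝ 2 (fun z => ∏ i, M z (σ i) i) z :=
    fun σ => contDiffAt_prod fun i _ => hM _ _
  have hc : ∀ σ : Equiv.Perm ι, fderiv ℝ (fun _ : ℂ => ((Equiv.Perm.sign σ : ℤ) : ℂ)) z = 0 :=
    fun σ => fderiv_const_apply _
  have hl : ∀ (c : ℂ), levi (fun _ : ℂ => c) z v w = 0 := fun c => by simp [levi]
  have hpp := fun σ : Equiv.Perm ι => levi_prod_of_fderiv_eq_zero Finset.univ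
    (f := fun i z => M z (σ i) i) (fun i => hM (σ i) i) (fun i => h0 (σ i) i) v w
  constructor
  · rw [fderiv_fun_sum fun σ _ => (contDiffAt_const.mul (hp σ)).differentiableAt two_ne_zero]
    refine Finset.sum_eq_zero fun σ _ => ?_
    rw [fderiv_fun_mul (differentiableAt_const _) ((hp σ).differentiableAt two_ne_zero), hc σ,
      (hpp σ).1]
    simp
  · rw [levi_finset_sum _ (fun σ => contDiffAt_const.mul (hp σ))]
    rw [Finset.sum_eq_single (1 : Equiv.Perm ι)]
    · rw [levi_mul_of_fderiv_eq_zero contDiffAt_const (hp 1) (hc 1) (hpp 1).1, hl, (hpp 1).2]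
      simp only [zero_mul, Equiv.Perm.sign_one, Units.val_one, Int.cast_one, one_mul, zero_add]
      refine Finset.sum_congr rfl fun i _ => ?_
      have : ∏ j ∈ Finset.univ.erase i, M z ((1 : Equiv.Perm ι) j) j = 1 := by
        rw [h1]; exact Finset.prod_eq_one fun j _ => Matrix.one_apply_eq j
      rw [this, mul_one]; rfl
    · intro σ _ hσ
      rw [levi_mul_of_fderiv_eq_zero contDiffAt_const (hp σ) (hc σ) (hpp σ).1, hl, (hpp σ).2]
      have : ∀ i, levi (fun z => M z (σ i) i) z v w * ∏ j ∈ Finset.univ.erase i, M z (σ j) j = 0 := by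
        intro i
        obtain ⟨j, hj, hji⟩ : ∃ j, σ j ≠ j ∧ j ≠ i := by
          by_contra! hcon
          apply hσ
          ext j
          by_cases hji : j = i
          · by_contra hne
            have h2 : σ (σ i) ≠ σ i := fun h => hne (by rw [hji]; exact σ.injective h)
            have h3 := hcon _ h2
            exact hne (by rw [hji]; exact h3)
          · by_contra hne
            exact hji (hcon j hne)
        rw [Finset.prod_eq_zero (Finset.mem_erase.2 ⟨hji, Finset.mem_univ j⟩), mul_zero]
        rw [h1]; exact Matrix.one_apply_ne hj
      simp [Finset.sum_eq_zero fun i _ => this i]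
    · simp

lemma levi_log_re_of_fderiv_eq_zero {f : ℂ → ℂ} {z : ℂ} (hf : ContDiffAt ℝ 2 f z)
    (f0 : fderiv ℝ f z = 0) (f1 : f z = 1) (v : ℂ) :
    (levi (fun z => ((Real.log (f z).re : ℝ) : ℂ)) z v v).re = (levi f z v v).re := by
  have hre : ContDiffAt ℝ 2 (fun z => (f z).re) z := Complex.reCLM.contDiff.contDiffAt.comp z hf
  have hpos : 0 < (f z).re := by simp [f1]
  set R : ℂ →L[ℝ] ℂ := Complex.ofRealCLM.comp Complex.reCLM with hR
  have e1 : fderiv ℝ (fun z => ((Real.log (f z).re : ℝ) : ℂ)) =ᶠ[𝓝 z]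
      fun z' => ((f z').re)⁻¹ • R.comp (fderiv ℝ f z') := by
    filter_upwards [hf.eventually (by simp), hre.continuousAt.eventually (lt_mem_nhds hpos)]
      with z' h1 h2
    have h3 := (h1.differentiableAt two_ne_zero).hasFDerivAt
    have h4 : HasFDerivAt (fun z => (f z).re) (Complex.reCLM.comp (fderiv ℝ f z')) z' :=
      Complex.reCLM.hasFDerivAt.comp z' h3
    refine (Complex.ofRealCLM.hasFDerivAt.comp z' (h4.log h2.ne')).fderiv.trans ?_
    ext v
    all_goals simp [R]
  have d1 : HasFDerivAt (fderiv ℝ f) (fderiv ℝ (fderiv ℝ f) z) z :=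
    ((hf.fderiv_right (m := 1) le_rfl).differentiableAt one_ne_zero).hasFDerivAt
  have h5 : HasFDerivAt (fun z' => ((f z').re)⁻¹) (fderiv ℝ (fun z' => ((f z').re)⁻¹) z) z :=
    ((hre.inv hpos.ne').differentiableAt two_ne_zero).hasFDerivAt
  have key : ∀ v w, fderiv ℝ (fderiv ℝ (fun z => ((Real.log (f z).re : ℝ) : ℂ))) z v w
      = (((fderiv ℝ (fderiv ℝ f) z v w).re : ℝ) : ℂ) := by
    intro v w
    have h : fderiv ℝ (fun z' => ((f z').re)⁻¹ • R.comp (fderiv ℝ f z')) z = _ :=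
      (h5.smul ((hasFDerivAt_const R z).clm_comp d1)).fderiv
    rw [e1.fderiv_eq, h]
    simp [f0, f1, R]
  simp only [levi, key]
  rw [fderiv_fderiv_comm hf (Complex.I • v) v]
  simp

/-- `∂∂̄ (f ḡ) = ∂f ∧ conj (∂g)` for holomorphic `f` and `g`. -/
lemma levi_mul_conj {f g : ℂ → ℂ} {z : ℂ} (hf : ContDiffAt ℂ ω f z) (hg : ContDiffAt ℂ ω g z)
    (v w : ℂ) :
    levi (fun z => f z * conj (g z)) z v w = fderiv ℂ f z v * conj (fderiv ℂ g z w) := by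
  have hgc : ∀ {g : ℂ → ℂ} {z}, ContDiffAt ℂ ω g z → ContDiffAt ℝ ω (fun z => conj (g z)) z :=
    fun h => (Complex.conjCLE : ℂ →L[ℝ] ℂ).contDiff.contDiffAt.comp _ (h.restrict_scalars ℝ)
  have hfg : ContDiffAt ℝ 2 (fun z => f z * conj (g z)) z :=
    ((hf.restrict_scalars ℝ).mul (hgc hg)).of_le le_top
  rw [← delC_dbarC hfg]
  have e : (fun z' => (1 / 2) * (fderiv ℝ (fun z => f z * conj (g z)) z' w
      + Complex.I * fderiv ℝ (fun z => f z * conj (g z)) z' (Complex.I • w)))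
      =ᶠ[𝓝 z] fun z' => f z' * conj (fderiv ℂ g z' w) := by
    filter_upwards [hf.eventually (by simp), hg.eventually (by simp)] with z' h1 h2
    have h3 := (h1.differentiableAt (by simp)).hasFDerivAt.restrictScalars ℝ
    have h4 : HasFDerivAt (fun z => conj (g z)) ((Complex.conjCLE : ℂ →L[ℝ] ℂ).comp
        ((fderiv ℂ g z').restrictScalars ℝ)) z' :=
      (Complex.conjCLE : ℂ →L[ℝ] ℂ).hasFDerivAt.comp z'
        ((h2.differentiableAt (by simp)).hasFDerivAt.restrictScalars ℝ)
    have h5 : fderiv ℝ (fun z => f z * conj (g z)) z' = _ := (h3.mul h4).fderiv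
    have h6 : fderiv ℂ f z' (Complex.I * w) = Complex.I * fderiv ℂ f z' w :=
      map_smul (fderiv ℂ f z') Complex.I w
    have h7 : fderiv ℂ g z' (Complex.I * w) = Complex.I * fderiv ℂ g z' w :=
      map_smul (fderiv ℂ g z') Complex.I w
    rw [h5]
    simp only [_root_.add_apply, _root_.smul_apply, smul_eq_mul, ContinuousLinearMap.comp_apply,
      ContinuousLinearMap.coe_restrictScalars', ContinuousLinearEquiv.coe_coe, Complex.conjCLE_apply,
      h6, h7, map_mul, Complex.conj_I]
    linear_combination (1 / 2 * (conj (g z') * fderiv ℂ f z' w - f z' * conj (fderiv ℂ g z' w)))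
      * Complex.I_mul_I
  have hg' := contDiffAt_fderiv_apply hg w
  rw [delC_congr e, delC_mul ((hf.restrict_scalars ℝ).differentiableAt (by simp))
    ((hgc hg').differentiableAt (by simp)), delC_conj_holo (hg'.differentiableAt (by simp)),
    delC_holo (hf.differentiableAt (by simp)), mul_zero, add_zero]

variable {κ : Type} [Fintype κ] [DecidableEq κ]

lemma contDiffAt_coord {k : ℂ → Cn κ} {z : ℂ} (hk : ContDiffAt ℂ ω k z) (α : κ) :
    ContDiffAt ℂ ω (fun z => k z α) z := (coordCLM α).contDiff.contDiffAt.comp z hk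

lemma fderiv_coord {k : ℂ → Cn κ} {z : ℂ} (hk : ContDiffAt ℂ ω k z) (α : κ) (v : ℂ) :
    fderiv ℂ (fun z => k z α) z v = fderiv ℂ k z v α := by
  have := ((coordCLM α).hasFDerivAt.comp z (hk.differentiableAt (by simp)).hasFDerivAt).fderiv
  exact congrArg (fun L => L v) this

lemma contDiffAt_sesq_holo (H : Matrix κ κ ℂ) {p q : ℂ → Cn κ} {z : ℂ} (hp : ContDiffAt ℂ ω p z)
    (hq : ContDiffAt ℂ ω q z) : ContDiffAt ℝ ∞ (fun z => sesq H (p z) (q z)) z :=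
  ContDiffAt.sesq (fun _ _ => contDiffAt_const) ((hp.restrict_scalars ℝ).of_le le_top)
    ((hq.restrict_scalars ℝ).of_le le_top)

lemma levi_sesq_holo (H : Matrix κ κ ℂ) {p q : ℂ → Cn κ} {z : ℂ} (hp : ContDiffAt ℂ ω p z)
    (hq : ContDiffAt ℂ ω q z) (v w : ℂ) :
    levi (fun z => sesq H (p z) (q z)) z v w = sesq H (fderiv ℂ p z v) (fderiv ℂ q z w) := by
  have hgc : ∀ β, ContDiffAt ℝ ω (fun z => conj (q z β)) z := fun β =>
    (Complex.conjCLE : ℂ →L[ℝ] ℂ).contDiff.contDiffAt.comp _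
      ((contDiffAt_coord hq β).restrict_scalars ℝ)
  have hc : ∀ α β, ContDiffAt ℂ ω (fun z => H α β * p z α) z := fun α β =>
    contDiffAt_const.mul (contDiffAt_coord hp α)
  have ht : ∀ α β, ContDiffAt ℝ 2 (fun z => H α β * p z α * conj (q z β)) z := fun α β =>
    (((hc α β).restrict_scalars ℝ).mul (hgc β)).of_le le_top
  simp only [sesq]
  rw [levi_finset_sum _ (fun α => ContDiffAt.sum fun β _ => ht α β)]
  refine Finset.sum_congr rfl fun α _ => ?_
  rw [levi_finset_sum _ (fun β => ht α β)]
  refine Finset.sum_congr rfl fun β _ => ?_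
  rw [levi_mul_conj (hc α β) (contDiffAt_coord hq β), fderiv_coord hq,
    fderiv_const_mul ((contDiffAt_coord hp α).differentiableAt (by simp))]
  rw [_root_.smul_apply, fderiv_coord hp, smul_eq_mul]

lemma fderiv_sesq_holo (H : Matrix κ κ ℂ) {p q : ℂ → Cn κ} {z : ℂ} (hp : ContDiffAt ℂ ω p z)
    (hq : ContDiffAt ℂ ω q z) (v : ℂ) :
    fderiv ℝ (fun z => sesq H (p z) (q z)) z v
      = sesq H (fderiv ℂ p z v) (q z) + sesq H (p z) (fderiv ℂ q z v) := by
  have h3 : ∀ α, HasFDerivAt (fun z => p z α) ((fderiv ℂ (fun z => p z α) z).restrictScalars ℝ) z :=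
    fun α => ((contDiffAt_coord hp α).differentiableAt (by simp)).hasFDerivAt.restrictScalars ℝ
  have h4 : ∀ β, HasFDerivAt (fun z => (starRingEnd ℂ) (q z β)) ((Complex.conjCLE : ℂ →L[ℝ] ℂ).comp
      ((fderiv ℂ (fun z => q z β) z).restrictScalars ℝ)) z := fun β =>
    (Complex.conjCLE : ℂ →L[ℝ] ℂ).hasFDerivAt.comp z
      (((contDiffAt_coord hq β).differentiableAt (by simp)).hasFDerivAt.restrictScalars ℝ)
  have h5 := HasFDerivAt.fun_sum (u := Finset.univ) fun α (_ : α ∈ Finset.univ) =>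
    HasFDerivAt.fun_sum (u := Finset.univ) fun β (_ : β ∈ Finset.univ) =>
      ((h3 α).const_mul (H α β)).mul (h4 β)
  have h6 : fderiv ℝ (fun z => sesq H (p z) (q z)) z = _ := h5.fderiv
  rw [h6]
  simp only [sesq, _root_.sum_apply, _root_.add_apply, _root_.smul_apply, smul_eq_mul,
    ContinuousLinearMap.comp_apply, ContinuousLinearMap.coe_restrictScalars',
    ContinuousLinearEquiv.coe_coe, Complex.conjCLE_apply, fderiv_coord hp, fderiv_coord hq,
    ← Finset.sum_add_distrib]
  refine Finset.sum_congr rfl fun α _ => Finset.sum_congr rfl fun β _ => ?_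
  ring

lemma sesq_zero_left (H : Matrix κ κ ℂ) (v : Cn κ) : sesq H 0 v = 0 := by simp [sesq]

lemma sesq_zero_right (H : Matrix κ κ ℂ) (v : Cn κ) : sesq H v 0 = 0 := by simp [sesq]

lemma sesq_sum_left {τ : Type*} (s : Finset τ) (H : Matrix κ κ ℂ) (v : τ → Cn κ) (w : Cn κ) :
    sesq H (∑ i ∈ s, v i) w = ∑ i ∈ s, sesq H (v i) w := by
  classical
  induction s using Finset.induction_on with
  | empty => simp [sesq_zero_left]
  | insert a s ha ih => rw [Finset.sum_insert ha, Finset.sum_insert ha, sesq_add_left, ih]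

lemma sesq_sum_right {τ : Type*} (s : Finset τ) (H : Matrix κ κ ℂ) (v : Cn κ) (w : τ → Cn κ) :
    sesq H v (∑ i ∈ s, w i) = ∑ i ∈ s, sesq H v (w i) := by
  classical
  induction s using Finset.induction_on with
  | empty => simp [sesq_zero_right]
  | insert a s ha ih => rw [Finset.sum_insert ha, Finset.sum_insert ha, sesq_add_right, ih]

variable {ι : Type} [Fintype ι] [DecidableEq ι]

/-- The Gram matrix of the vectors `k a` for the form `H`. -/
def gram (H : Matrix κ κ ℂ) (k : ι → Cn κ) : Matrix ι ι ℂ := fun a b => sesq H (k a) (k b)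

lemma det_gram_sum (H : Matrix κ κ ℂ) (k : ι → Cn κ) (Q : Matrix ι ι ℂ) :
    (gram H fun b => ∑ a, Q a b • k a).det = (gram H k).det * Complex.normSq Q.det := by
  have : (gram H fun b => ∑ a, Q a b • k a) = Q.transpose * gram H k * Q.map (starRingEnd ℂ) := by
    ext a b
    simp only [gram, Matrix.mul_apply, Matrix.transpose_apply, Matrix.map_apply, sesq_sum_left,
      sesq_sum_right, Finset.sum_mul, Finset.mul_sum, sesq_smul_left, sesq_smul_right]
    exact Finset.sum_congr rfl fun α _ => Finset.sum_congr rfl fun β _ => by ring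
  have h2 : (Q.map (starRingEnd ℂ)).det = conj Q.det := by
    rw [RingHom.map_det]; rfl
  rw [this, Matrix.det_mul, Matrix.det_mul, Matrix.det_transpose, h2, ← Complex.mul_conj]
  ring

lemma exists_orthonormalizing {M : Matrix ι ι ℂ} (hM : M.PosDef) :
    ∃ P : Matrix ι ι ℂ, P.det ≠ 0 ∧ P.transpose * M * P.map (starRingEnd ℂ) = 1 := by
  set U : Matrix ι ι ℂ := hM.1.eigenvectorUnitary.1 with hU
  have hUU : U.conjTranspose * U = 1 := Unitary.coe_star_mul_self hM.1.eigenvectorUnitary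
  set D : Matrix ι ι ℂ := Matrix.diagonal fun i => (((Real.sqrt (hM.1.eigenvalues i))⁻¹ : ℝ) : ℂ)
    with hD
  set Λ : Matrix ι ι ℂ := Matrix.diagonal fun i => ((hM.1.eigenvalues i : ℝ) : ℂ) with hΛ
  have hspec : M = U * Λ * U.conjTranspose := by
    conv_lhs => rw [hM.1.spectral_theorem]
    rfl
  have hDD : D.conjTranspose * Λ * D = 1 := by
    rw [hD, hΛ, Matrix.diagonal_conjTranspose, Matrix.diagonal_mul_diagonal,
      Matrix.diagonal_mul_diagonal, ← Matrix.diagonal_one]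
    congr 1
    ext i
    have h0 := hM.eigenvalues_pos i
    have h1 : Real.sqrt (hM.1.eigenvalues i) ≠ 0 := (Real.sqrt_pos.2 h0).ne'
    have h2 : (Real.sqrt (hM.1.eigenvalues i))⁻¹ * hM.1.eigenvalues i
        * (Real.sqrt (hM.1.eigenvalues i))⁻¹ = 1 := by
      nth_rewrite 2 [← Real.mul_self_sqrt h0.le]
      field_simp
    simp only [Pi.star_apply, Complex.star_def, Complex.conj_ofReal]
    exact_mod_cast h2
  set R : Matrix ι ι ℂ := U * D with hR
  have h1 : R.conjTranspose * M * R = 1 := by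
    calc R.conjTranspose * M * R
        = D.conjTranspose * (U.conjTranspose * U) * Λ * (U.conjTranspose * U) * D := by
          rw [hspec, hR, Matrix.conjTranspose_mul]; simp only [Matrix.mul_assoc]
      _ = 1 := by rw [hUU, Matrix.mul_one, Matrix.mul_one, hDD]
  refine ⟨R.map (starRingEnd ℂ), ?_, ?_⟩
  · have : (R.map (starRingEnd ℂ)).det = conj R.det := by rw [RingHom.map_det]; rfl
    rw [this, Ne, map_eq_zero]
    intro h0
    have := congrArg Matrix.det h1
    rw [Matrix.det_mul, h0, mul_zero, Matrix.det_one] at this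
    exact zero_ne_one this
  · have h2 : (R.map (starRingEnd ℂ)).map (starRingEnd ℂ) = R := by ext a b; simp
    have h3 : (R.map (starRingEnd ℂ)).transpose = R.conjTranspose := by
      ext a b; simp [Matrix.conjTranspose_apply]
    rw [h2, h3, h1]

/-- The logarithm of the Gram determinant of a holomorphic frame is strictly subharmonic when the
span of the frame moves. -/
theorem levi_log_det_gram_pos {H : Matrix κ κ ℂ} (hH : H.PosDef) {k : ι → ℂ → Cn κ}
    (hk : ∀ a, ContDiffAt ℂ ω (k a) 0) (h0 : (gram H fun a => k a 0).PosDef)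
    (hmove : ∃ a, fderiv ℂ (k a) 0 1 ∉ Submodule.span ℂ (range fun a => k a 0)) :
    0 < (levi (fun s => ((Real.log (gram H fun a => k a s).det.re : ℝ) : ℂ)) 0 1 1).re := by
  obtain ⟨P, hP, hPM⟩ := exists_orthonormalizing h0
  have hH' := posDef_iff_sesq.1 hH
  set e : ι → Cn κ := fun b => ∑ a, P a b • k a 0 with he
  have horth : gram H e = 1 := by
    rw [← hPM]
    ext a b
    simp only [gram, he, Matrix.mul_apply, Matrix.transpose_apply, Matrix.map_apply, sesq_sum_left,
      sesq_sum_right, Finset.sum_mul, Finset.mul_sum, sesq_smul_left, sesq_smul_right]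
    exact Finset.sum_congr rfl fun α _ => Finset.sum_congr rfl fun β _ => by ring
  set nu : ι → Cn κ := fun b => ∑ a, P a b • fderiv ℂ (k a) 0 1 with hnu
  set C : Matrix ι ι ℂ := fun c b => sesq H (nu b) (e c) with hC
  set Q : ℂ → Matrix ι ι ℂ := fun s => P - s • (P * C) with hQ
  set kt : ι → ℂ → Cn κ := fun b s => ∑ a, Q s a b • k a s with hkt
  have hQs : ∀ a b, ContDiff ℂ ω fun s => Q s a b := fun a b =>
    contDiff_const.sub (contDiff_id.mul contDiff_const)
  have hkts : ∀ b, ContDiffAt ℂ ω (kt b) 0 := fun b =>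
    ContDiffAt.sum fun a _ => (hQs a b).contDiffAt.smul (hk a)
  have hkt0 : ∀ b, kt b 0 = e b := fun b => by simp [hkt, hQ, he]
  have hktd : ∀ b, fderiv ℂ (kt b) 0 1 = nu b - ∑ c, C c b • e c := by
    intro b
    have hq : ∀ a, HasFDerivAt (fun s => Q s a b)
        (-(ContinuousLinearMap.id ℂ ℂ).smulRight ((P * C) a b)) 0 := by
      intro a
      have := ((hasFDerivAt_id (𝕜 := ℂ) (0 : ℂ)).mul_const ((P * C) a b)).const_sub (P a b)
      refine this.congr_fderiv ?_
      ext; simp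
    have h1 := HasFDerivAt.fun_sum (u := Finset.univ) fun a (_ : a ∈ Finset.univ) =>
      (hq a).smul ((hk a).differentiableAt (by simp)).hasFDerivAt
    have h2 : fderiv ℂ (kt b) 0 = _ := h1.fderiv
    rw [h2]
    have h3 : ∑ c, C c b • e c = ∑ a, (P * C) a b • k a 0 := by
      simp only [he, Finset.smul_sum, Matrix.mul_apply, Finset.sum_smul]
      rw [Finset.sum_comm]
      exact Finset.sum_congr rfl fun α _ => Finset.sum_congr rfl fun β _ => by
        rw [smul_smul, mul_comm]
    rw [h3, hnu, ← Finset.sum_sub_distrib, _root_.sum_apply]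
    refine Finset.sum_congr rfl fun a _ => ?_
    simp [hQ, sub_eq_add_neg]
  have hperp : ∀ b c, sesq H (fderiv ℂ (kt b) 0 1) (kt c 0) = 0 := by
    intro b c
    have : ∀ d, sesq H (C d b • e d) (e c) = if d = c then C c b else 0 := by
      intro d
      have h := congrFun (congrFun horth d) c
      rw [sesq_smul_left]
      change C d b * gram H e d c = _
      rw [h, Matrix.one_apply]
      split_ifs with hdc
      · rw [hdc, mul_one]
      · rw [mul_zero]
    rw [hktd, hkt0, sub_eq_add_neg, ← neg_one_smul ℂ (∑ c, C c b • e c), sesq_add_left,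
      sesq_smul_left, sesq_sum_left Finset.univ H (fun d => C d b • e d),
      Finset.sum_congr rfl fun d _ => this d,
      Finset.sum_ite_eq' Finset.univ c]
    simp [hC]
  have hdir : ∀ (b : ι) (v : ℂ), fderiv ℂ (kt b) 0 v = v • fderiv ℂ (kt b) 0 1 := by
    intro b v
    rw [← map_smul, smul_eq_mul, mul_one]
  have hM2 : ∀ a b, ContDiffAt ℝ 2 (fun s => gram H (fun b => kt b s) a b) 0 := fun a b =>
    (contDiffAt_sesq_holo H (hkts a) (hkts b)).of_le two_le_infty
  have hcrit : ∀ a b, fderiv ℝ (fun s => gram H (fun b => kt b s) a b) 0 = 0 := by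
    intro a b
    ext v
    have := fderiv_sesq_holo H (hkts a) (hkts b) v
    have hp2 : sesq H (kt a 0) (fderiv ℂ (kt b) 0 1) = 0 := by
      rw [← sesq_conj hH'.1, hperp, map_zero]
    rw [hdir a, hdir b, sesq_smul_left, sesq_smul_right, hperp, hp2, mul_zero, mul_zero,
      add_zero] at this
    exact this
  have hone : gram H (fun b => kt b 0) = 1 := by
    rw [← horth]; congr 1; ext1 b; exact hkt0 b
  obtain ⟨hd0, hd2⟩ := levi_det_of_eq_one hM2 hcrit hone 1 1
  have hgauge : levi (fun s => ((Real.log (gram H fun b => kt b s).det.re : ℝ) : ℂ)) 0 1 1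
      = levi (fun s => ((Real.log (gram H fun a => k a s).det.re : ℝ) : ℂ)) 0 1 1 := by
    refine levi_log_re_mul_normSq (g := fun s => (gram H fun a => k a s).det)
      (J := fun s => (Q s).det) ?_ (det_re_pos h0) ?_ ?_ (Eventually.of_forall fun s => ?_) 1 1
    · exact contDiffAt_det fun a b => (contDiffAt_sesq_holo H (hk a) (hk b)).of_le two_le_infty
    · exact contDiffAt_det fun a b => ((hQs a b).contDiffAt).of_le le_top
    · simpa [hQ] using hP
    · rw [← Complex.re_mul_ofReal, ← det_gram_sum]
  rw [← hgauge, levi_log_re_of_fderiv_eq_zero (contDiffAt_det hM2) hd0 (by rw [hone, Matrix.det_one]),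
    hd2, Complex.re_sum]
  have hterm : ∀ a, levi (fun s => gram H (fun b => kt b s) a a) 0 1 1
      = sesq H (fderiv ℂ (kt a) 0 1) (fderiv ℂ (kt a) 0 1) := fun a =>
    levi_sesq_holo H (hkts a) (hkts a) 1 1
  simp only [hterm]
  have hnn : ∀ v, 0 ≤ (sesq H v v).re := fun v => by
    by_cases hv : v = 0
    · rw [hv, sesq_zero_left]; simp
    · exact (hH'.2 v hv).le
  refine Finset.sum_pos' (fun a _ => hnn _) ?_
  by_contra! hcon
  have hz : ∀ b, fderiv ℂ (kt b) 0 1 = 0 := by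
    intro b
    by_contra hb
    exact absurd (hH'.2 _ hb) (not_lt.2 (hcon b (Finset.mem_univ b)))
  set V := Submodule.span ℂ (range fun a => k a 0)
  have heV : ∀ b, e b ∈ V := fun b => Submodule.sum_mem _ fun a _ =>
    Submodule.smul_mem _ _ (Submodule.subset_span ⟨a, rfl⟩)
  have hnuV : ∀ b, nu b ∈ V := by
    intro b
    have := hktd b
    rw [hz b] at this
    rw [sub_eq_zero.1 this.symm]
    exact Submodule.sum_mem _ fun c _ => Submodule.smul_mem _ _ (heV c)
  obtain ⟨a, ha⟩ := hmove
  apply ha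
  have hPu : P * P⁻¹ = 1 := Matrix.mul_nonsing_inv P (isUnit_iff_ne_zero.2 hP)
  have : fderiv ℂ (k a) 0 1 = ∑ b, P⁻¹ b a • nu b := by
    simp only [hnu, Finset.smul_sum, smul_smul]
    rw [Finset.sum_comm]
    have h4 : ∀ c, ∑ b, (P⁻¹ b a * P c b) • fderiv ℂ (k c) 0 1
        = (1 : Matrix ι ι ℂ) c a • fderiv ℂ (k c) 0 1 := by
      intro c
      rw [← Finset.sum_smul, ← hPu, Matrix.mul_apply]
      congr 1
      exact Finset.sum_congr rfl fun b _ => mul_comm _ _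
    simp only [h4, Matrix.one_apply, ite_smul, one_smul, zero_smul, Finset.sum_ite_eq',
      Finset.mem_univ, if_true]
  rw [this]
  exact Submodule.sum_mem _ fun b _ => Submodule.smul_mem _ _ (hnuV b)

end Frame

/-! ### Affine coordinates on the blow-up of the Segre cone -/

section Segre

variable {m l : ℕ}

/-- Insert the entry `0` in position `a`. -/
def insZero (a : Fin (m + 1)) (ζ : Fin m → ℂ) : Fin (m + 1) → ℂ := a.insertNth (0 : ℂ) ζ

@[simp] lemma insZero_same (a : Fin (m + 1)) (ζ : Fin m → ℂ) : insZero a ζ a = 0 := by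
  simp [insZero]

@[simp] lemma insZero_succAbove (a : Fin (m + 1)) (ζ : Fin m → ℂ) (i : Fin m) :
    insZero a ζ (a.succAbove i) = ζ i := by simp [insZero]

/-- The entries of `insZero`, as linear functionals. -/
def insZeroCLM (a c : Fin (m + 1)) : (Fin m → ℂ) →L[ℂ] ℂ :=
  LinearMap.toContinuousLinearMap
    { toFun := fun ζ => insZero a ζ c
      map_add' := fun ζ ζ' => by
        refine Fin.succAboveCases a ?_ (fun i => ?_) c <;> simp
      map_smul' := fun r ζ => by
        refine Fin.succAboveCases a ?_ (fun i => ?_) c <;> simp }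

@[simp] lemma insZeroCLM_apply (a c : Fin (m + 1)) (ζ : Fin m → ℂ) :
    insZeroCLM a c ζ = insZero a ζ c := rfl

/-- Insert the entry `1` in position `a`. -/
def insOne (a : Fin (m + 1)) (ζ : Fin m → ℂ) : Fin (m + 1) → ℂ := Pi.single a 1 + insZero a ζ

@[simp] lemma insOne_same (a : Fin (m + 1)) (ζ : Fin m → ℂ) : insOne a ζ a = 1 := by
  simp [insOne]

@[simp] lemma insOne_succAbove (a : Fin (m + 1)) (ζ : Fin m → ℂ) (i : Fin m) :
    insOne a ζ (a.succAbove i) = ζ i := by simp [insOne, Fin.succAbove_ne]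

lemma insOne_ne_zero (a : Fin (m + 1)) (ζ : Fin m → ℂ) : insOne a ζ ≠ 0 := fun h => by
  simpa using congrFun h a

lemma hasFDerivAt_insOne (a c : Fin (m + 1)) (ζ : Fin m → ℂ) :
    HasFDerivAt (fun ζ => insOne a ζ c) (insZeroCLM a c) ζ :=
  (insZeroCLM a c).hasFDerivAt.const_add _

/-- The affine coordinates `(t, ζ, ω)` on the blow-up. -/
abbrev Par (m l : ℕ) : Type := ℂ × (Fin m → ℂ) × (Fin l → ℂ)

/-- The contraction `(t, ζ, ω) ↦ t Z ⊗ W` in affine coordinates. -/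
def segPar (a : Fin (m + 1)) (b : Fin (l + 1)) (p : Par m l) : SegreSpace m l :=
  WithLp.toLp 2 fun cd => p.1 * (insOne a p.2.1 cd.1 * insOne b p.2.2 cd.2)

/-- The frame of the tangent space to the cone along `Z ⊗ W`. -/
def frame (a : Fin (m + 1)) (b : Fin (l + 1)) (p u : Par m l) : SegreSpace m l :=
  WithLp.toLp 2 fun cd => u.1 * (insOne a p.2.1 cd.1 * insOne b p.2.2 cd.2)
    + insZero a u.2.1 cd.1 * insOne b p.2.2 cd.2 + insOne a p.2.1 cd.1 * insZero b u.2.2 cd.2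

/-- The derivative of the frame in the direction `v`. -/
def frameDer (a : Fin (m + 1)) (b : Fin (l + 1)) (p v u : Par m l) : SegreSpace m l :=
  WithLp.toLp 2 fun cd => u.1 * (insZero a v.2.1 cd.1 * insOne b p.2.2 cd.2
      + insOne a p.2.1 cd.1 * insZero b v.2.2 cd.2)
    + insZero a u.2.1 cd.1 * insZero b v.2.2 cd.2 + insZero a v.2.1 cd.1 * insZero b u.2.2 cd.2

@[simp] lemma segPar_apply (a : Fin (m + 1)) (b : Fin (l + 1)) (p : Par m l) (c d) :
    segPar a b p (c, d) = p.1 * (insOne a p.2.1 c * insOne b p.2.2 d) := rfl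

@[simp] lemma frame_apply (a : Fin (m + 1)) (b : Fin (l + 1)) (p u : Par m l) (c d) :
    frame a b p u (c, d) = u.1 * (insOne a p.2.1 c * insOne b p.2.2 d)
    + insZero a u.2.1 c * insOne b p.2.2 d + insOne a p.2.1 c * insZero b u.2.2 d := rfl

@[simp] lemma frameDer_apply (a : Fin (m + 1)) (b : Fin (l + 1)) (p v u : Par m l) (c d) :
    frameDer a b p v u (c, d) = u.1 * (insZero a v.2.1 c * insOne b p.2.2 d
      + insOne a p.2.1 c * insZero b v.2.2 d)
    + insZero a u.2.1 c * insZero b v.2.2 d + insZero a v.2.1 c * insZero b u.2.2 d := rfl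

/-- The frame, linear in its second argument. -/
def frameCLM (a : Fin (m + 1)) (b : Fin (l + 1)) (p : Par m l) : Par m l →L[ℂ] SegreSpace m l :=
  LinearMap.toContinuousLinearMap
    { toFun := frame a b p
      map_add' := fun u u' => by
        ext ⟨c, d⟩
        have h1 := map_add (insZeroCLM a c) u.2.1 u'.2.1
        have h2 := map_add (insZeroCLM b d) u.2.2 u'.2.2
        simp only [insZeroCLM_apply] at h1 h2
        simp only [frame_apply, PiLp.add_apply, Prod.fst_add, Prod.snd_add, h1, h2]
        ring
      map_smul' := fun r u => by
        ext ⟨c, d⟩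
        have h1 := map_smul (insZeroCLM a c) r u.2.1
        have h2 := map_smul (insZeroCLM b d) r u.2.2
        simp only [insZeroCLM_apply, smul_eq_mul] at h1 h2
        simp only [frame_apply, PiLp.smul_apply, Prod.smul_fst, Prod.smul_snd, h1, h2, smul_eq_mul,
          RingHom.id_apply]
        ring }

/-- The map `(dt, dζ, dω) ↦ (dt, t dζ, t dω)`. -/
def scaleCLM (t : ℂ) : Par m l →L[ℂ] Par m l :=
  (ContinuousLinearMap.fst ℂ _ _).prod (t • ContinuousLinearMap.snd ℂ _ _)

@[simp] lemma scaleCLM_apply (t : ℂ) (u : Par m l) : scaleCLM t u = (u.1, t • u.2) := rfl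

lemma frame_injective (a : Fin (m + 1)) (b : Fin (l + 1)) (p : Par m l) :
    Function.Injective (frameCLM a b p) := by
  rw [injective_iff_map_eq_zero]
  intro u hu
  have h : ∀ c d, frame a b p u (c, d) = 0 := fun c d => congrArg (fun x : SegreSpace m l => x (c, d)) hu
  have h0 : u.1 = 0 := by simpa using h a b
  refine Prod.ext h0 (Prod.ext ?_ ?_)
  · ext i; simpa [h0] using h (a.succAbove i) b
  · ext i; simpa [h0] using h a (b.succAbove i)

lemma hasFDerivAt_line {E : Type*} [NormedAddCommGroup E] [NormedSpace ℂ E] (z v : E) (s : ℂ) :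
    HasFDerivAt (fun s : ℂ => z + s • v) ((ContinuousLinearMap.id ℂ ℂ).smulRight v) s :=
  ((ContinuousLinearMap.id ℂ ℂ).smulRight v).hasFDerivAt.const_add z

/-- The tangent spaces of the Segre cone move in every direction of `ℙ^m × ℙ^l`. -/
lemma exists_frameDer_notMem (hm : 1 ≤ m) (hl : 1 ≤ l) (a : Fin (m + 1)) (b : Fin (l + 1))
    (p v : Par m l) (hv : v.2 ≠ 0) (U : Set (Par m l)) (hU : Submodule.span ℂ U = ⊤) :
    ∃ u ∈ U, frameDer a b p v u ∉ Submodule.span ℂ (range fun u : U => frame a b p u) := by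
  by_contra! hcon
  have key : ∀ u ∈ U, ∀ c d, insZero a u.2.1 c * insZero b v.2.2 d
      + insZero a v.2.1 c * insZero b u.2.2 d = 0 := by
    intro u hu c d
    set Φ : SegreSpace m l →L[ℂ] ℂ := coordCLM (c, d) - insOne a p.2.1 c • coordCLM (a, d)
      - insOne b p.2.2 d • coordCLM (c, b) + (insOne a p.2.1 c * insOne b p.2.2 d) • coordCLM (a, b)
      with hΦ
    have hle : Submodule.span ℂ (range fun u : U => frame a b p u) ≤ LinearMap.ker Φ.toLinearMap := by
      rw [Submodule.span_le]
      rintro _ ⟨u, rfl⟩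
      rw [SetLike.mem_coe, LinearMap.mem_ker]
      simp only [hΦ, ContinuousLinearMap.coe_coe, _root_.add_apply, _root_.sub_apply,
        _root_.smul_apply, coordCLM_apply, frame_apply, insOne_same, insZero_same, smul_eq_mul]
      ring
    have h1 : Φ (frameDer a b p v u) = 0 := hle (hcon u hu)
    simp only [hΦ, _root_.add_apply, _root_.sub_apply,
        _root_.smul_apply, coordCLM_apply, frameDer_apply, insOne_same, insZero_same, smul_eq_mul] at h1
    linear_combination h1
  have key2 : ∀ u : Par m l, ∀ c d, insZero a u.2.1 c * insZero b v.2.2 d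
      + insZero a v.2.1 c * insZero b u.2.2 d = 0 := by
    intro u c d
    set Ψ : Par m l →ₗ[ℂ] ℂ := (insZero b v.2.2 d • (insZeroCLM a c).comp
        ((ContinuousLinearMap.fst ℂ _ _).comp (ContinuousLinearMap.snd ℂ _ _))
      + insZero a v.2.1 c • (insZeroCLM b d).comp
        ((ContinuousLinearMap.snd ℂ _ _).comp (ContinuousLinearMap.snd ℂ _ _)) :
        Par m l →L[ℂ] ℂ).toLinearMap with hΨ
    have hΨa : ∀ u : Par m l, Ψ u = insZero a u.2.1 c * insZero b v.2.2 d
      + insZero a v.2.1 c * insZero b u.2.2 d := fun u => by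
      simp [hΨ]; ring
    have hle : (⊤ : Submodule ℂ (Par m l)) ≤ LinearMap.ker Ψ := by
      rw [← hU, Submodule.span_le]
      intro u hu
      rw [SetLike.mem_coe, LinearMap.mem_ker, hΨa]
      exact key u hu c d
    rw [← hΨa]
    exact hle (Submodule.mem_top (x := u))
  apply hv
  refine Prod.ext ?_ ?_
  · ext i
    have := key2 (0, 0, Pi.single ⟨0, hl⟩ 1) (a.succAbove i) (b.succAbove ⟨0, hl⟩)
    have h0 : insZero a (0 : Fin m → ℂ) = 0 := funext fun c => map_zero (insZeroCLM a c)
    simpa [h0] using this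
  · ext i
    have := key2 (0, Pi.single ⟨0, hm⟩ 1, 0) (a.succAbove ⟨0, hm⟩) (b.succAbove i)
    have h0 : insZero b (0 : Fin l → ℂ) = 0 := funext fun c => map_zero (insZeroCLM b c)
    simpa [h0] using this

variable {n : ℕ} (L : Cn (Fin n) ≃L[ℂ] Par m l) (a : Fin (m + 1)) (b : Fin (l + 1))

lemma hasFDerivAt_L1 (z : Cn (Fin n)) : HasFDerivAt (fun z => (L z).1)
    ((ContinuousLinearMap.fst ℂ _ _).comp (L : Cn (Fin n) →L[ℂ] Par m l)) z :=
  ((ContinuousLinearMap.fst ℂ _ _).comp (L : Cn (Fin n) →L[ℂ] Par m l)).hasFDerivAt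

lemma hasFDerivAt_insOne_L1 (c : Fin (m + 1)) (z : Cn (Fin n)) :
    HasFDerivAt (fun z => insOne a (L z).2.1 c) ((insZeroCLM a c).comp
      (((ContinuousLinearMap.fst ℂ _ _).comp (ContinuousLinearMap.snd ℂ _ _)).comp
        (L : Cn (Fin n) →L[ℂ] Par m l))) z :=
  (hasFDerivAt_insOne a c _).comp z (((ContinuousLinearMap.fst ℂ _ _).comp
    (ContinuousLinearMap.snd ℂ _ _)).comp (L : Cn (Fin n) →L[ℂ] Par m l)).hasFDerivAt

lemma hasFDerivAt_insOne_L2 (d : Fin (l + 1)) (z : Cn (Fin n)) :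
    HasFDerivAt (fun z => insOne b (L z).2.2 d) ((insZeroCLM b d).comp
      (((ContinuousLinearMap.snd ℂ _ _).comp (ContinuousLinearMap.snd ℂ _ _)).comp
        (L : Cn (Fin n) →L[ℂ] Par m l))) z :=
  (hasFDerivAt_insOne b d _).comp z (((ContinuousLinearMap.snd ℂ _ _).comp
    (ContinuousLinearMap.snd ℂ _ _)).comp (L : Cn (Fin n) →L[ℂ] Par m l)).hasFDerivAt

lemma contDiff_insOne_L1 (c : Fin (m + 1)) : ContDiff ℂ ω (fun z => insOne a (L z).2.1 c) :=
  contDiff_const.add ((insZeroCLM a c).comp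
      (((ContinuousLinearMap.fst ℂ _ _).comp (ContinuousLinearMap.snd ℂ _ _)).comp
        (L : Cn (Fin n) →L[ℂ] Par m l))).contDiff

lemma contDiff_insOne_L2 (d : Fin (l + 1)) : ContDiff ℂ ω (fun z => insOne b (L z).2.2 d) :=
  contDiff_const.add ((insZeroCLM b d).comp
      (((ContinuousLinearMap.snd ℂ _ _).comp (ContinuousLinearMap.snd ℂ _ _)).comp
        (L : Cn (Fin n) →L[ℂ] Par m l))).contDiff

lemma contDiff_L1 : ContDiff ℂ ω (fun z => (L z).1) :=
  ((ContinuousLinearMap.fst ℂ _ _).comp (L : Cn (Fin n) →L[ℂ] Par m l)).contDiff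

lemma contDiff_segPar : ContDiff ℂ ω (fun z => segPar a b (L z)) := by
  rw [contDiff_euclidean]
  rintro ⟨c, d⟩
  exact (contDiff_L1 L).mul ((contDiff_insOne_L1 L a c).mul (contDiff_insOne_L2 L b d))

lemma contDiff_frame (u : Par m l) : ContDiff ℂ ω (fun z => frame a b (L z) u) := by
  rw [contDiff_euclidean]
  rintro ⟨c, d⟩
  have h1 := contDiff_insOne_L1 L a c
  have h2 := contDiff_insOne_L2 L b d
  exact ((contDiff_const.mul (h1.mul h2)).add (contDiff_const.mul h2)).add (h1.mul contDiff_const)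

lemma fderiv_segPar (z v : Cn (Fin n)) :
    fderiv ℂ (fun z => segPar a b (L z)) z v = frame a b (L z) (scaleCLM (L z).1 (L v)) := by
  ext ⟨c, d⟩
  have h1 := (coordCLM (c, d)).hasFDerivAt.comp z
    ((contDiff_segPar L a b).contDiffAt.differentiableAt (by simp)).hasFDerivAt
  have h2 := (hasFDerivAt_L1 L z).mul ((hasFDerivAt_insOne_L1 L a c z).mul
    (hasFDerivAt_insOne_L2 L b d z))
  have h3 := congrArg (fun T => T v) (h1.unique h2)
  simp only [ContinuousLinearMap.comp_apply, coordCLM_apply, _root_.add_apply, _root_.smul_apply,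
    smul_eq_mul, ContinuousLinearEquiv.coe_coe, ContinuousLinearMap.coe_fst',
    ContinuousLinearMap.coe_snd', insZeroCLM_apply, Pi.mul_apply] at h3
  have h4 := map_smul (insZeroCLM a c) (L z).1 (L v).2.1
  have h5 := map_smul (insZeroCLM b d) (L z).1 (L v).2.2
  simp only [insZeroCLM_apply, smul_eq_mul] at h4 h5
  rw [h3]
  simp only [scaleCLM_apply, frame_apply, Prod.smul_fst, Prod.smul_snd, h4, h5]
  ring

lemma fderiv_frame (u : Par m l) (z v : Cn (Fin n)) :
    fderiv ℂ (fun z => frame a b (L z) u) z v = frameDer a b (L z) (L v) u := by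
  ext ⟨c, d⟩
  have h1 := (coordCLM (c, d)).hasFDerivAt.comp z
    ((contDiff_frame L a b u).contDiffAt.differentiableAt (by simp)).hasFDerivAt
  have hi1 := hasFDerivAt_insOne_L1 L a c z
  have hi2 := hasFDerivAt_insOne_L2 L b d z
  have h2 := (((hi1.mul hi2).const_mul u.1).add (hi2.const_mul (insZero a u.2.1 c))).add
    (hi1.mul_const (insZero b u.2.2 d))
  have h3 := congrArg (fun T => T v) (h1.unique h2)
  simp only [ContinuousLinearMap.comp_apply, coordCLM_apply, _root_.add_apply, _root_.smul_apply,
    smul_eq_mul, ContinuousLinearEquiv.coe_coe, ContinuousLinearMap.coe_fst',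
    ContinuousLinearMap.coe_snd', insZeroCLM_apply] at h3
  rw [h3]
  simp only [frameDer_apply]
  ring

variable (H : SegreSpace m l → Matrix (Fin (m + 1) × Fin (l + 1)) (Fin (m + 1) × Fin (l + 1)) ℂ)

/-- The pullback of `H` to the blow-up. -/
def pullCone : Cn (Fin n) → Matrix (Fin n) (Fin n) ℂ := pullMat H fun z => segPar a b (L z)

/-- The Gram matrix of the frame. -/
def gramCone (z : Cn (Fin n)) : Matrix (Fin n) (Fin n) ℂ :=
  gram (H (segPar a b (L z))) fun i => frame a b (L z) (L (EuclideanSpace.single i 1))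

variable {H}

lemma contDiffAt_pullCone {z : Cn (Fin n)}
    (hH : ∀ α β, ContDiffAt ℝ ∞ (fun x => H x α β) (segPar a b (L z))) (i j : Fin n) :
    ContDiffAt ℝ ∞ (fun z => pullCone L a b H z i j) z :=
  contDiffAt_pullMat hH (contDiff_segPar L a b).contDiffAt i j

lemma contDiffAt_gramCone {z : Cn (Fin n)}
    (hH : ∀ α β, ContDiffAt ℝ ∞ (fun x => H x α β) (segPar a b (L z))) (i j : Fin n) :
    ContDiffAt ℝ ∞ (fun z => gramCone L a b H z i j) z :=
  ContDiffAt.sesq (fun α β => (hH α β).comp z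
      (((contDiff_segPar L a b).contDiffAt.restrict_scalars ℝ).of_le le_top))
    (((contDiff_frame L a b _).contDiffAt.restrict_scalars ℝ).of_le le_top)
    (((contDiff_frame L a b _).contDiffAt.restrict_scalars ℝ).of_le le_top)

lemma gramCone_eq_pullLin (z : Cn (Fin n)) : gramCone L a b H z
    = pullLin (H (segPar a b (L z))) ((frameCLM a b (L z)).comp (L : Cn (Fin n) →L[ℂ] Par m l)) := rfl

lemma posDef_pullLin {ι κ : Type} [Fintype ι] [Fintype κ] [DecidableEq ι] [DecidableEq κ]
    {G : Matrix κ κ ℂ} (hG : G.PosDef) {T : Cn ι →L[ℂ] Cn κ} (hi : Function.Injective T) :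
    (pullLin G T).PosDef := by
  have h := posDef_pullMat (G := fun _ => G) (h := T) (z := 0) hG (by rw [T.fderiv]; exact hi)
  have h2 : pullMat (fun _ => G) T 0 = pullLin G T := by
    ext a b
    simp only [pullMat, pullLin, T.fderiv]
  rwa [h2] at h

lemma posDef_gramCone {z : Cn (Fin n)} (hH : (H (segPar a b (L z))).PosDef) :
    (gramCone L a b H z).PosDef := by
  rw [gramCone_eq_pullLin]
  exact posDef_pullLin hH ((frame_injective a b (L z)).comp L.injective)

lemma sesq_pullCone (z v w : Cn (Fin n)) : sesq (pullCone L a b H z) v w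
    = sesq (H (segPar a b (L z))) (frame a b (L z) (scaleCLM (L z).1 (L v)))
      (frame a b (L z) (scaleCLM (L z).1 (L w))) := by
  rw [pullCone, sesq_pullMat, fderiv_segPar, fderiv_segPar]

/-- The endomorphism `diag(1, t, …, t)` of `ℂ^n`. -/
def scaleCn (z : Cn (Fin n)) : Cn (Fin n) →L[ℂ] Cn (Fin n) :=
  (L.symm : Par m l →L[ℂ] Cn (Fin n)).comp ((scaleCLM (L z).1).comp (L : Cn (Fin n) →L[ℂ] Par m l))

lemma det_pullCone (z : Cn (Fin n)) : (pullCone L a b H z).det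
    = (gramCone L a b H z).det * Complex.normSq (detLin (scaleCn L z)) := by
  rw [← det_pullLin]
  congr 1
  ext i j
  have h : ∀ v w, sesq (gramCone L a b H z) v w
      = sesq (H (segPar a b (L z))) (frame a b (L z) (L v)) (frame a b (L z) (L w)) := fun v w =>
    (sesq_of_sesquilinear (fun v w => sesq (H (segPar a b (L z)))
      (frameCLM a b (L z) (L v)) (frameCLM a b (L z) (L w)))
      (fun v v' w => by simp only [map_add, sesq_add_left])
      (fun c v w => by simp only [map_smul, sesq_smul_left])
      (fun v w w' => by simp only [map_add, sesq_add_right])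
      (fun c v w => by simp only [map_smul, sesq_smul_right]) v w).symm
  rw [← sesq_single (pullCone L a b H z), sesq_pullCone, pullLin, h]
  simp [scaleCn]

lemma contDiff_detLin_scaleCn : ContDiff ℂ ω fun z => detLin (scaleCn L z) := by
  rw [contDiff_iff_contDiffAt]
  intro z
  refine contDiffAt_det fun α i => ?_
  have h1 : ContDiff ℂ ω fun z => (((L (EuclideanSpace.single i 1)).1,
      (L z).1 • (L (EuclideanSpace.single i 1)).2) : Par m l) :=
    contDiff_const.prodMk ((contDiff_L1 L).smul contDiff_const)
  exact ((coordCLM α).contDiff.comp ((L.symm : Par m l →L[ℂ] Cn (Fin n)).contDiff.comp h1)).contDiffAt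

lemma injective_scaleCn {z : Cn (Fin n)} (hz : (L z).1 ≠ 0) : Function.Injective (scaleCn L z) := by
  intro u u' h
  have h1 : scaleCLM (L z).1 (L u) = scaleCLM (L z).1 (L u') := L.symm.injective h
  simp only [scaleCLM_apply, Prod.mk.injEq] at h1
  exact L.injective (Prod.ext h1.1 (smul_right_injective _ hz h1.2))

lemma leviMat_pullCone {z : Cn (Fin n)} (hz : (L z).1 ≠ 0)
    (hH : ∀ α β, ContDiffAt ℝ ∞ (fun x => H x α β) (segPar a b (L z)))
    (hp : (H (segPar a b (L z))).PosDef) :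
    leviMat (pullCone L a b H) z = leviMat (gramCone L a b H) z := by
  ext i j
  refine levi_log_re_mul_normSq (g := fun z => (gramCone L a b H z).det)
    (J := fun z => detLin (scaleCn L z)) ?_ (det_re_pos (posDef_gramCone L a b hp)) ?_
    (detLin_ne_zero (injective_scaleCn L hz)) (Eventually.of_forall fun z' => ?_) _ _
  · exact contDiffAt_det fun i j => (contDiffAt_gramCone L a b hH i j).of_le two_le_infty
  · exact (contDiff_detLin_scaleCn L).contDiffAt.of_le le_top
  · rw [det_pullCone, Complex.re_mul_ofReal]

/-- On the exceptional divisor, `∂∂̄ log det` is positive on the kernel of the pulled back metric. -/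
theorem leviMat_gramCone_pos (hm : 1 ≤ m) (hl : 1 ≤ l) {z : Cn (Fin n)} (hz : (L z).1 = 0)
    (hH : ∀ α β, ContDiffAt ℝ ∞ (fun x => H x α β) 0) (hp : (H 0).PosDef) {v : Cn (Fin n)}
    (hv : v ≠ 0) (hAv : (sesq (pullCone L a b H z) v v).re ≤ 0) :
    0 < (sesq (leviMat (gramCone L a b H) z) v v).re := by
  have hseg : ∀ z, (L z).1 = 0 → segPar a b (L z) = 0 := fun z hz => by
    ext ⟨c, d⟩; simp [hz]
  have hp' := posDef_iff_sesq.1 hp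
  rw [sesq_pullCone, hseg z hz] at hAv
  have h0 : frameCLM a b (L z) (scaleCLM (L z).1 (L v)) = 0 := by
    by_contra hne
    exact absurd (hp'.2 _ hne) (not_lt.2 hAv)
  have h1 : scaleCLM (L z).1 (L v) = 0 := frame_injective a b (L z) (by rw [h0, map_zero])
  have hv1 : (L v).1 = 0 := congrArg Prod.fst h1
  have hv2 : (L v).2 ≠ 0 := fun h => hv (L.injective (by rw [map_zero]; exact Prod.ext hv1 h))
  set k : Fin n → ℂ → SegreSpace m l := fun i s =>
    frame a b (L (z + s • v)) (L (EuclideanSpace.single i 1)) with hk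
  have hline : ContDiff ℂ ω fun s : ℂ => z + s • v := contDiff_const.add (contDiff_id.smul contDiff_const)
  have hd := hasFDerivAt_line z v 0
  have hzz : z + (0 : ℂ) • v = z := by simp
  have hHz : ∀ α β, ContDiffAt ℝ ∞ (fun x => H x α β) (segPar a b (L z)) := by rwa [hseg z hz]
  have hpz : (H (segPar a b (L z))).PosDef := by rwa [hseg z hz]
  have hsm : ContDiffAt ℝ 2 (logDet (gramCone L a b H)) (z + (0 : ℂ) • v) := by
    rw [hzz]
    exact (contDiffAt_logDet (contDiffAt_gramCone L a b hHz)
      (det_re_pos (posDef_gramCone L a b hpz))).of_le two_le_infty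
  have h2 := levi_comp (f := logDet (gramCone L a b H)) (h := fun s : ℂ => z + s • v) (z := 0)
    hsm (hline.contDiffAt.of_le le_top) 1 1
  rw [hd.fderiv, hzz] at h2
  simp only [ContinuousLinearMap.smulRight_apply, ContinuousLinearMap.id_apply, one_smul] at h2
  rw [sesq_leviMat, ← h2]
  have h3 : (fun s : ℂ => logDet (gramCone L a b H) (z + s • v))
      = fun s => ((Real.log (gram (H 0) fun i => k i s).det.re : ℝ) : ℂ) := by
    ext s
    have : segPar a b (L (z + s • v)) = 0 := hseg _ (by simp [hz, hv1])
    simp only [logDet, gramCone, this, hk]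
  rw [h3]
  have hk0 : ∀ i, k i 0 = frame a b (L z) (L (EuclideanSpace.single i 1)) := fun i => by
    simp [hk]
  refine levi_log_det_gram_pos hp (fun i => ((contDiff_frame L a b _).comp hline).contDiffAt) ?_ ?_
  · have := posDef_gramCone L a b hpz
    rw [gramCone, hseg z hz] at this
    simpa only [hk0] using this
  · set U : Set (Par m l) := range fun i : Fin n => L (EuclideanSpace.single i 1) with hU
    have hUtop : Submodule.span ℂ U = ⊤ := by
      rw [eq_top_iff]
      intro u _
      have hu : u = ∑ i, (L.symm u) i • L (EuclideanSpace.single i 1) := by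
        conv_lhs => rw [← L.apply_symm_apply u, ← euclidean_sum_single (L.symm u)]
        rw [map_sum]
        exact Finset.sum_congr rfl fun i _ => map_smul L _ _
      rw [hu]
      exact Submodule.sum_mem _ fun i _ => Submodule.smul_mem _ _ (Submodule.subset_span ⟨i, rfl⟩)
    obtain ⟨_, ⟨i, rfl⟩, hi⟩ := exists_frameDer_notMem hm hl a b (L z) (L v) hv2 U hUtop
    refine ⟨i, fun hmem => hi ?_⟩
    have hder : fderiv ℂ (k i) 0 1 = frameDer a b (L z) (L v) (L (EuclideanSpace.single i 1)) := by
      have h4 : HasFDerivAt (fun z => frame a b (L z) (L (EuclideanSpace.single i 1)))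
          (fderiv ℂ (fun z => frame a b (L z) (L (EuclideanSpace.single i 1))) (z + (0 : ℂ) • v))
          (z + (0 : ℂ) • v) :=
        ((contDiff_frame L a b _).contDiffAt.differentiableAt (by simp)).hasFDerivAt
      have h5 := (HasFDerivAt.comp (g := fun z => frame a b (L z) (L (EuclideanSpace.single i 1)))
        (0 : ℂ) h4 hd).fderiv
      change fderiv ℂ (k i) 0 = _ at h5
      rw [h5, hzz]
      simp [fderiv_frame]
    rw [hder] at hmem
    refine Submodule.span_mono ?_ hmem
    rintro _ ⟨i, rfl⟩
    exact ⟨⟨_, ⟨i, rfl⟩⟩, (hk0 i).symm⟩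

end Segre

/-! ### Small multiples of a form that is positive on the kernel -/

lemma eventually_pos_add_smul {n : ℕ} {A B : Cn (Fin n) → Matrix (Fin n) (Fin n) ℂ} {z : Cn (Fin n)}
    (hA : ∀ i j, ContinuousAt (fun z => A z i j) z) (hB : ∀ i j, ContinuousAt (fun z => B z i j) z)
    (hA0 : ∀ᶠ z in 𝓝 z, ∀ v, 0 ≤ (sesq (A z) v v).re)
    (hAB : ∀ v, v ≠ 0 → (sesq (A z) v v).re ≤ 0 → 0 < (sesq (B z) v v).re) :
    ∀ᶠ q : Cn (Fin n) × ℝ in 𝓝 z ×ˢ 𝓝[>] 0, ∀ v, v ≠ 0 →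
      0 < (sesq (A q.1 + (q.2 : ℂ) • B q.1) v v).re := by
  have hcont : ∀ {A : Cn (Fin n) → Matrix (Fin n) (Fin n) ℂ},
      (∀ i j, ContinuousAt (fun z => A z i j) z) → ∀ v,
      Tendsto (fun q : (Cn (Fin n) × ℝ) × Cn (Fin n) => (sesq (A q.1.1) q.2 q.2).re)
        ((𝓝 z ×ˢ 𝓝[>] 0) ×ˢ 𝓝 v) (𝓝 (sesq (A z) v v).re) := by
    intro A hA v
    have t1 : Tendsto (fun q : (Cn (Fin n) × ℝ) × Cn (Fin n) => q.1.1)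
        ((𝓝 z ×ˢ 𝓝[>] 0) ×ˢ 𝓝 v) (𝓝 z) := tendsto_fst.comp tendsto_fst
    have t2 : Tendsto (fun q : (Cn (Fin n) × ℝ) × Cn (Fin n) => q.2)
        ((𝓝 z ×ˢ 𝓝[>] 0) ×ˢ 𝓝 v) (𝓝 v) := tendsto_snd
    have t3 : ∀ i, Tendsto (fun q : (Cn (Fin n) × ℝ) × Cn (Fin n) => q.2 i)
        ((𝓝 z ×ˢ 𝓝[>] 0) ×ˢ 𝓝 v) (𝓝 (v i)) := fun i =>
      ((coordCLM i).continuous.tendsto v).comp t2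
    refine (Complex.continuous_re.tendsto _).comp ?_
    exact tendsto_finsetSum _ fun i _ => tendsto_finsetSum _ fun j _ =>
      (((hA i j).tendsto.comp t1).mul (t3 i)).mul ((Complex.continuous_conj.tendsto _).comp (t3 j))
  have hsphere : ∀ v ∈ Metric.sphere (0 : Cn (Fin n)) 1,
      ∀ᶠ q : (Cn (Fin n) × ℝ) × Cn (Fin n) in (𝓝 z ×ˢ 𝓝[>] 0) ×ˢ 𝓝 v,
        0 < (sesq (A q.1.1 + (q.1.2 : ℂ) • B q.1.1) q.2 q.2).re := by
    intro v hv
    have hv0 : v ≠ 0 := by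
      rintro rfl; simp at hv
    have hexp : ∀ q : (Cn (Fin n) × ℝ) × Cn (Fin n),
        (sesq (A q.1.1 + (q.1.2 : ℂ) • B q.1.1) q.2 q.2).re
          = (sesq (A q.1.1) q.2 q.2).re + q.1.2 * (sesq (B q.1.1) q.2 q.2).re := fun q => by
      rw [sesq_add_matrix, sesq_smul_matrix, Complex.add_re, Complex.re_ofReal_mul]
    have t0 : Tendsto (fun q : (Cn (Fin n) × ℝ) × Cn (Fin n) => q.1.2)
        ((𝓝 z ×ˢ 𝓝[>] 0) ×ˢ 𝓝 v) (𝓝[>] 0) := tendsto_snd.comp tendsto_fst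
    have t1 : Tendsto (fun q : (Cn (Fin n) × ℝ) × Cn (Fin n) => q.1.1)
        ((𝓝 z ×ˢ 𝓝[>] 0) ×ˢ 𝓝 v) (𝓝 z) := tendsto_fst.comp tendsto_fst
    by_cases h : (sesq (A z) v v).re ≤ 0
    · filter_upwards [(hcont hB v).eventually (lt_mem_nhds (hAB v hv0 h)), t0.eventually self_mem_nhdsWithin,
        t1.eventually hA0] with q h1 h2 h3
      rw [hexp]
      exact add_pos_of_nonneg_of_pos (h3 _) (mul_pos h2 h1)
    · have t2 := (hcont hA v).add ((t0.mono_right nhdsWithin_le_nhds).mul (hcont hB v))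
      rw [zero_mul, add_zero] at t2
      filter_upwards [t2.eventually (lt_mem_nhds (not_le.1 h))] with q h1
      rw [hexp]; exact h1
  have h1 : ∀ᶠ q : Cn (Fin n) × ℝ in 𝓝 z ×ˢ 𝓝[>] 0, ∀ v ∈ Metric.sphere (0 : Cn (Fin n)) 1,
      0 < (sesq (A q.1 + (q.2 : ℂ) • B q.1) v v).re :=
    (Filter.Eventually.curry (p := fun q : (Cn (Fin n) × ℝ) × Cn (Fin n) =>
      0 < (sesq (A q.1.1 + (q.1.2 : ℂ) • B q.1.1) q.2 q.2).re)
      ((isCompact_sphere (0 : Cn (Fin n)) 1).mem_prod_nhdsSet_of_forall hsphere)).mono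
        fun _ h => h.self_of_nhdsSet
  filter_upwards [h1] with q hq v hv
  have hn : ‖v‖ ≠ 0 := norm_ne_zero_iff.2 hv
  have h2 := hq (((‖v‖⁻¹ : ℝ) : ℂ) • v) (by simp [norm_smul, hn])
  rw [sesq_smul_left, sesq_smul_right, Complex.conj_ofReal, ← mul_assoc, ← Complex.ofReal_mul,
    Complex.re_ofReal_mul] at h2
  exact (pos_iff_pos_of_mul_pos h2).1 (by positivity)

/-! ### Extension of `g - ε Ric(g)` over a nowhere dense set -/

section MderLemmas

variable {n : ℕ} {M : Type} [TopologicalSpace M] [ChartedSpace (Cn (Fin n)) M]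

lemma mder_comp {σ σ' : Cn (Fin n) → M} {h : Cn (Fin n) → Cn (Fin n)} {z : Cn (Fin n)}
    (e : σ =ᶠ[𝓝 z] fun w => σ' (h w))
    (hσ : MDifferentiableAt 𝓘(ℂ, Cn (Fin n)) 𝓘(ℂ, Cn (Fin n)) σ' (h z))
    (hh : DifferentiableAt ℂ h z) (v : Cn (Fin n)) :
    mder σ z v = mder σ' (h z) (fderiv ℂ h z v) := by
  have h1 : mder σ z = mder (σ' ∘ h) z :=
    e.mfderiv_eq (I := 𝓘(ℂ, Cn (Fin n))) (I' := 𝓘(ℂ, Cn (Fin n)))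
  have h2 : mder (σ' ∘ h) z = (mder σ' (h z)).comp (fderiv ℂ h z) := by
    rw [← mfderiv_eq_fderiv]
    exact mfderiv_comp z (g := σ') (f := h) hσ hh.mdifferentiableAt
  rw [h1, h2]; rfl

lemma pb_comp (g : SesqField n M) {σ σ' : Cn (Fin n) → M} {h : Cn (Fin n) → Cn (Fin n)}
    {z : Cn (Fin n)} (e : σ =ᶠ[𝓝 z] fun w => σ' (h w))
    (hσ : MDifferentiableAt 𝓘(ℂ, Cn (Fin n)) 𝓘(ℂ, Cn (Fin n)) σ' (h z))
    (hh : DifferentiableAt ℂ h z) : pb g σ z = pullMat (pb g σ') h z := by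
  ext a b
  rw [pullMat, sesq_pb, ← mder_comp e hσ hh, ← mder_comp e hσ hh]
  change g.ev (σ z) _ _ = _
  rw [show σ z = σ' (h z) from e.self_of_nhds]

variable [IsManifold 𝓘(ℂ, Cn (Fin n)) ω M]

lemma mfderiv_chart_mder_symm {φ : OpenPartialHomeomorph M (Cn (Fin n))}
    (hφ : φ ∈ atlas (Cn (Fin n)) M) {z : Cn (Fin n)} (hz : z ∈ φ.target) (v : Cn (Fin n)) :
    (mfderiv 𝓘(ℂ, Cn (Fin n)) 𝓘(ℂ, Cn (Fin n)) φ (φ.symm z) :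
      Tan n M (φ.symm z) →L[ℂ] Cn (Fin n)) (mder φ.symm z v) = v := by
  rw [mfderiv_chart_mder hφ (contMDiffAt_atlas_symm hφ hz) (φ.map_target hz)]
  have : (fun z => φ (φ.symm z)) =ᶠ[𝓝 z] id := by
    filter_upwards [φ.open_target.mem_nhds hz] with w hw using φ.right_inv hw
  rw [this.fderiv_eq, fderiv_id]; rfl

lemma injective_mder_symm {φ : OpenPartialHomeomorph M (Cn (Fin n))}
    (hφ : φ ∈ atlas (Cn (Fin n)) M) {z : Cn (Fin n)} (hz : z ∈ φ.target) :
    Function.Injective (mder φ.symm z) := fun v w h => by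
  rw [← mfderiv_chart_mder_symm hφ hz v, ← mfderiv_chart_mder_symm hφ hz w, h]

lemma surjective_mder_symm {φ : OpenPartialHomeomorph M (Cn (Fin n))}
    (hφ : φ ∈ atlas (Cn (Fin n)) M) {z : Cn (Fin n)} (hz : z ∈ φ.target) :
    Function.Surjective (mder φ.symm z) :=
  (LinearMap.injective_iff_surjective (f := (mder φ.symm z : Cn (Fin n) →ₗ[ℂ] Cn (Fin n)))).1
    (injective_mder_symm hφ hz)

end MderLemmas

section Extension

lemma IsClosedHermAt.congr {n : ℕ} {G G' : Cn (Fin n) → Matrix (Fin n) (Fin n) ℂ} {z : Cn (Fin n)}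
    (h : IsClosedHermAt G z) (hG : G' =ᶠ[𝓝 z] G) : IsClosedHermAt G' z where
  smooth a b := (h.smooth a b).congr_of_eventuallyEq (hG.mono fun w hw => by simp only [hw])
  herm := by rw [hG.self_of_nhds]; exact h.herm
  closed a b c := by
    have e : ∀ a b, (fun w => G' w a b) =ᶠ[𝓝 z] fun w => G w a b := fun a b =>
      hG.mono fun w hw => by simp only [hw]
    rw [wirt, wirt, (e a b).fderiv_eq, (e c b).fderiv_eq]
    exact h.closed a b c

variable {n : ℕ} {M X : Type} [TopologicalSpace M] [ChartedSpace (Cn (Fin n)) M]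
  [TopologicalSpace X] [ChartedSpace (Cn (Fin n)) X]

/-- Near `z`, the pullback of `g` by `σ` and `∂∂̄ log det` of it extend smoothly from `S` as `A` and
`B`, where `A` is semipositive and `B` is positive on the kernel of `A z`. -/
structure IsLocalExtension (g : SesqField n M) (σ : Cn (Fin n) → M) (S : Set (Cn (Fin n)))
    (z : Cn (Fin n)) (A B : Cn (Fin n) → Matrix (Fin n) (Fin n) ℂ) : Prop where
  smooth_fst : ∀ i j, ContDiffAt ℝ ∞ (fun z => A z i j) z
  smooth_snd : ∀ i j, ContDiffAt ℝ ∞ (fun z => B z i j) z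
  eq_fst : ∀ᶠ w in 𝓝 z, w ∈ S → A w = pb g σ w
  eq_snd : ∀ᶠ w in 𝓝 z, w ∈ S → B w = leviMat (pb g σ) w
  nonneg : ∀ᶠ w in 𝓝 z, ∀ v, 0 ≤ (sesq (A w) v v).re
  pos : ∀ v, v ≠ 0 → (sesq (A z) v v).re ≤ 0 → 0 < (sesq (B z) v v).re

lemma IsLocalExtension.smooth {g : SesqField n M} {σ : Cn (Fin n) → M} {S : Set (Cn (Fin n))}
    {z : Cn (Fin n)} {A B : Cn (Fin n) → Matrix (Fin n) (Fin n) ℂ}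
    (h : IsLocalExtension g σ S z A B) (ε : ℝ) (i j : Fin n) :
    ContDiffAt ℝ ∞ (fun z => (A z + (ε : ℂ) • B z) i j) z :=
  (h.smooth_fst i j).add (contDiffAt_const.mul (h.smooth_snd i j))

/-- The sesquilinear form on the tangent space at `x` with matrix `C` in the preferred chart. -/
def formOfMatrix (x : X) (C : Matrix (Fin n) (Fin n) ℂ) : Tan n X x →ₗ[ℂ] Tan n X x →ₗ⋆[ℂ] ℂ :=
  let d : Tan n X x →L[ℂ] Cn (Fin n) :=
    mfderiv 𝓘(ℂ, Cn (Fin n)) 𝓘(ℂ, Cn (Fin n)) (chartAt (Cn (Fin n)) x) x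
  LinearMap.mk₂'ₛₗ (RingHom.id ℂ) (starRingEnd ℂ) (fun v w => sesq C (d v) (d w))
    (fun v v' w => by rw [map_add, sesq_add_left])
    (fun c v w => by rw [map_smul, sesq_smul_left]; rfl)
    (fun v w w' => by rw [map_add, sesq_add_right])
    (fun c v w => by rw [map_smul, sesq_smul_right]; rfl)

variable [IsManifold 𝓘(ℂ, Cn (Fin n)) ω M] [IsManifold 𝓘(ℂ, Cn (Fin n)) ω X]

lemma pb_formOfMatrix (C : X → Matrix (Fin n) (Fin n) ℂ)
    {φ : OpenPartialHomeomorph X (Cn (Fin n))} (hφ : φ ∈ atlas (Cn (Fin n)) X) {z : Cn (Fin n)}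
    (hz : z ∈ φ.target) :
    pb (fun x => formOfMatrix x (C x)) φ.symm z
      = pullMat (fun _ => C (φ.symm z)) (fun w => chartAt (Cn (Fin n)) (φ.symm z) (φ.symm w)) z := by
  ext a b
  rw [pullMat, ← mfderiv_chart_mder (chart_mem_atlas _ _) (contMDiffAt_atlas_symm hφ hz)
    (mem_chart_source _ _), ← mfderiv_chart_mder (chart_mem_atlas _ _) (contMDiffAt_atlas_symm hφ hz)
    (mem_chart_source _ _)]
  rfl

variable {ι : M → X} {r : X → M}

lemma eq_of_tendsto_of_dense {f g : Cn (Fin n) → ℂ} {z : Cn (Fin n)} {S : Set (Cn (Fin n))}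
    (hS : z ∈ closure S) (hf : ContinuousAt f z) (hg : ContinuousAt g z)
    (h : ∀ᶠ w in 𝓝 z, w ∈ S → f w = g w) : f z = g z := by
  have : (𝓝[S] z).NeBot := mem_closure_iff_nhdsWithin_neBot.1 hS
  refine tendsto_nhds_unique (hf.mono_left nhdsWithin_le_nhds)
    ((hg.mono_left (nhdsWithin_le_nhds (s := S))).congr' ?_)
  exact (eventually_nhdsWithin_iff.2 h).mono fun w hw => hw.symm

lemma mem_closure_preimage_chart (hd : Dense (range ι)) (φ : OpenPartialHomeomorph X (Cn (Fin n)))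
    {z : Cn (Fin n)} (hz : z ∈ φ.target) : z ∈ closure (φ.symm ⁻¹' range ι) := by
  rw [mem_closure_iff_frequently]
  have h1 : ∃ᶠ x in 𝓝 (φ.symm z), x ∈ range ι := mem_closure_iff_frequently.1 (hd _)
  rw [← φ.symm.map_nhds_eq (x := z) hz] at h1
  exact h1

lemma contMDiffAt_retract_symm (hr : ContMDiffOn 𝓘(ℂ, Cn (Fin n)) 𝓘(ℂ, Cn (Fin n)) ω r (range ι))
    (ho : IsOpen (range ι)) {φ : OpenPartialHomeomorph X (Cn (Fin n))}
    (hφ : φ ∈ atlas (Cn (Fin n)) X) {z : Cn (Fin n)} (hz : z ∈ φ.target) (hzr : φ.symm z ∈ range ι) :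
    ContMDiffAt 𝓘(ℂ, Cn (Fin n)) 𝓘(ℂ, Cn (Fin n)) ω (fun w => r (φ.symm w)) z :=
  (hr.contMDiffAt (ho.mem_nhds hzr)).comp z (contMDiffAt_atlas_symm hφ hz)

lemma injective_mder_retract_symm (hι : ContMDiff 𝓘(ℂ, Cn (Fin n)) 𝓘(ℂ, Cn (Fin n)) ω ι)
    (hr : ContMDiffOn 𝓘(ℂ, Cn (Fin n)) 𝓘(ℂ, Cn (Fin n)) ω r (range ι))
    (hri : ∀ y, r (ι y) = y) (ho : IsOpen (range ι)) {φ : OpenPartialHomeomorph X (Cn (Fin n))}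
    (hφ : φ ∈ atlas (Cn (Fin n)) X) {z : Cn (Fin n)} (hz : z ∈ φ.target) (hzr : φ.symm z ∈ range ι) :
    Function.Injective (mder (fun w => r (φ.symm w)) z) := by
  have h1 : φ.symm =ᶠ[𝓝 z] ι ∘ fun w => r (φ.symm w) := by
    filter_upwards [(φ.continuousAt_symm hz).eventually (ho.mem_nhds hzr)] with w hw
    obtain ⟨y, hy⟩ := hw
    simp [← hy, hri]
  have h2 : mder φ.symm z = mder (ι ∘ fun w => r (φ.symm w)) z :=
    h1.mfderiv_eq (I := 𝓘(ℂ, Cn (Fin n))) (I' := 𝓘(ℂ, Cn (Fin n)))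
  have h3 := mfderiv_comp z (g := ι) (f := fun w => r (φ.symm w))
    (hι.mdifferentiableAt (by simp))
    ((contMDiffAt_retract_symm hr ho hφ hz hzr).mdifferentiableAt (by simp))
  intro v w h
  apply injective_mder_symm hφ hz
  rw [h2]
  have h4 : ∀ v, mder (ι ∘ fun w => r (φ.symm w)) z v
    = mfderiv 𝓘(ℂ, Cn (Fin n)) 𝓘(ℂ, Cn (Fin n)) ι (r (φ.symm z)) (mder (fun w => r (φ.symm w)) z v) :=
    fun v => congrArg (fun L => L v) h3
  rw [h4, h4, h]

lemma pb_subRicci_retract {g : SesqField n M} (hg : IsKahler g)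
    (hι : ContMDiff 𝓘(ℂ, Cn (Fin n)) 𝓘(ℂ, Cn (Fin n)) ω ι)
    (hr : ContMDiffOn 𝓘(ℂ, Cn (Fin n)) 𝓘(ℂ, Cn (Fin n)) ω r (range ι))
    (hri : ∀ y, r (ι y) = y) (ho : IsOpen (range ι)) {φ : OpenPartialHomeomorph X (Cn (Fin n))}
    (hφ : φ ∈ atlas (Cn (Fin n)) X) {z : Cn (Fin n)} (hz : z ∈ φ.target) (hzr : φ.symm z ∈ range ι)
    (ε : ℝ) :
    pb (subRicci g ε) (fun w => r (φ.symm w)) z = pb g (fun w => r (φ.symm w)) z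
      + (ε : ℂ) • leviMat (pb g fun w => r (φ.symm w)) z :=
  pb_subRicci hg (φ.symm.isOpen_inter_preimage ho)
    (fun _ hw => (contMDiffAt_retract_symm hr ho hφ hw.1 hw.2).contMDiffWithinAt) ⟨hz, hzr⟩
    (injective_mder_retract_symm hι hr hri ho hφ hz hzr) ε

lemma isKahlerAt_pb_retract {g : SesqField n M} (hg : IsKahler g)
    (hι : ContMDiff 𝓘(ℂ, Cn (Fin n)) 𝓘(ℂ, Cn (Fin n)) ω ι)
    (hr : ContMDiffOn 𝓘(ℂ, Cn (Fin n)) 𝓘(ℂ, Cn (Fin n)) ω r (range ι))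
    (hri : ∀ y, r (ι y) = y) (ho : IsOpen (range ι)) {φ : OpenPartialHomeomorph X (Cn (Fin n))}
    (hφ : φ ∈ atlas (Cn (Fin n)) X) {z : Cn (Fin n)} (hz : z ∈ φ.target) (hzr : φ.symm z ∈ range ι) :
    IsKahlerAt (pb g fun w => r (φ.symm w)) z :=
  hg.pb (φ.symm.isOpen_inter_preimage ho)
    (fun _ hw => (contMDiffAt_retract_symm hr ho hφ hw.1 hw.2).contMDiffWithinAt) ⟨hz, hzr⟩
    (injective_mder_retract_symm hι hr hri ho hφ hz hzr)

/-- The local extension away from the exceptional set. -/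
lemma isLocalExtension_of_mem_range {g : SesqField n M} (hg : IsKahler g)
    (hι : ContMDiff 𝓘(ℂ, Cn (Fin n)) 𝓘(ℂ, Cn (Fin n)) ω ι)
    (hr : ContMDiffOn 𝓘(ℂ, Cn (Fin n)) 𝓘(ℂ, Cn (Fin n)) ω r (range ι))
    (hri : ∀ y, r (ι y) = y) (ho : IsOpen (range ι)) {φ : OpenPartialHomeomorph X (Cn (Fin n))}
    (hφ : φ ∈ atlas (Cn (Fin n)) X) {z : Cn (Fin n)} (hz : z ∈ φ.target) (hzr : φ.symm z ∈ range ι) :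
    IsLocalExtension g (fun w => r (φ.symm w)) (φ.symm ⁻¹' range ι) z
      (pb g fun w => r (φ.symm w)) (leviMat (pb g fun w => r (φ.symm w))) := by
  have hK := isKahlerAt_pb_retract hg hι hr hri ho hφ hz hzr
  refine ⟨hK.smooth, (isClosedHermAt_leviMat hK.smooth (det_re_pos hK.posDef)).smooth,
    Eventually.of_forall fun w _ => rfl, Eventually.of_forall fun w _ => rfl, ?_, fun v hv h => ?_⟩
  · filter_upwards [(φ.symm.isOpen_inter_preimage ho).mem_nhds ⟨hz, hzr⟩] with w hw v
    by_cases hv : v = 0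
    · simp [hv, sesq]
    · exact ((posDef_iff_sesq.1
        (isKahlerAt_pb_retract hg hι hr hri ho hφ hw.1 hw.2).posDef).2 v hv).le
  · exact absurd ((posDef_iff_sesq.1 hK.posDef).2 v hv) (not_lt.2 h)

/-- `g - ε Ric(g)` extends over a nowhere dense set in the presence of local extensions, with a
constant `ε₀` independent of the point by compactness. -/
theorem exists_extension [CompactSpace X] {g : SesqField n M} (hg : IsKahler g)
    (hι : ContMDiff 𝓘(ℂ, Cn (Fin n)) 𝓘(ℂ, Cn (Fin n)) ω ι)
    (hr : ContMDiffOn 𝓘(ℂ, Cn (Fin n)) 𝓘(ℂ, Cn (Fin n)) ω r (range ι))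
    (hri : ∀ y, r (ι y) = y) (ho : IsOpen (range ι)) (hd : Dense (range ι))
    (H : ∀ φ ∈ atlas (Cn (Fin n)) X, ∀ z ∈ φ.target, ∃ A B,
      IsLocalExtension g (fun w => r (φ.symm w)) (φ.symm ⁻¹' range ι) z A B) :
    ∃ ε₀ : ℝ, 0 < ε₀ ∧ ∀ ε : ℝ, 0 < ε → ε < ε₀ → IsKahler (subRicci g ε) ∧
      ∃ gX : SesqField n X, IsKahler gX ∧ ∀ (y : M) (v w : Tan n M y),
        gX (ι y) (mfderiv 𝓘(ℂ, Cn (Fin n)) 𝓘(ℂ, Cn (Fin n)) ι y v)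
          (mfderiv 𝓘(ℂ, Cn (Fin n)) 𝓘(ℂ, Cn (Fin n)) ι y w) = subRicci g ε y v w := by
  choose! A B hAB using H
  set e : X → OpenPartialHomeomorph X (Cn (Fin n)) := fun x => chartAt (Cn (Fin n)) x with he
  have hea : ∀ x, e x ∈ atlas (Cn (Fin n)) X := fun x => chart_mem_atlas _ x
  have hes : ∀ x, x ∈ (e x).source := fun x => mem_chart_source _ x
  have het : ∀ x, e x x ∈ (e x).target := fun x => (e x).map_source (hes x)
  set gX : ℝ → SesqField n X := fun ε x =>
    formOfMatrix x (A (e x) (e x x) (e x x) + (ε : ℂ) • B (e x) (e x x) (e x x)) with hgX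
  have key : ∀ φ ∈ atlas (Cn (Fin n)) X, ∀ z ∈ φ.target, ∀ A' B',
      IsLocalExtension g (fun w => r (φ.symm w)) (φ.symm ⁻¹' range ι) z A' B' →
      ∀ᶠ w in 𝓝 z, ∀ ε, pb (gX ε) φ.symm w = A' w + (ε : ℂ) • B' w := by
    intro φ hφ z hz A' B' hAB'
    have c1 : ∀ᶠ w in 𝓝 z, ∀ i j, ContinuousAt (fun w => A' w i j) w :=
      eventually_all.2 fun i => eventually_all.2 fun j =>
        (((hAB'.smooth_fst i j).of_le two_le_infty).eventually (by simp)).mono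
          fun w hw => hw.continuousAt
    have c2 : ∀ᶠ w in 𝓝 z, ∀ i j, ContinuousAt (fun w => B' w i j) w :=
      eventually_all.2 fun i => eventually_all.2 fun j =>
        (((hAB'.smooth_snd i j).of_le two_le_infty).eventually (by simp)).mono
          fun w hw => hw.continuousAt
    filter_upwards [c1, c2, φ.open_target.mem_nhds hz, hAB'.eq_fst.eventually_nhds,
      hAB'.eq_snd.eventually_nhds] with w hA hB hw eA eB ε
    set x := φ.symm w with hx
    have hxs : x ∈ φ.source := φ.map_target hw
    have hE := hAB (e x) (hea x) (e x x) (het x)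
    set h : Cn (Fin n) → Cn (Fin n) := fun w' => e x (φ.symm w') with hh
    have hhw : h w = e x x := rfl
    have hhd : ContDiffAt ℂ ω h w :=
      contDiffAt_chart_comp (hea x) (contMDiffAt_atlas_symm hφ hw) (hes x)
    have hp : pb (gX ε) φ.symm w
        = pullMat (fun w' => A (e x) (e x x) w' + (ε : ℂ) • B (e x) (e x x) w') h w :=
      pb_formOfMatrix (fun x => A (e x) (e x x) (e x x) + (ε : ℂ) • B (e x) (e x x) (e x x)) hφ hw
    rw [hp]
    ext i j
    refine eq_of_tendsto_of_dense (f := fun w => pullMat (fun w' => A (e x) (e x x) w'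
        + (ε : ℂ) • B (e x) (e x x) w') h w i j) (g := fun w => (A' w + (ε : ℂ) • B' w) i j)
      (mem_closure_preimage_chart hd φ hw)
      (contDiffAt_pullMat (fun i j => hE.smooth ε i j) hhd i j).continuousAt
      ((hA i j).add (continuousAt_const.mul (hB i j))) ?_
    have hct : ContinuousAt h w := hhd.continuousAt
    filter_upwards [eA, eB, φ.open_target.mem_nhds hw, hct.eventually hE.eq_fst,
      hct.eventually hE.eq_snd, (φ.continuousAt_symm hw).eventually ((e x).open_source.mem_nhds (hes x)),
      (hhd.of_le (m := 1) le_top).eventually (by simp)] with u uA uB ut uEA uEB us ud hu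
    have hsu : (e x).symm (h u) = φ.symm u := (e x).left_inv us
    have hhu : h u ∈ (e x).target := (e x).map_source us
    have hmem : (e x).symm (h u) ∈ range ι := by rw [hsu]; exact hu
    have hev : (fun w => r (φ.symm w)) =ᶠ[𝓝 u] fun w => (fun w => r ((e x).symm w)) (h w) := by
      filter_upwards [(φ.continuousAt_symm ut).eventually ((e x).open_source.mem_nhds us)] with u' hu'
      simp only [hh, (e x).left_inv hu']
    have hpb := pb_comp (subRicci g ε) hev
      ((contMDiffAt_retract_symm hr ho (hea x) hhu hmem).mdifferentiableAt (by simp))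
      (ud.differentiableAt (by simp))
    change pullMat (fun w' => A (e x) (e x x) w' + (ε : ℂ) • B (e x) (e x x) w') h u i j
      = (A' u + (ε : ℂ) • B' u) i j
    rw [uA hu, uB hu, ← pb_subRicci_retract hg hι hr hri ho hφ ut hu, hpb, pullMat, pullMat,
      uEA hmem, uEB hmem, pb_subRicci_retract hg hι hr hri ho (hea x) hhu hmem]
  have hpos : ∀ x₀ : X, ∀ᶠ q : ℝ × X in 𝓝[>] 0 ×ˢ 𝓝 x₀, ∀ v : Cn (Fin n), v ≠ 0 →
      0 < ((gX q.1).ev q.2 v v).re := by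
    intro x₀
    have hE := hAB (e x₀) (hea x₀) (e x₀ x₀) (het x₀)
    have h1 := eventually_pos_add_smul (fun i j => (hE.smooth_fst i j).continuousAt)
      (fun i j => (hE.smooth_snd i j).continuousAt) hE.nonneg hE.pos
    have t1 : Tendsto (fun q : ℝ × X => e x₀ q.2) (𝓝[>] 0 ×ˢ 𝓝 x₀) (𝓝 (e x₀ x₀)) :=
      ((e x₀).continuousAt (hes x₀)).tendsto.comp tendsto_snd
    have t2 : Tendsto (fun q : ℝ × X => (e x₀ q.2, q.1)) (𝓝[>] 0 ×ˢ 𝓝 x₀)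
        (𝓝 (e x₀ x₀) ×ˢ 𝓝[>] 0) := t1.prodMk tendsto_fst
    filter_upwards [t2.eventually h1, t1.eventually (key _ (hea x₀) _ (het x₀) _ _ hE),
      tendsto_snd.eventually ((e x₀).open_source.mem_nhds (hes x₀))] with q h1 h2 h3 v hv
    obtain ⟨u, rfl⟩ := surjective_mder_symm (hea x₀) ((e x₀).map_source h3) v
    have h4 := h1 u (fun hu => hv (by rw [hu, map_zero]))
    rw [← h2 q.1, sesq_pb, (e x₀).left_inv h3] at h4
    exact h4
  have hall : ∀ᶠ ε in 𝓝[>] (0 : ℝ), ∀ x : X, ∀ v : Cn (Fin n), v ≠ 0 → 0 < ((gX ε).ev x v v).re :=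
    ((Filter.Eventually.curry (p := fun q : ℝ × X => ∀ v : Cn (Fin n), v ≠ 0 →
      0 < ((gX q.1).ev q.2 v v).re)
      (isCompact_univ.mem_prod_nhdsSet_of_forall fun x _ => hpos x)).mono
        fun _ h x => h.self_of_nhdsSet x (mem_univ x))
  obtain ⟨ε₀, hε₀, hε⟩ := mem_nhdsGT_iff_exists_Ioo_subset.1 hall
  refine ⟨ε₀, hε₀, fun ε h0 h1 => ?_⟩
  have hP : ∀ x : X, ∀ v : Cn (Fin n), v ≠ 0 → 0 < ((gX ε).ev x v v).re := hε ⟨h0, h1⟩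
  have hKX : IsKahler (gX ε) := by
    intro φ hφ
    rw [isKahlerOn_iff φ.open_target]
    intro z hz
    have hE := hAB φ hφ z hz
    have hk := key φ hφ z hz _ _ hE
    have heq : coeff (gX ε) φ =ᶠ[𝓝 z] fun w => A φ z w + (ε : ℂ) • B φ z w :=
      hk.mono fun w hw => hw ε
    have hcl : IsClosedHermAt (fun w => A φ z w + (ε : ℂ) • B φ z w) z := by
      refine IsClosedHermAt.of_dense (hE.smooth ε) (mem_closure_preimage_chart hd φ hz) ?_
      rw [eventually_nhdsWithin_iff]
      filter_upwards [hE.eq_fst.eventually_nhds, hE.eq_snd.eventually_nhds,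
        φ.open_target.mem_nhds hz] with w eA eB hw hwS
      have hK := isKahlerAt_pb_retract hg hι hr hri ho hφ hw hwS
      have h1 := hK.isClosedHermAt.add_smul
        (isClosedHermAt_leviMat hK.smooth (det_re_pos hK.posDef)) ε
      have h2 : (fun w => A φ z w + (ε : ℂ) • B φ z w) =ᶠ[𝓝 w]
          fun w => pb g (fun w => r (φ.symm w)) w + (ε : ℂ) • leviMat (pb g fun w => r (φ.symm w)) w := by
        filter_upwards [eA, eB, (φ.symm.isOpen_inter_preimage ho).mem_nhds ⟨hw, hwS⟩] with u h1 h2 h3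
        rw [h1 h3.2, h2 h3.2]
      exact h1.congr h2
    refine IsKahlerAt.congr ⟨hcl.smooth, ?_, hcl.closed⟩ heq
    rw [posDef_iff_sesq]
    refine ⟨hcl.herm, fun v hv => ?_⟩
    have h3 := heq.self_of_nhds
    simp only at h3
    rw [← h3, coeff_eq_pb, sesq_pb]
    exact hP _ _ fun h => hv (injective_mder_symm hφ hz (by rw [h, map_zero]))
  have hpull : ∀ c ∈ atlas (Cn (Fin n)) M, ∀ z ∈ c.target,
      pb (gX ε) (fun w => ι (c.symm w)) z = pb (subRicci g ε) c.symm z := by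
    intro c hc z hz
    set x := ι (c.symm z) with hx
    have hE := hAB (e x) (hea x) (e x x) (het x)
    have hs : ContMDiffAt 𝓘(ℂ, Cn (Fin n)) 𝓘(ℂ, Cn (Fin n)) ω (fun w => ι (c.symm w)) z :=
      hι.contMDiffAt.comp z (contMDiffAt_atlas_symm hc hz)
    have hmem : (e x).symm (e x x) ∈ range ι := by rw [(e x).left_inv (hes x)]; exact ⟨_, rfl⟩
    have h1 := pb_eq_pullMat (gX ε) (hea x) hs (hes x)
    have h2 : coeff (gX ε) (e x) (e x x) = pb (subRicci g ε) (fun w => r ((e x).symm w)) (e x x) := by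
      have := (key _ (hea x) _ (het x) _ _ hE).self_of_nhds ε
      rw [coeff_eq_pb, this, hE.eq_fst.self_of_nhds hmem, hE.eq_snd.self_of_nhds hmem,
        pb_subRicci_retract hg hι hr hri ho (hea x) (het x) hmem]
    have h3 : pb (subRicci g ε) c.symm z
        = pullMat (pb (subRicci g ε) fun w => r ((e x).symm w)) (fun w => e x (ι (c.symm w))) z := by
      refine pb_comp _ ?_ ((contMDiffAt_retract_symm hr ho (hea x) (het x) hmem).mdifferentiableAt
        (by simp)) ((contDiffAt_chart_comp (hea x) hs (hes x)).differentiableAt (by simp))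
      filter_upwards [hs.continuousAt.eventually ((e x).open_source.mem_nhds (hes x))] with w hw
      rw [(e x).left_inv hw, hri]
    rw [h1, h3]
    ext i j
    rw [pullMat, pullMat, h2]
  have hinj : ∀ c ∈ atlas (Cn (Fin n)) M, ∀ z ∈ c.target,
      Function.Injective (mder (fun w => ι (c.symm w)) z) := by
    intro c hc z hz v w h
    apply injective_mder_symm hc hz
    have hs : ContMDiffAt 𝓘(ℂ, Cn (Fin n)) 𝓘(ℂ, Cn (Fin n)) ω (fun w => ι (c.symm w)) z :=
      hι.contMDiffAt.comp z (contMDiffAt_atlas_symm hc hz)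
    have h3 := mfderiv_comp z (g := r) (f := fun w => ι (c.symm w))
      ((hr.contMDiffAt (ho.mem_nhds ⟨_, rfl⟩)).mdifferentiableAt (by simp))
      (hs.mdifferentiableAt (by simp))
    have h4 : r ∘ (fun w => ι (c.symm w)) = c.symm := funext fun w => hri _
    rw [h4] at h3
    have h5 : ∀ v, mder c.symm z v = mfderiv 𝓘(ℂ, Cn (Fin n)) 𝓘(ℂ, Cn (Fin n)) r (ι (c.symm z))
        (mder (fun w => ι (c.symm w)) z v) := fun v => congrArg (fun L => L v) h3
    rw [h5, h5, h]
  refine ⟨fun c hc => ?_, gX ε, hKX, fun y v w => ?_⟩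
  · rw [isKahlerOn_iff c.open_target]
    intro z hz
    refine IsKahlerAt.congr (hKX.pb c.open_target
      (fun w hw => (hι.contMDiffAt.comp w (contMDiffAt_atlas_symm hc hw)).contMDiffWithinAt) hz
      (hinj c hc z hz)) ?_
    filter_upwards [c.open_target.mem_nhds hz] with w hw
    exact (hpull c hc w hw).symm
  · set c := chartAt (Cn (Fin n)) y with hc
    have hca := chart_mem_atlas (Cn (Fin n)) y
    have hys := mem_chart_source (Cn (Fin n)) y
    have hyt := c.map_source hys
    obtain ⟨u, hu⟩ := surjective_mder_symm hca hyt v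
    obtain ⟨u', hu'⟩ := surjective_mder_symm hca hyt w
    have h1 := congrArg (fun G => sesq G u u') (hpull c hca (c y) hyt)
    simp only [sesq_pb] at h1
    have h3 := mfderiv_comp (c y) (g := ι) (f := c.symm) (hι.mdifferentiableAt (by simp))
      ((contMDiffAt_atlas_symm hca hyt).mdifferentiableAt (by simp))
    have h5 : ∀ v, mder (fun w => ι (c.symm w)) (c y) v
        = mfderiv 𝓘(ℂ, Cn (Fin n)) 𝓘(ℂ, Cn (Fin n)) ι (c.symm (c y)) (mder c.symm (c y) v) :=
      fun v => congrArg (fun L => L v) h3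
    rw [h5, h5] at h1
    have h6 : c.symm (c y) = y := c.left_inv hys
    rw [h6] at h1
    rw [hu, hu'] at h1
    exact h1

end Extension

/-! ### The local extension at the exceptional divisors -/

section ConeExtension

variable {N n : ℕ} {Y S : Set (CP N)} [ChartedSpace (Cn (Fin n)) ↥(Y \ S)]
  [IsManifold 𝓘(ℂ, Cn (Fin n)) ω ↥(Y \ S)] {q : CP N} {m l : ℕ}

lemma segPar_eq_zero {a : Fin (m + 1)} {b : Fin (l + 1)} {p : Par m l} (hp : p.1 = 0) :
    segPar a b p = 0 := by
  ext ⟨c, d⟩; simp [hp]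

/-- The local extension of `g` and `∂∂̄ log det g` in affine coordinates of the blow-up. -/
lemma ConeChart.exists_isLocalExtension (ψ : ConeChart (n := n) Y S q m l) (hm : 1 ≤ m) (hl : 1 ≤ l)
    {g : SesqField n ↥(Y \ S)} (hg : ψ.IsRestriction g) {σ : Cn (Fin n) → ↥(Y \ S)}
    {T : Set (Cn (Fin n))} {z : Cn (Fin n)} (L : Cn (Fin n) ≃L[ℂ] Par m l) (a : Fin (m + 1))
    (b : Fin (l + 1)) (hz : (L z).1 = 0) (hT : ∀ᶠ w in 𝓝 z, w ∈ T ↔ (L w).1 ≠ 0)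
    (hσ : ∀ᶠ w in 𝓝 z, w ∈ T → ContMDiffAt 𝓘(ℂ, Cn (Fin n)) 𝓘(ℂ, Cn (Fin n)) ω σ w)
    (hmem : ∀ᶠ w in 𝓝 z, w ∈ T → incl (σ w) ∈ ψ.toHomeo.source ∧
      ψ.emb (incl (σ w)) = segPar a b (L w)) :
    ∃ A B, IsLocalExtension g σ T z A B := by
  obtain ⟨Ω, H, hΩ, h0Ω, hH, hgH⟩ := hg
  have hHat := (isKahlerOn_iff hΩ).1 hH
  have hcont : ContinuousAt (fun w => segPar a b (L w)) z := (contDiff_segPar L a b).continuous.continuousAt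
  have hΩz : ∀ᶠ w in 𝓝 z, segPar a b (L w) ∈ Ω :=
    hcont.eventually (hΩ.mem_nhds (show segPar a b (L z) ∈ Ω by rw [segPar_eq_zero hz]; exact h0Ω))
  have hne : ∀ w, (L w).1 ≠ 0 → ∀ᶠ w' in 𝓝 w, (L w').1 ≠ 0 := fun w hw =>
    (contDiff_L1 L).continuous.continuousAt.eventually (isOpen_ne.mem_nhds hw)
  have hpb : ∀ᶠ w in 𝓝 z, w ∈ T → pb g σ w = pullCone L a b H w := by
    filter_upwards [hT.eventually_nhds, hσ, hmem.eventually_nhds, hΩz] with w w1 w2 w3 w4 hwT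
    have hs := w2 hwT
    obtain ⟨hin, hemb⟩ := w3.self_of_nhds hwT
    have hnear : ∀ᶠ w' in 𝓝 w, w' ∈ T := by
      filter_upwards [hne w (w1.self_of_nhds.1 hwT), w1] with w' h1 h2 using h2.2 h1
    have hev : (fun w' => ψ.emb (incl (σ w'))) =ᶠ[𝓝 w] fun w' => segPar a b (L w') := by
      filter_upwards [w3, hnear] with w' h1 h2 using (h1 h2).2
    have hemd : MDifferentiableAt 𝓘(ℂ, Cn (Fin n)) 𝓘(ℂ, SegreSpace m l)
        (fun y' : ↥(Y \ S) => ψ.emb (incl y')) (σ w) := by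
      refine ((ψ.biholomorphic.1 (σ w) hin).contMDiffAt ?_).mdifferentiableAt (by simp)
      exact (ψ.toHomeo.open_source.preimage
        (Continuous.subtype_mk continuous_subtype_val _)).mem_nhds hin
    have hchain := mfderiv_comp w (g := fun y' : ↥(Y \ S) => ψ.emb (incl y')) (f := σ) hemd
      (hs.mdifferentiableAt (by simp))
    have hder : ∀ v, fderiv ℂ (fun w' => segPar a b (L w')) w v
        = (mfderiv 𝓘(ℂ, Cn (Fin n)) 𝓘(ℂ, SegreSpace m l)
          (fun y' : ↥(Y \ S) => ψ.emb (incl y')) (σ w) : Tan n ↥(Y \ S) (σ w) →L[ℂ] SegreSpace m l)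
          (mder σ w v) := by
      intro v
      rw [← hev.fderiv_eq, ← mfderiv_eq_fderiv]
      exact congrArg (fun L => L v) hchain
    ext i j
    have h5 := hgH (σ w) hin (by rw [hemb]; exact w4) (mder σ w (EuclideanSpace.single i 1))
      (mder σ w (EuclideanSpace.single j 1))
    rw [pullCone, pullMat, hder, hder, ← hemb]
    exact h5
  have hgood : ∀ᶠ w in 𝓝 z, (∀ α β, ContDiffAt ℝ ∞ (fun x => H x α β) (segPar a b (L w))) ∧
      (H (segPar a b (L w))).PosDef :=
    hΩz.mono fun w hw => ⟨(hHat _ hw).smooth, (hHat _ hw).posDef⟩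
  refine ⟨pullCone L a b H, leviMat (gramCone L a b H),
    contDiffAt_pullCone L a b hgood.self_of_nhds.1, ?_, ?_, ?_, ?_, ?_⟩
  · exact (isClosedHermAt_leviMat (contDiffAt_gramCone L a b hgood.self_of_nhds.1)
      (det_re_pos (posDef_gramCone L a b hgood.self_of_nhds.2))).smooth
  · exact hpb.mono fun w hw h => (hw h).symm
  · filter_upwards [hpb.eventually_nhds, hT.eventually_nhds, hgood] with w w1 w2 w3 hwT
    have hw0 := w2.self_of_nhds.1 hwT
    rw [← leviMat_pullCone L a b hw0 w3.1 w3.2]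
    have hev : logDet (pullCone L a b H) =ᶠ[𝓝 w] logDet (pb g σ) := by
      filter_upwards [w1, w2, hne w hw0] with w' h1 h2 h3
      simp only [logDet, h1 (h2.2 h3)]
    ext i j
    exact levi_congr hev _ _
  · filter_upwards [hgood] with w hw v
    rw [sesq_pullCone]
    set u := frame a b (L w) (scaleCLM (L w).1 (L v))
    by_cases hu : u = 0
    · simp [hu, sesq]
    · exact ((posDef_iff_sesq.1 hw.2).2 u hu).le
  · intro v hv h
    have h0 := hHat 0 h0Ω
    exact leviMat_gramCone_pos L a b hm hl hz h0.smooth h0.posDef hv h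

end ConeExtension

/-! ### Projective space -/

section ProjectiveSpace

variable {N : ℕ}

/-- The point of `ℙ^N` with homogeneous coordinates `v`. -/
def CP.mk (v : Fin (N + 1) → ℂ) (hv : v ≠ 0) : CP N := Projectivization.mk ℂ v hv

lemma CP.rep_ne_zero (P : CP N) : P.rep ≠ 0 := Projectivization.rep_nonzero (K := ℂ) P

lemma CP.mk_rep (P : CP N) : CP.mk P.rep P.rep_ne_zero = P := Projectivization.mk_rep (K := ℂ) P

lemma CP.rep_mk (v : Fin (N + 1) → ℂ) (hv : v ≠ 0) : ∃ c : ℂ, c ≠ 0 ∧ (CP.mk v hv).rep = c • v := by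
  obtain ⟨a, ha⟩ := Projectivization.exists_smul_eq_mk_rep ℂ v hv
  exact ⟨a, a.ne_zero, ha.symm⟩

lemma CP.mk_eq_mk {v w : Fin (N + 1) → ℂ} (hv : v ≠ 0) (hw : w ≠ 0) {c : ℂ} (h : c • w = v) :
    CP.mk v hv = CP.mk w hw :=
  (Projectivization.mk_eq_mk_iff' ℂ v w hv hw).2 ⟨c, h⟩

lemma CP.exists_rep_ne (P : CP N) : ∃ a, P.rep a ≠ 0 := by
  by_contra! h
  exact P.rep_ne_zero (funext h)

lemma CP.affine_mk (v : Fin (N + 1) → ℂ) (hv : v ≠ 0) (a c : Fin (N + 1)) :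
    CP.affine a (CP.mk v hv) c = v c / v a := by
  obtain ⟨t, ht, h⟩ := CP.rep_mk v hv
  simp only [CP.affine, h, Pi.smul_apply, smul_eq_mul]
  exact mul_div_mul_left _ _ ht

lemma CP.rep_mk_ne_zero_iff (v : Fin (N + 1) → ℂ) (hv : v ≠ 0) (a : Fin (N + 1)) :
    (CP.mk v hv).rep a ≠ 0 ↔ v a ≠ 0 := by
  obtain ⟨t, ht, h⟩ := CP.rep_mk v hv
  simp [h, ht]

/-- The point with affine coordinates `ζ` in the chart `a`. -/
def CP.ofAffine (a : Fin (N + 1)) (ζ : Fin N → ℂ) : CP N := CP.mk (insOne a ζ) (insOne_ne_zero a ζ)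

/-- The affine coordinates in the chart `a`, without the entry `1`. -/
def CP.coords (a : Fin (N + 1)) (P : CP N) : Fin N → ℂ := fun i => CP.affine a P (a.succAbove i)

lemma CP.affine_ofAffine (a c : Fin (N + 1)) (ζ : Fin N → ℂ) :
    CP.affine c (CP.ofAffine a ζ) = fun d => insOne a ζ d / insOne a ζ c :=
  funext fun _ => CP.affine_mk _ _ _ _

@[simp] lemma CP.coords_ofAffine (a : Fin (N + 1)) (ζ : Fin N → ℂ) :
    CP.coords a (CP.ofAffine a ζ) = ζ := by
  ext i; simp [CP.coords, CP.affine_ofAffine]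

lemma CP.rep_ofAffine_ne_zero_iff (a c : Fin (N + 1)) (ζ : Fin N → ℂ) :
    (CP.ofAffine a ζ).rep c ≠ 0 ↔ insOne a ζ c ≠ 0 := CP.rep_mk_ne_zero_iff _ _ _

lemma CP.insOne_coords {a : Fin (N + 1)} {P : CP N} (h : P.rep a ≠ 0) :
    insOne a (CP.coords a P) = CP.affine a P := by
  ext c
  refine Fin.succAboveCases a ?_ (fun i => ?_) c
  · simp [CP.affine, h]
  · simp [CP.coords]

lemma CP.ofAffine_coords {a : Fin (N + 1)} {P : CP N} (h : P.rep a ≠ 0) :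
    CP.ofAffine a (CP.coords a P) = P := by
  conv_rhs => rw [← P.mk_rep]
  refine CP.mk_eq_mk _ _ (c := (P.rep a)⁻¹) ?_
  rw [CP.insOne_coords h]
  ext c
  simp [CP.affine, div_eq_inv_mul]

lemma CP.continuous_mk : Continuous fun v : {v : Fin (N + 1) → ℂ // v ≠ 0} => CP.mk v.1 v.2 :=
  continuous_quotient_mk'

lemma CP.isQuotientMap_mk : IsQuotientMap fun v : {v : Fin (N + 1) → ℂ // v ≠ 0} => CP.mk v.1 v.2 :=
  isQuotientMap_quotient_mk'

lemma CP.continuous_ofAffine (a : Fin (N + 1)) : Continuous (CP.ofAffine a) := by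
  refine CP.continuous_mk.comp (f := fun ζ => ⟨insOne a ζ, insOne_ne_zero a ζ⟩)
    (Continuous.subtype_mk (continuous_pi fun c => ?_) _)
  exact continuous_const.add (insZeroCLM a c).continuous

/-- The embedding of `ℙ^N` by the entries of the orthogonal projection onto a line. -/
def CP.proj (P : CP N) : Fin (N + 1) → Fin (N + 1) → ℂ := fun a b =>
  P.rep a * conj (P.rep b) / ∑ c, P.rep c * conj (P.rep c)

lemma sum_mul_conj_ne_zero {v : Fin (N + 1) → ℂ} (hv : v ≠ 0) : ∑ c, v c * conj (v c) ≠ 0 := by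
  intro h
  simp only [Complex.mul_conj, ← Complex.ofReal_sum, Complex.ofReal_eq_zero] at h
  rw [Finset.sum_eq_zero_iff_of_nonneg fun _ _ => Complex.normSq_nonneg _] at h
  exact hv (funext fun c => Complex.normSq_eq_zero.1 (h c (Finset.mem_univ c)))

lemma CP.proj_mk (v : Fin (N + 1) → ℂ) (hv : v ≠ 0) (a b : Fin (N + 1)) :
    (CP.mk v hv).proj a b = v a * conj (v b) / ∑ c, v c * conj (v c) := by
  obtain ⟨t, ht, h⟩ := CP.rep_mk v hv
  have ht' : conj t ≠ 0 := by simpa using ht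
  have h1 : ∑ c, (t * v c) * conj (t * v c) = (t * conj t) * ∑ c, v c * conj (v c) := by
    rw [Finset.mul_sum]
    exact Finset.sum_congr rfl fun c _ => by rw [map_mul]; ring
  simp only [CP.proj, h, Pi.smul_apply, smul_eq_mul, h1]
  rw [map_mul, ← mul_div_mul_left (v a * conj (v b)) _ (mul_ne_zero ht ht')]
  congr 1; ring

lemma CP.continuous_proj : Continuous (CP.proj (N := N)) := by
  rw [CP.isQuotientMap_mk.continuous_iff]
  refine continuous_pi fun a => continuous_pi fun b => ?_
  have h : (fun v : {v : Fin (N + 1) → ℂ // v ≠ 0} => (CP.mk v.1 v.2).proj a b)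
      = fun v => v.1 a * conj (v.1 b) / ∑ c, v.1 c * conj (v.1 c) := funext fun v => CP.proj_mk _ v.2 _ _
  have hc : ∀ a, Continuous fun v : {v : Fin (N + 1) → ℂ // v ≠ 0} => v.1 a := fun a =>
    (continuous_apply a).comp continuous_subtype_val
  change Continuous fun v : {v : Fin (N + 1) → ℂ // v ≠ 0} => (CP.mk v.1 v.2).proj a b
  rw [h]
  refine Continuous.div₀ ((hc a).mul (Complex.continuous_conj.comp (hc b)))
    (continuous_finsetSum _ fun c _ => (hc c).mul (Complex.continuous_conj.comp (hc c)))
    fun v => sum_mul_conj_ne_zero v.2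

lemma CP.injective_proj : Function.Injective (CP.proj (N := N)) := by
  intro P Q h
  obtain ⟨b, hb⟩ := P.exists_rep_ne
  have hP := sum_mul_conj_ne_zero P.rep_ne_zero
  have hQ := sum_mul_conj_ne_zero Q.rep_ne_zero
  rw [← P.mk_rep, ← Q.mk_rep]
  have hb' : conj (P.rep b) ≠ 0 := by simpa using hb
  refine CP.mk_eq_mk _ _ (c := conj (Q.rep b) / (∑ c, Q.rep c * conj (Q.rep c))
    * (∑ c, P.rep c * conj (P.rep c)) / conj (P.rep b)) ?_
  ext a
  have h1 := congrFun (congrFun h a) b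
  simp only [CP.proj] at h1
  rw [div_eq_div_iff hP hQ] at h1
  simp only [Pi.smul_apply, smul_eq_mul]
  field_simp
  linear_combination -h1

instance : T2Space (CP N) := T2Space.of_injective_continuous CP.injective_proj CP.continuous_proj

instance : CompactSpace (CP N) := by
  have hK : IsCompact (Metric.sphere (0 : Fin (N + 1) → ℂ) 1) := isCompact_sphere _ _
  have := isCompact_iff_compactSpace.1 hK
  have hne : ∀ v : Metric.sphere (0 : Fin (N + 1) → ℂ) 1, v.1 ≠ 0 := fun v h => by
    have := v.2; simp [h] at this
  have hc : Continuous fun v : Metric.sphere (0 : Fin (N + 1) → ℂ) 1 => CP.mk v.1 (hne v) :=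
    CP.continuous_mk.comp (f := fun v => ⟨v.1, hne v⟩) (Continuous.subtype_mk continuous_subtype_val _)
  have hs : Function.Surjective
      fun v : Metric.sphere (0 : Fin (N + 1) → ℂ) 1 => CP.mk v.1 (hne v) := by
    intro P
    have h0 : ‖P.rep‖ ≠ 0 := norm_ne_zero_iff.2 P.rep_ne_zero
    refine ⟨⟨((‖P.rep‖⁻¹ : ℝ) : ℂ) • P.rep, by simp [norm_smul, h0]⟩, ?_⟩
    conv_rhs => rw [← P.mk_rep]
    exact CP.mk_eq_mk _ _ rfl
  exact hs.compactSpace hc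

lemma eval_smul_of_isHomogeneous {f : MvPolynomial (Fin (N + 1)) ℂ} {d : ℕ} (hf : f.IsHomogeneous d)
    (c : ℂ) (v : Fin (N + 1) → ℂ) :
    MvPolynomial.eval (c • v) f = c ^ d * MvPolynomial.eval v f := by
  rw [MvPolynomial.eval_eq, MvPolynomial.eval_eq, Finset.mul_sum]
  refine Finset.sum_congr rfl fun s hs => ?_
  have h1 : ∑ i ∈ s.support, s i = d := by
    have := hf (MvPolynomial.mem_support_iff.1 hs)
    simpa [Finsupp.weight_apply, Finsupp.sum] using this
  simp only [Pi.smul_apply, smul_eq_mul, mul_pow, Finset.prod_mul_distrib, Finset.prod_pow_eq_pow_sum]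
  rw [h1]; ring

lemma forall_eval_smul {I : Ideal (MvPolynomial (Fin (N + 1)) ℂ)}
    (hI : ∀ f ∈ I, ∀ d : ℕ, MvPolynomial.homogeneousComponent d f ∈ I) {v : Fin (N + 1) → ℂ}
    (h : ∀ f ∈ I, MvPolynomial.eval v f = 0) (c : ℂ) : ∀ f ∈ I, MvPolynomial.eval (c • v) f = 0 := by
  intro f hf
  rw [← MvPolynomial.sum_homogeneousComponent f, map_sum]
  refine Finset.sum_eq_zero fun d _ => ?_
  rw [eval_smul_of_isHomogeneous (MvPolynomial.homogeneousComponent_isHomogeneous d f),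
    h _ (hI f hf d), mul_zero]

lemma IsProjectiveVariety.isClosed {Y : Set (CP N)} (hY : IsProjectiveVariety Y) : IsClosed Y := by
  obtain ⟨_, I, -, hI, rfl⟩ := hY
  rw [← CP.isQuotientMap_mk.isClosed_preimage]
  have h : (fun v : {v : Fin (N + 1) → ℂ // v ≠ 0} => CP.mk v.1 v.2) ⁻¹'
      {y | ∀ f ∈ I, MvPolynomial.eval y.rep f = 0}
      = ⋂ f ∈ I, {v | MvPolynomial.eval v.1 f = 0} := by
    ext v
    obtain ⟨c, hc, h⟩ := CP.rep_mk v.1 v.2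
    simp only [mem_preimage, mem_ofPred_eq, mem_iInter, h]
    refine ⟨fun hv f hf => ?_, fun hv => forall_eval_smul hI hv c⟩
    have := forall_eval_smul hI hv c⁻¹ f hf
    rwa [smul_smul, inv_mul_cancel₀ hc, one_smul] at this
  rw [h]
  exact isClosed_biInter fun f _ => isClosed_eq
    ((MvPolynomial.continuous_eval f).comp continuous_subtype_val) continuous_const

end ProjectiveSpace

/-! ### The blow-up of the cone in affine coordinates -/

section BlowUp

variable {m l : ℕ}

lemma segPar_mem_cone (a : Fin (m + 1)) (b : Fin (l + 1)) (p : Par m l) : segPar a b p ∈ cone m l :=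
  ⟨p.1 • insOne a p.2.1, insOne b p.2.2, fun c d => by simp [mul_assoc]⟩

lemma segPar_mem_blowUp (a : Fin (m + 1)) (b : Fin (l + 1)) (p : Par m l) :
    (segPar a b p, CP.ofAffine a p.2.1, CP.ofAffine b p.2.2) ∈ blowUp m l := by
  obtain ⟨c, hc, h⟩ := CP.rep_mk _ (insOne_ne_zero a p.2.1)
  obtain ⟨d, hd, h'⟩ := CP.rep_mk _ (insOne_ne_zero b p.2.2)
  refine ⟨p.1 * c⁻¹ * d⁻¹, fun i j => ?_⟩
  simp only [CP.ofAffine, h, h', segPar_apply, Pi.smul_apply, smul_eq_mul]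
  field_simp

lemma segPar_self (a : Fin (m + 1)) (b : Fin (l + 1)) (p : Par m l) : segPar a b p (a, b) = p.1 := by
  simp

lemma exists_mem_blowUp {x : SegreSpace m l} (hx : x ∈ cone m l) :
    ∃ Θ : CP m × CP l, (x, Θ) ∈ blowUp m l := by
  obtain ⟨Z, W, h⟩ := hx
  by_cases hZ : Z = 0
  · exact ⟨(CP.ofAffine 0 0, CP.ofAffine 0 0), 0, fun a b => by simp [h, hZ]⟩
  by_cases hW : W = 0
  · exact ⟨(CP.ofAffine 0 0, CP.ofAffine 0 0), 0, fun a b => by simp [h, hW]⟩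
  obtain ⟨c, hc, h1⟩ := CP.rep_mk Z hZ
  obtain ⟨d, hd, h2⟩ := CP.rep_mk W hW
  refine ⟨(CP.mk Z hZ, CP.mk W hW), c⁻¹ * d⁻¹, fun i j => ?_⟩
  simp only [h1, h2, h, Pi.smul_apply, smul_eq_mul]
  field_simp

lemma segPar_of_mem_blowUp {x : SegreSpace m l} {Θ : CP m × CP l} (h : (x, Θ) ∈ blowUp m l)
    {a : Fin (m + 1)} {b : Fin (l + 1)} (ha : Θ.1.rep a ≠ 0) (hb : Θ.2.rep b ≠ 0) :
    segPar a b (x (a, b), CP.coords a Θ.1, CP.coords b Θ.2) = x := by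
  obtain ⟨t, ht⟩ := h
  ext ⟨c, d⟩
  simp only [segPar_apply, CP.insOne_coords ha, CP.insOne_coords hb, CP.affine]
  rw [ht, ht]
  field_simp

lemma blowUp_of_ne {x : SegreSpace m l} {Θ : CP m × CP l} (h : (x, Θ) ∈ blowUp m l)
    {a : Fin (m + 1)} {b : Fin (l + 1)} (hx : x (a, b) ≠ 0) :
    Θ.1.rep a ≠ 0 ∧ Θ.2.rep b ≠ 0 ∧ (∀ c, CP.affine a Θ.1 c = x (c, b) / x (a, b)) ∧
      ∀ d, CP.affine b Θ.2 d = x (a, d) / x (a, b) := by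
  obtain ⟨t, ht⟩ := h
  rw [ht] at hx
  have ht0 : t ≠ 0 := left_ne_zero_of_mul hx
  have ha : Θ.1.rep a ≠ 0 := left_ne_zero_of_mul (right_ne_zero_of_mul hx)
  have hb : Θ.2.rep b ≠ 0 := right_ne_zero_of_mul (right_ne_zero_of_mul hx)
  refine ⟨ha, hb, fun c => ?_, fun d => ?_⟩
  · rw [ht, ht, CP.affine]; field_simp
  · rw [ht, ht, CP.affine]; field_simp

lemma entry_ne_zero_of_mem_blowUp {x : SegreSpace m l} {Θ : CP m × CP l} (h : (x, Θ) ∈ blowUp m l)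
    (hx : x ≠ 0) {a : Fin (m + 1)} {b : Fin (l + 1)} (ha : Θ.1.rep a ≠ 0) (hb : Θ.2.rep b ≠ 0) :
    x (a, b) ≠ 0 := fun h0 => hx <| by
  rw [← segPar_of_mem_blowUp h ha hb, h0, segPar_eq_zero rfl]

lemma blowUp_unique {x : SegreSpace m l} {Θ Θ' : CP m × CP l} (h : (x, Θ) ∈ blowUp m l)
    (h' : (x, Θ') ∈ blowUp m l) (hx : x ≠ 0) : Θ = Θ' := by
  obtain ⟨a, ha⟩ := Θ.1.exists_rep_ne
  obtain ⟨b, hb⟩ := Θ.2.exists_rep_ne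
  have hab := entry_ne_zero_of_mem_blowUp h hx ha hb
  obtain ⟨h1, h2, h3, h4⟩ := blowUp_of_ne h hab
  obtain ⟨h1', h2', h3', h4'⟩ := blowUp_of_ne h' hab
  refine Prod.ext ?_ ?_
  · rw [← CP.ofAffine_coords h1, ← CP.ofAffine_coords h1']
    congr 1; ext i; simp only [CP.coords, h3, h3']
  · rw [← CP.ofAffine_coords h2, ← CP.ofAffine_coords h2']
    congr 1; ext i; simp only [CP.coords, h4, h4']

/-- `segPar` as a map to the cone. -/
def segCone (a : Fin (m + 1)) (b : Fin (l + 1)) (p : Par m l) : ↥(cone m l) :=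
  ⟨segPar a b p, segPar_mem_cone a b p⟩

lemma continuous_segCone {n : ℕ} (L : Cn (Fin n) ≃L[ℂ] Par m l) (a : Fin (m + 1)) (b : Fin (l + 1)) :
    Continuous fun z => segCone a b (L z) :=
  Continuous.subtype_mk (contDiff_segPar L a b).continuous _

end BlowUp

/-! ### Gluing manifolds from charts -/

section Gluing

variable {n : ℕ} {X : Type}

/-- The transition map from `e` to `e'` is holomorphic with open domain. -/
def IsHolTransition (e e' : PartialEquiv X (Cn (Fin n))) : Prop :=
  ∀ z ∈ e.target, e.symm z ∈ e'.source →
    (∀ᶠ w in 𝓝 z, w ∈ e.target ∧ e.symm w ∈ e'.source) ∧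
      ContDiffAt ℂ ω (fun w => e' (e.symm w)) z

lemma IsHolTransition.trans {e c e' : PartialEquiv X (Cn (Fin n))} (h : IsHolTransition e c)
    (h' : IsHolTransition c e') {z : Cn (Fin n)} (hz : z ∈ e.target) (hc : e.symm z ∈ c.source)
    (he' : e.symm z ∈ e'.source) :
    (∀ᶠ w in 𝓝 z, w ∈ e.target ∧ e.symm w ∈ e'.source) ∧
      ContDiffAt ℂ ω (fun w => e' (e.symm w)) z := by
  obtain ⟨h1, h2⟩ := h z hz hc
  have hcc : c.symm (c (e.symm z)) = e.symm z := c.left_inv hc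
  obtain ⟨h3, h4⟩ := h' (c (e.symm z)) (c.map_source hc) (by rw [hcc]; exact he')
  refine ⟨?_, (h4.comp z h2).congr_of_eventuallyEq ?_⟩
  · filter_upwards [h1, h2.continuousAt.eventually h3] with w hw1 hw2
    exact ⟨hw1.1, by simpa only [c.left_inv hw1.2] using hw2.2⟩
  · filter_upwards [h1] with w hw1
    simp only [Function.comp, c.left_inv hw1.2]

lemma exists_manifold_of_isHolTransition (E : Set (PartialEquiv X (Cn (Fin n))))
    (hcov : ∀ x, ∃ e ∈ E, x ∈ e.source) (hE : ∀ e ∈ E, ∀ e' ∈ E, IsHolTransition e e') :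
    ∃ (_ : TopologicalSpace X) (_ : ChartedSpace (Cn (Fin n)) X),
      IsManifold 𝓘(ℂ, Cn (Fin n)) ω X ∧
      ∀ e : PartialEquiv X (Cn (Fin n)), e ∈ E ↔ ∃ e' ∈ atlas (Cn (Fin n)) X, e'.toPartialEquiv = e := by
  choose ch hch hchs using hcov
  let core : ChartedSpaceCore (Cn (Fin n)) X :=
    { atlas := E
      chartAt := ch
      mem_chart_source := hchs
      chart_mem_atlas := hch
      open_source := fun e e' he he' => by
        rw [isOpen_iff_mem_nhds]
        intro z hz
        exact (hE e he e' he' z hz.1 hz.2).1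
      continuousOn_toFun := fun e e' he he' z hz =>
        (hE e he e' he' z hz.1 hz.2).2.continuousAt.continuousWithinAt }
  let _ : TopologicalSpace X := core.toTopologicalSpace
  let _ : ChartedSpace (Cn (Fin n)) X := core.toChartedSpace
  have hat : ∀ e : PartialEquiv X (Cn (Fin n)),
      e ∈ E ↔ ∃ e' ∈ atlas (Cn (Fin n)) X, e'.toPartialEquiv = e := by
    intro e
    refine ⟨fun he => ⟨core.openPartialHomeomorph e he, ?_, rfl⟩, ?_⟩
    · exact mem_iUnion₂.2 ⟨e, he, rfl⟩
    · rintro ⟨e', he', rfl⟩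
      obtain ⟨e, he, h⟩ := mem_iUnion₂.1 he'
      rw [mem_singleton_iff.1 h]
      exact he
  refine ⟨inferInstance, inferInstance, ?_, hat⟩
  refine isManifold_of_contDiffOn 𝓘(ℂ, Cn (Fin n)) ω X fun e e' he he' => ?_
  intro z hz
  exact (hE _ ((hat _).2 ⟨e, he, rfl⟩) _ ((hat _).2 ⟨e', he', rfl⟩) z hz.1.1
    hz.1.2).2.contDiffWithinAt

end Gluing

/-- A continuous local right inverse of a holomorphic map with bijective derivative is holomorphic. -/
lemma contDiffAt_of_rightInverse {n : ℕ} {F K : Cn (Fin n) → Cn (Fin n)} {z : Cn (Fin n)}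
    (hF : ContDiffAt ℂ ω F (K z)) (hi : Function.Injective (fderiv ℂ F (K z)))
    (hK : ContinuousAt K z) (h : ∀ᶠ w in 𝓝 z, F (K w) = w) : ContDiffAt ℂ ω K z := by
  have hd := (hF.differentiableAt (by simp)).hasFDerivAt
  let f' : Cn (Fin n) ≃L[ℂ] Cn (Fin n) := (LinearEquiv.ofInjectiveEndo
    (fderiv ℂ F (K z) : Cn (Fin n) →ₗ[ℂ] Cn (Fin n)) hi).toContinuousLinearEquiv
  have hf' : (f' : Cn (Fin n) →L[ℂ] Cn (Fin n)) = fderiv ℂ F (K z) := by ext; rfl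
  rw [← hf'] at hd
  have h1 := hF.to_localInverse hd (by simp)
  rw [h.self_of_nhds] at h1
  refine h1.congr_of_eventuallyEq ?_
  have h2 := (hF.hasStrictFDerivAt' hd (by simp)).eventually_left_inverse
  filter_upwards [h, hK.eventually h2] with w hw1 hw2
  rw [hw1] at hw2
  exact hw2.symm

/-! ### The resolution as a set, and its charts -/

section Total

variable {N n k : ℕ} (Y : Set (CP N)) (p : Fin k → CP N) (m l : Fin k → ℕ)

/-- The regular part of `Y` together with the exceptional divisors. -/
def Total : Type := ↥(Y \ range p) ⊕ Σ j, CP (m j) × CP (l j)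

variable {Y p m l}

/-- The regular part. -/
def Total.reg (y : ↥(Y \ range p)) : Total Y p m l := Sum.inl y

/-- The points of the exceptional divisors. -/
def Total.exc (j : Fin k) (P : CP (m j) × CP (l j)) : Total Y p m l := Sum.inr ⟨j, P⟩

lemma Total.reg_injective : Function.Injective (Total.reg : _ → Total Y p m l) := Sum.inl_injective

lemma Total.exc_notMem (j : Fin k) (P : CP (m j) × CP (l j)) :
    (Total.exc j P : Total Y p m l) ∉ range Total.reg := fun ⟨_, h⟩ => by cases h

lemma Total.cases {C : Total Y p m l → Prop} (h1 : ∀ y, C (Total.reg y))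
    (h2 : ∀ j P, C (Total.exc j P)) (x) : C x := by
  rcases x with y | ⟨j, P⟩
  exacts [h1 y, h2 j P]

variable [ChartedSpace (Cn (Fin n)) ↥(Y \ range p)]
  (ψ : ∀ j, ConeChart (n := n) Y (range p) (p j) (m j) (l j))

/-- The contraction of the exceptional divisors. -/
def contr : Total Y p m l → ↥Y := Sum.elim incl fun s => ⟨p s.1, (ψ s.1).center.choose⟩

lemma contr_exc_mem (j : Fin k) (P : CP (m j) × CP (l j)) :
    contr ψ (Total.exc j P) ∈ (ψ j).toHomeo.source := (ψ j).center.choose_spec.1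

lemma emb_contr_exc (j : Fin k) (P : CP (m j) × CP (l j)) :
    (ψ j).emb (contr ψ (Total.exc j P)) = 0 := (ψ j).center.choose_spec.2

open Classical in
/-- The directions `([Z],[W])` near the `j`-th exceptional divisor. -/
def direc (j : Fin k) : Total Y p m l → CP (m j) × CP (l j) :=
  Sum.elim (fun y => (exists_mem_blowUp ((ψ j).toHomeo (incl y)).2).choose)
    fun s => if h : s.1 = j then h ▸ s.2 else (CP.ofAffine 0 0, CP.ofAffine 0 0)

@[simp] lemma direc_exc (j : Fin k) (P : CP (m j) × CP (l j)) : direc ψ j (Total.exc j P) = P :=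
  dif_pos rfl

lemma eq_of_contr_exc_mem (hp : Function.Injective p) {i j : Fin k} {P : CP (m i) × CP (l i)}
    (h : contr ψ (Total.exc i P) ∈ (ψ j).toHomeo.source) : i = j :=
  hp ((ψ j).isolated _ h ⟨i, rfl⟩)

lemma mem_blowUp_direc (hp : Function.Injective p) {j : Fin k} {x : Total Y p m l}
    (h : contr ψ x ∈ (ψ j).toHomeo.source) :
    ((ψ j).emb (contr ψ x), direc ψ j x) ∈ blowUp (m j) (l j) := by
  induction x using Total.cases with
  | h1 y => exact (exists_mem_blowUp ((ψ j).toHomeo (incl y)).2).choose_spec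
  | h2 i P =>
    obtain rfl := eq_of_contr_exc_mem ψ hp h
    rw [emb_contr_exc]
    exact ⟨0, fun a b => by simp⟩

lemma contr_reg_ne_exc (y : ↥(Y \ range p)) (j : Fin k) (P : CP (m j) × CP (l j)) :
    contr ψ (Total.reg y : Total Y p m l) ≠ contr ψ (Total.exc j P) := fun h =>
  y.2.2 ⟨j, (congrArg Subtype.val h).symm⟩

lemma incl_injective {S : Set (CP N)} : Function.Injective (incl : ↥(Y \ S) → ↥Y) := fun _ _ h =>
  Subtype.ext (congrArg (fun z : ↥Y => (z : CP N)) h)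

lemma Total.ext_of_contr (hp : Function.Injective p) {j : Fin k} {x x' : Total Y p m l}
    (h : contr ψ x ∈ (ψ j).toHomeo.source) (h1 : contr ψ x = contr ψ x')
    (h2 : direc ψ j x = direc ψ j x') : x = x' := by
  induction x using Total.cases with
  | h1 y =>
    induction x' using Total.cases with
    | h1 _ => rw [incl_injective h1]
    | h2 i P => exact absurd h1 (contr_reg_ne_exc ψ y i P)
  | h2 i P =>
    obtain rfl := eq_of_contr_exc_mem ψ hp h
    induction x' using Total.cases with
    | h1 y' => exact absurd h1.symm (contr_reg_ne_exc ψ y' i P)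
    | h2 i' P' =>
      rw [h1] at h
      obtain rfl := eq_of_contr_exc_mem ψ hp h
      rw [direc_exc, direc_exc] at h2
      rw [h2]

lemma emb_injOn (j : Fin k) : InjOn (ψ j).emb (ψ j).toHomeo.source := fun _ hy _ hy' h =>
  (ψ j).toHomeo.injOn hy hy' (Subtype.ext h)

lemma emb_reg_ne_zero {j : Fin k} {y : ↥(Y \ range p)} (h : incl y ∈ (ψ j).toHomeo.source) :
    (ψ j).emb (incl y) ≠ 0 := fun h0 =>
  contr_reg_ne_exc ψ y j (CP.ofAffine 0 0, CP.ofAffine 0 0)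
    (emb_injOn ψ j h (contr_exc_mem ψ j _) (h0.trans (emb_contr_exc ψ j _).symm))

/-- A chart of the regular part, as a chart of the resolution. -/
def pushChart (c : OpenPartialHomeomorph ↥(Y \ range p) (Cn (Fin n))) :
    PartialEquiv (Total Y p m l) (Cn (Fin n)) where
  toFun := Sum.elim c fun _ => 0
  invFun z := Total.reg (c.symm z)
  source := Total.reg '' c.source
  target := c.target
  map_source' := by rintro _ ⟨y, hy, rfl⟩; exact c.map_source hy
  map_target' z hz := ⟨_, c.map_target hz, rfl⟩
  left_inv' := by rintro _ ⟨y, hy, rfl⟩; exact congrArg Total.reg (c.left_inv hy)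
  right_inv' z hz := c.right_inv hz

@[simp] lemma pushChart_reg (c : OpenPartialHomeomorph ↥(Y \ range p) (Cn (Fin n)))
    (y : ↥(Y \ range p)) : pushChart (m := m) (l := l) c (Total.reg y) = c y := rfl

@[simp] lemma pushChart_symm (c : OpenPartialHomeomorph ↥(Y \ range p) (Cn (Fin n)))
    (z : Cn (Fin n)) : (pushChart (m := m) (l := l) c).symm z = Total.reg (c.symm z) := rfl

@[simp] lemma reg_mem_pushChart_source (c : OpenPartialHomeomorph ↥(Y \ range p) (Cn (Fin n)))
    (y : ↥(Y \ range p)) : Total.reg y ∈ (pushChart (m := m) (l := l) c).source ↔ y ∈ c.source :=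
  Total.reg_injective.mem_set_image

variable (L : ∀ j, Cn (Fin n) ≃L[ℂ] Par (m j) (l j))

open Classical in
/-- The parametrization of the resolution by affine coordinates of the blow-up. -/
def segInv (j : Fin k) (a : Fin (m j + 1)) (b : Fin (l j + 1)) (z : Cn (Fin n)) : Total Y p m l :=
  if h : ((ψ j).toHomeo.symm (segCone a b (L j z)) : CP N) ∈ range p then
    Total.exc j (CP.ofAffine a (L j z).2.1, CP.ofAffine b (L j z).2.2)
  else Total.reg ⟨_, ((ψ j).toHomeo.symm (segCone a b (L j z))).2, h⟩

section SegInv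

variable {L} {j : Fin k} {a : Fin (m j + 1)} {b : Fin (l j + 1)} {z : Cn (Fin n)}

lemma contr_segInv (hz : segCone a b (L j z) ∈ (ψ j).toHomeo.target) :
    contr ψ (segInv ψ L j a b z) = (ψ j).toHomeo.symm (segCone a b (L j z)) := by
  rw [segInv]
  split_ifs with h
  · exact Subtype.ext ((ψ j).isolated _ ((ψ j).toHomeo.map_target hz) h).symm
  · rfl

lemma contr_segInv_mem (hz : segCone a b (L j z) ∈ (ψ j).toHomeo.target) :
    contr ψ (segInv ψ L j a b z) ∈ (ψ j).toHomeo.source := by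
  rw [contr_segInv ψ hz]; exact (ψ j).toHomeo.map_target hz

lemma emb_contr_segInv (hz : segCone a b (L j z) ∈ (ψ j).toHomeo.target) :
    (ψ j).emb (contr ψ (segInv ψ L j a b z)) = segPar a b (L j z) := by
  rw [contr_segInv ψ hz, ConeChart.emb, (ψ j).toHomeo.right_inv hz]; rfl

lemma direc_segInv (hp : Function.Injective p) (hz : segCone a b (L j z) ∈ (ψ j).toHomeo.target) :
    direc ψ j (segInv ψ L j a b z) = (CP.ofAffine a (L j z).2.1, CP.ofAffine b (L j z).2.2) := by
  by_cases h : ((ψ j).toHomeo.symm (segCone a b (L j z)) : CP N) ∈ range p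
  · rw [segInv, dif_pos h, direc_exc]
  · have h1 := mem_blowUp_direc ψ hp (contr_segInv_mem ψ hz)
    rw [emb_contr_segInv ψ hz] at h1
    refine blowUp_unique h1 (segPar_mem_blowUp a b (L j z)) ?_
    rw [← emb_contr_segInv ψ hz]
    have h2 := contr_segInv_mem ψ hz
    rw [segInv, dif_neg h] at h2 ⊢
    exact emb_reg_ne_zero ψ h2

lemma segPar_ne_zero_iff {m l : ℕ} {a : Fin (m + 1)} {b : Fin (l + 1)} {q : Par m l} :
    segPar a b q ≠ 0 ↔ q.1 ≠ 0 := by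
  refine ⟨fun h h0 => h (segPar_eq_zero h0), fun h h0 => h ?_⟩
  rw [← segPar_self a b q, h0]; rfl

lemma segInv_mem_range_iff (hp : Function.Injective p)
    (hz : segCone a b (L j z) ∈ (ψ j).toHomeo.target) :
    segInv ψ L j a b z ∈ range Total.reg ↔ (L j z).1 ≠ 0 := by
  rw [← segPar_ne_zero_iff (a := a) (b := b), ← emb_contr_segInv ψ hz]
  have h2 := contr_segInv_mem ψ hz
  constructor
  · rintro ⟨y, hy⟩
    rw [← hy] at h2 ⊢
    exact emb_reg_ne_zero ψ h2
  · intro h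
    generalize segInv ψ L j a b z = x at h h2
    induction x using Total.cases with
    | h1 y => exact ⟨y, rfl⟩
    | h2 i P =>
      obtain rfl := eq_of_contr_exc_mem ψ hp h2
      exact absurd (emb_contr_exc ψ _ _) h

end SegInv

/-- Affine coordinates of the blow-up, as a chart of the resolution. -/
def segChart (hp : Function.Injective p) (j : Fin k) (a : Fin (m j + 1)) (b : Fin (l j + 1)) :
    PartialEquiv (Total Y p m l) (Cn (Fin n)) where
  toFun x := (L j).symm ((ψ j).emb (contr ψ x) (a, b), CP.coords a (direc ψ j x).1,
    CP.coords b (direc ψ j x).2)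
  invFun := segInv ψ L j a b
  source := {x | contr ψ x ∈ (ψ j).toHomeo.source ∧ (direc ψ j x).1.rep a ≠ 0 ∧
    (direc ψ j x).2.rep b ≠ 0}
  target := {z | segCone a b (L j z) ∈ (ψ j).toHomeo.target}
  map_source' x hx := by
    have h1 := segPar_of_mem_blowUp (mem_blowUp_direc ψ hp hx.1) hx.2.1 hx.2.2
    simp only [mem_ofPred_eq, ContinuousLinearEquiv.apply_symm_apply]
    have h2 : segCone a b ((ψ j).emb (contr ψ x) (a, b), CP.coords a (direc ψ j x).1,
      CP.coords b (direc ψ j x).2) = (ψ j).toHomeo (contr ψ x) := Subtype.ext h1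
    rw [h2]
    exact (ψ j).toHomeo.map_source hx.1
  map_target' z hz := by
    refine ⟨contr_segInv_mem ψ hz, ?_⟩
    rw [direc_segInv ψ hp hz]
    simp [CP.rep_ofAffine_ne_zero_iff]
  left_inv' x hx := by
    have h1 := segPar_of_mem_blowUp (mem_blowUp_direc ψ hp hx.1) hx.2.1 hx.2.2
    have h2 : segCone a b ((ψ j).emb (contr ψ x) (a, b), CP.coords a (direc ψ j x).1,
      CP.coords b (direc ψ j x).2) = (ψ j).toHomeo (contr ψ x) := Subtype.ext h1
    have hz : segCone a b (L j ((L j).symm ((ψ j).emb (contr ψ x) (a, b),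
        CP.coords a (direc ψ j x).1, CP.coords b (direc ψ j x).2))) ∈ (ψ j).toHomeo.target := by
      rw [ContinuousLinearEquiv.apply_symm_apply, h2]
      exact (ψ j).toHomeo.map_source hx.1
    refine Total.ext_of_contr ψ hp (contr_segInv_mem ψ hz) ?_ ?_
    · rw [contr_segInv ψ hz, ContinuousLinearEquiv.apply_symm_apply, h2, (ψ j).toHomeo.left_inv hx.1]
    · rw [direc_segInv ψ hp hz, ContinuousLinearEquiv.apply_symm_apply]
      exact Prod.ext (CP.ofAffine_coords hx.2.1) (CP.ofAffine_coords hx.2.2)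
  right_inv' z hz := by
    simp only [emb_contr_segInv ψ hz, direc_segInv ψ hp hz, segPar_self, CP.coords_ofAffine]
    exact (L j).symm_apply_apply z

end Total

/-! ### The transition maps of the resolution -/

section Transitions

variable {N n k : ℕ} {Y : Set (CP N)} {p : Fin k → CP N} {m l : Fin k → ℕ}
  [ChartedSpace (Cn (Fin n)) ↥(Y \ range p)]
  (ψ : ∀ j, ConeChart (n := n) Y (range p) (p j) (m j) (l j))
  (L : ∀ j, Cn (Fin n) ≃L[ℂ] Par (m j) (l j)) (hp : Function.Injective p)

lemma continuous_incl {S : Set (CP N)} : Continuous (incl : ↥(Y \ S) → ↥Y) :=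
  Continuous.subtype_mk continuous_subtype_val _

lemma isInducing_incl {S : Set (CP N)} : IsInducing (incl : ↥(Y \ S) → ↥Y) := by
  refine IsInducing.of_comp (g := Subtype.val) continuous_incl continuous_subtype_val ?_
  exact IsInducing.subtypeVal

lemma continuous_emb_entry {m l : ℕ} (c : Fin (m + 1) × Fin (l + 1)) :
    Continuous fun x : ↥(cone m l) => (x : SegreSpace m l) c :=
  (coordCLM c).continuous.comp continuous_subtype_val

section Regular

variable {c : OpenPartialHomeomorph ↥(Y \ range p) (Cn (Fin n))} {z : Cn (Fin n)} {j : Fin k}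

lemma eventually_incl_mem (hz : z ∈ c.target) (h : incl (c.symm z) ∈ (ψ j).toHomeo.source) :
    ∀ᶠ w in 𝓝 z, w ∈ c.target ∧ incl (c.symm w) ∈ (ψ j).toHomeo.source := by
  have h1 : ContinuousAt (fun w => incl (c.symm w)) z :=
    continuous_incl.continuousAt.comp (c.continuousAt_symm hz)
  filter_upwards [c.open_target.mem_nhds hz, h1.eventually ((ψ j).toHomeo.open_source.mem_nhds h)]
    with w h1 h2 using ⟨h1, h2⟩

variable [IsManifold 𝓘(ℂ, Cn (Fin n)) ω ↥(Y \ range p)]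

lemma emb_symm_contDiffAt (hc : c ∈ atlas (Cn (Fin n)) ↥(Y \ range p)) (hz : z ∈ c.target)
    (h : incl (c.symm z) ∈ (ψ j).toHomeo.source) :
    ContDiffAt ℂ ω (fun w => (ψ j).emb (incl (c.symm w))) z ∧
      Function.Injective (fderiv ℂ (fun w => (ψ j).emb (incl (c.symm w))) z) := by
  have h1 : ContMDiffAt 𝓘(ℂ, Cn (Fin n)) 𝓘(ℂ, SegreSpace (m j) (l j)) ω
      (fun y : ↥(Y \ range p) => (ψ j).emb (incl y)) (c.symm z) :=
    ((ψ j).biholomorphic.1 (c.symm z) h).contMDiffAt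
      (((ψ j).toHomeo.open_source.preimage continuous_incl).mem_nhds h)
  have h2 := contMDiffAt_atlas_symm hc hz
  refine ⟨contMDiffAt_iff_contDiffAt.1 (h1.comp z h2), ?_⟩
  have h3 := mfderiv_comp z (h1.mdifferentiableAt (by simp)) (h2.mdifferentiableAt (by simp))
  have h4 : ∀ v, fderiv ℂ (fun w => (ψ j).emb (incl (c.symm w))) z v
      = mfderiv 𝓘(ℂ, Cn (Fin n)) 𝓘(ℂ, SegreSpace (m j) (l j))
        (fun y : ↥(Y \ range p) => (ψ j).emb (incl y)) (c.symm z) (mder c.symm z v) := by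
    intro v
    rw [← mfderiv_eq_fderiv]
    exact congrArg (fun L => L v) h3
  intro v w hvw
  rw [h4, h4] at hvw
  exact injective_mder_symm hc hz ((ψ j).biholomorphic.2 (c.symm z) h hvw)

end Regular

lemma reg_mem_segChart_source {j : Fin k} {a : Fin (m j + 1)} {b : Fin (l j + 1)}
    {y : ↥(Y \ range p)} : Total.reg y ∈ (segChart ψ L hp j a b).source ↔
      incl y ∈ (ψ j).toHomeo.source ∧ (ψ j).emb (incl y) (a, b) ≠ 0 := by
  constructor
  · rintro ⟨h1, h2, h3⟩
    exact ⟨h1, entry_ne_zero_of_mem_blowUp (mem_blowUp_direc ψ hp h1) (emb_reg_ne_zero ψ h1) h2 h3⟩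
  · rintro ⟨h1, h2⟩
    have h3 := blowUp_of_ne (mem_blowUp_direc ψ hp (x := Total.reg y) h1) h2
    exact ⟨h1, h3.1, h3.2.1⟩

lemma segChart_reg {j : Fin k} {a : Fin (m j + 1)} {b : Fin (l j + 1)}
    {y : ↥(Y \ range p)} (h : Total.reg y ∈ (segChart ψ L hp j a b).source) :
    segChart ψ L hp j a b (Total.reg y) = (L j).symm ((ψ j).emb (incl y) (a, b),
      (fun i => (ψ j).emb (incl y) (a.succAbove i, b) / (ψ j).emb (incl y) (a, b)),
      fun i => (ψ j).emb (incl y) (a, b.succAbove i) / (ψ j).emb (incl y) (a, b)) := by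
  have h1 := (reg_mem_segChart_source ψ L hp).1 h
  have h3 := blowUp_of_ne (mem_blowUp_direc ψ hp (x := Total.reg y) h.1) h1.2
  change (L j).symm _ = _
  refine congrArg _ (Prod.ext rfl (Prod.ext ?_ ?_))
  · exact funext fun i => h3.2.2.1 _
  · exact funext fun i => h3.2.2.2 _

lemma contDiffAt_quotients {j : Fin k} (a : Fin (m j + 1)) (b : Fin (l j + 1))
    {E : Cn (Fin n) → SegreSpace (m j) (l j)} {z : Cn (Fin n)} (hE : ContDiffAt ℂ ω E z)
    (h0 : E z (a, b) ≠ 0) :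
    ContDiffAt ℂ ω (fun w => (L j).symm (E w (a, b), (fun i => E w (a.succAbove i, b) / E w (a, b)),
      fun i => E w (a, b.succAbove i) / E w (a, b))) z := by
  have he : ∀ c, ContDiffAt ℂ ω (fun w => E w c) z := fun c =>
    (coordCLM c).contDiff.contDiffAt.comp z hE
  refine (L j).symm.contDiff.contDiffAt.comp z ((he _).prodMk (ContDiffAt.prodMk ?_ ?_))
  · exact contDiffAt_pi.2 fun i => (he _).div (he _) h0
  · exact contDiffAt_pi.2 fun i => (he _).div (he _) h0

variable [IsManifold 𝓘(ℂ, Cn (Fin n)) ω ↥(Y \ range p)]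

lemma isHolTransition_push_push {c c' : OpenPartialHomeomorph ↥(Y \ range p) (Cn (Fin n))}
    (hc : c ∈ atlas (Cn (Fin n)) ↥(Y \ range p)) (hc' : c' ∈ atlas (Cn (Fin n)) ↥(Y \ range p)) :
    IsHolTransition (pushChart (m := m) (l := l) c) (pushChart c') := by
  intro z hz h
  have hz' : z ∈ c.target := hz
  have h' : c.symm z ∈ c'.source := (reg_mem_pushChart_source c' _).1 h
  refine ⟨?_, contDiffAt_chart_comp hc' (contMDiffAt_atlas_symm hc hz') h'⟩
  filter_upwards [c.open_target.mem_nhds hz',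
    (c.continuousAt_symm hz').eventually (c'.open_source.mem_nhds h')] with w h1 h2
  exact ⟨h1, (reg_mem_pushChart_source c' _).2 h2⟩

lemma isHolTransition_push_seg {c : OpenPartialHomeomorph ↥(Y \ range p) (Cn (Fin n))}
    (hc : c ∈ atlas (Cn (Fin n)) ↥(Y \ range p)) (j : Fin k) (a : Fin (m j + 1))
    (b : Fin (l j + 1)) : IsHolTransition (pushChart c) (segChart ψ L hp j a b) := by
  intro z hz h
  have hz' : z ∈ c.target := hz
  have h' : Total.reg (c.symm z) ∈ (segChart ψ L hp j a b).source := h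
  obtain ⟨h1, h2⟩ := (reg_mem_segChart_source ψ L hp).1 h'
  obtain ⟨h3, -⟩ := emb_symm_contDiffAt ψ hc hz' h1
  have h4 : ∀ᶠ w in 𝓝 z, (ψ j).emb (incl (c.symm w)) (a, b) ≠ 0 :=
    ((coordCLM (a, b)).continuous.continuousAt.comp h3.continuousAt).eventually (isOpen_ne.mem_nhds h2)
  have h5 : ∀ᶠ w in 𝓝 z, w ∈ c.target ∧ Total.reg (c.symm w) ∈ (segChart ψ L hp j a b).source := by
    filter_upwards [eventually_incl_mem ψ hz' h1, h4] with w w1 w2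
    exact ⟨w1.1, (reg_mem_segChart_source ψ L hp).2 ⟨w1.2, w2⟩⟩
  refine ⟨h5, (contDiffAt_quotients L a b h3 h2).congr_of_eventuallyEq ?_⟩
  filter_upwards [h5] with w hw
  exact segChart_reg ψ L hp hw.2

lemma eventually_mem_segChart_target {j : Fin k} {a : Fin (m j + 1)} {b : Fin (l j + 1)}
    {z : Cn (Fin n)} (hz : z ∈ (segChart ψ L hp j a b).target) :
    ∀ᶠ w in 𝓝 z, w ∈ (segChart ψ L hp j a b).target :=
  (continuous_segCone (L j) a b).continuousAt.eventually
    ((ψ j).toHomeo.open_target.mem_nhds hz)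

lemma continuousAt_contr_segInv {j : Fin k} {a : Fin (m j + 1)} {b : Fin (l j + 1)}
    {z : Cn (Fin n)} (hz : z ∈ (segChart ψ L hp j a b).target) :
    ContinuousAt (fun w => contr ψ (segInv ψ L j a b w)) z := by
  have h : (fun w => contr ψ (segInv ψ L j a b w))
      =ᶠ[𝓝 z] fun w => (ψ j).toHomeo.symm (segCone a b (L j w)) :=
    (eventually_mem_segChart_target ψ L hp hz).mono fun w hw => contr_segInv ψ hw
  refine ContinuousAt.congr ?_ h.symm
  exact ContinuousAt.comp (f := fun w => segCone a b (L j w))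
    ((ψ j).toHomeo.continuousAt_symm hz) (continuous_segCone (L j) a b).continuousAt

lemma isHolTransition_seg_push {c : OpenPartialHomeomorph ↥(Y \ range p) (Cn (Fin n))}
    (hc : c ∈ atlas (Cn (Fin n)) ↥(Y \ range p)) (j : Fin k) (a : Fin (m j + 1))
    (b : Fin (l j + 1)) : IsHolTransition (segChart ψ L hp j a b) (pushChart c) := by
  intro z hz h
  have hev : ∀ᶠ w in 𝓝 z, w ∈ (segChart ψ L hp j a b).target ∧
      segInv ψ L j a b w ∈ range Total.reg := by
    obtain ⟨y, -, hy⟩ := h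
    have h1 := (segInv_mem_range_iff ψ hp hz).1 ⟨y, hy⟩
    filter_upwards [eventually_mem_segChart_target ψ L hp hz,
      (contDiff_L1 (L j)).continuous.continuousAt.eventually (isOpen_ne.mem_nhds h1)] with w w1 w2
    exact ⟨w1, (segInv_mem_range_iff ψ hp w1).2 w2⟩
  obtain ⟨y, hy, hyz⟩ := h
  have hyz' : segInv ψ L j a b z = Total.reg y := hyz.symm
  let ρ : Cn (Fin n) → ↥(Y \ range p) := fun w =>
    Sum.elim id (fun _ => y) (segInv ψ L j a b w)
  have hρ : ∀ w, segInv ψ L j a b w ∈ range Total.reg → Total.reg (ρ w) = segInv ψ L j a b w := by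
    rintro w ⟨y', hy'⟩
    simp only [ρ, ← hy']; rfl
  have hρz : ρ z = y := by simp only [ρ, hyz']; rfl
  have hρc : ContinuousAt ρ z := by
    rw [isInducing_incl.continuousAt_iff]
    refine (continuousAt_contr_segInv ψ L hp hz).congr ?_
    filter_upwards [hev] with w hw
    rw [← hρ w hw.2]; rfl
  have hsrc : ∀ᶠ w in 𝓝 z, ρ w ∈ c.source :=
    hρc.eventually (c.open_source.mem_nhds (by rw [hρz]; exact hy))
  have hev2 : ∀ᶠ w in 𝓝 z, w ∈ (segChart ψ L hp j a b).target ∧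
      segInv ψ L j a b w ∈ (pushChart c).source := by
    filter_upwards [hev, hsrc] with w w1 w2
    exact ⟨w1.1, ρ w, w2, hρ w w1.2⟩
  refine ⟨hev2, ?_⟩
  set K : Cn (Fin n) → Cn (Fin n) := fun w => pushChart c (segInv ψ L j a b w) with hK
  have hKρ : K =ᶠ[𝓝 z] fun w => c (ρ w) := by
    filter_upwards [hev] with w hw
    simp only [hK, ← hρ w hw.2, pushChart_reg]
  have hKz : K z = c y := hKρ.self_of_nhds.trans (congrArg c hρz)
  set F : Cn (Fin n) → Cn (Fin n) := fun w => segChart ψ L hp j a b ((pushChart c).symm w) with hF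
  have hzc : K z ∈ c.target := by rw [hKz]; exact c.map_source hy
  have hsymm : c.symm (K z) = y := by rw [hKz, c.left_inv hy]
  have hmem : Total.reg (c.symm (K z)) ∈ (segChart ψ L hp j a b).source := by
    rw [hsymm, ← hyz']; exact (segChart ψ L hp j a b).map_target hz
  obtain ⟨t1, t2⟩ := isHolTransition_push_seg ψ L hp hc j a b (K z) hzc hmem
  refine contDiffAt_of_rightInverse (F := F) t2 ?_ ?_ ?_
  · obtain ⟨h1, h2⟩ := emb_symm_contDiffAt ψ hc hzc
      ((reg_mem_segChart_source ψ L hp).1 hmem).1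
    have h3 : (fun w => (ψ j).emb (incl (c.symm w))) =ᶠ[𝓝 (K z)] (fun w => segPar a b (L j w)) ∘ F := by
      filter_upwards [t1] with w hw
      have := emb_contr_segInv ψ ((segChart ψ L hp j a b).map_source hw.2)
      have h5 : segInv ψ L j a b (segChart ψ L hp j a b (Total.reg (c.symm w)))
        = Total.reg (c.symm w) := (segChart ψ L hp j a b).left_inv hw.2
      rw [pushChart_symm, h5] at this
      exact this
    rw [h3.fderiv_eq, fderiv_comp (K z)
      ((contDiff_segPar (L j) a b).contDiffAt.differentiableAt (by simp))
      (t2.differentiableAt (by simp))] at h2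
    exact Function.Injective.of_comp (f := fderiv ℂ (fun w => segPar a b (L j w)) (F (K z))) h2
  · refine ContinuousAt.congr ?_ hKρ.symm
    exact (c.continuousAt (by rw [hρz]; exact hy)).comp hρc
  · filter_upwards [hev2, hev, hsrc] with w w1 w2 w3
    have h5 : (pushChart c).symm (pushChart c (segInv ψ L j a b w)) = segInv ψ L j a b w :=
      (pushChart c).left_inv w1.2
    exact (congrArg (segChart ψ L hp j a b) h5).trans ((segChart ψ L hp j a b).right_inv w1.1)

lemma isHolTransition_seg_seg_same (j : Fin k) (a a' : Fin (m j + 1)) (b b' : Fin (l j + 1)) :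
    IsHolTransition (segChart ψ L hp j a b) (segChart ψ L hp j a' b') := by
  intro z hz h
  have hform : ∀ w ∈ (segChart ψ L hp j a b).target,
      segInv ψ L j a b w ∈ (segChart ψ L hp j a' b').source ↔
      insOne a (L j w).2.1 a' ≠ 0 ∧ insOne b (L j w).2.2 b' ≠ 0 := by
    intro w hw
    rw [← CP.rep_ofAffine_ne_zero_iff, ← CP.rep_ofAffine_ne_zero_iff]
    have := direc_segInv ψ hp hw
    constructor
    · rintro ⟨-, h2, h3⟩
      rw [this] at h2 h3
      exact ⟨h2, h3⟩
    · rintro ⟨h2, h3⟩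
      refine ⟨contr_segInv_mem ψ hw, ?_⟩
      rw [this]
      exact ⟨h2, h3⟩
  obtain ⟨h1, h2⟩ := (hform z hz).1 h
  have c1 : ∀ c, ContDiffAt ℂ ω (fun w => insOne a (L j w).2.1 c) z := fun c =>
    (contDiff_insOne_L1 (L j) a c).contDiffAt
  have c2 : ∀ c, ContDiffAt ℂ ω (fun w => insOne b (L j w).2.2 c) z := fun c =>
    (contDiff_insOne_L2 (L j) b c).contDiffAt
  have htar := eventually_mem_segChart_target ψ L hp hz
  refine ⟨?_, ?_⟩
  · filter_upwards [htar, (c1 a').continuousAt.eventually (isOpen_ne.mem_nhds h1),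
      (c2 b').continuousAt.eventually (isOpen_ne.mem_nhds h2)] with w w1 w2 w3
    exact ⟨w1, (hform w w1).2 ⟨w2, w3⟩⟩
  · have h3 : (fun w => segChart ψ L hp j a' b' ((segChart ψ L hp j a b).symm w)) =ᶠ[𝓝 z]
        fun w => (L j).symm ((L j w).1 * (insOne a (L j w).2.1 a' * insOne b (L j w).2.2 b'),
          (fun i => insOne a (L j w).2.1 (a'.succAbove i) / insOne a (L j w).2.1 a'),
          fun i => insOne b (L j w).2.2 (b'.succAbove i) / insOne b (L j w).2.2 b') := by
      filter_upwards [htar] with w hw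
      change (L j).symm ((ψ j).emb (contr ψ (segInv ψ L j a b w)) (a', b'),
        CP.coords a' (direc ψ j (segInv ψ L j a b w)).1,
        CP.coords b' (direc ψ j (segInv ψ L j a b w)).2) = _
      rw [emb_contr_segInv ψ hw, direc_segInv ψ hp hw]
      refine congrArg _ (Prod.ext (segPar_apply _ _ _ _ _) (Prod.ext ?_ ?_))
      · exact funext fun i => congrFun (CP.affine_ofAffine _ _ _) _
      · exact funext fun i => congrFun (CP.affine_ofAffine _ _ _) _
    refine ContDiffAt.congr_of_eventuallyEq ?_ h3
    refine (L j).symm.contDiff.contDiffAt.comp z (ContDiffAt.prodMk ?_ (ContDiffAt.prodMk ?_ ?_))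
    · exact (contDiff_L1 (L j)).contDiffAt.mul ((c1 _).mul (c2 _))
    · exact contDiffAt_pi.2 fun i => (c1 _).div (c1 _) h1
    · exact contDiffAt_pi.2 fun i => (c2 _).div (c2 _) h2

lemma isHolTransition_seg_seg (i j : Fin k) (a : Fin (m i + 1)) (b : Fin (l i + 1))
    (a' : Fin (m j + 1)) (b' : Fin (l j + 1)) :
    IsHolTransition (segChart ψ L hp i a b) (segChart ψ L hp j a' b') := by
  intro z hz h
  by_cases hr : (segChart ψ L hp i a b).symm z ∈ range Total.reg
  · obtain ⟨y, hy⟩ := hr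
    have hc := chart_mem_atlas (Cn (Fin n)) y
    refine (isHolTransition_seg_push ψ L hp hc i a b).trans
      (isHolTransition_push_seg ψ L hp hc j a' b') hz ?_ h
    rw [← hy]
    exact (reg_mem_pushChart_source _ _).2 (mem_chart_source _ y)
  · have hij : i = j := by
      have h1 : contr ψ ((segChart ψ L hp i a b).symm z) ∈ (ψ i).toHomeo.source :=
        ((segChart ψ L hp i a b).map_target hz).1
      have h2 : contr ψ ((segChart ψ L hp i a b).symm z) ∈ (ψ j).toHomeo.source := h.1
      generalize (segChart ψ L hp i a b).symm z = x at hr h1 h2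
      induction x using Total.cases with
      | h1 y => exact absurd ⟨y, rfl⟩ hr
      | h2 r P => exact (eq_of_contr_exc_mem ψ hp h1).symm.trans (eq_of_contr_exc_mem ψ hp h2)
    subst hij
    exact isHolTransition_seg_seg_same ψ L hp i a a' b b' z hz h

/-- The atlas of the resolution. -/
def resAtlas : Set (PartialEquiv (Total Y p m l) (Cn (Fin n))) :=
  {e | (∃ c ∈ atlas (Cn (Fin n)) ↥(Y \ range p), e = pushChart c) ∨
    ∃ j a b, e = segChart ψ L hp j a b}

lemma exists_manifold_resAtlas :
    ∃ (_ : TopologicalSpace (Total Y p m l)) (_ : ChartedSpace (Cn (Fin n)) (Total Y p m l)),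
      IsManifold 𝓘(ℂ, Cn (Fin n)) ω (Total Y p m l) ∧
      ∀ e, e ∈ resAtlas ψ L hp ↔ ∃ e' ∈ atlas (Cn (Fin n)) (Total Y p m l), e'.toPartialEquiv = e := by
  refine exists_manifold_of_isHolTransition _ (fun x => ?_) ?_
  · induction x using Total.cases with
    | h1 y => exact ⟨_, Or.inl ⟨_, chart_mem_atlas (Cn (Fin n)) y, rfl⟩,
        (reg_mem_pushChart_source _ _).2 (mem_chart_source _ y)⟩
    | h2 j P =>
      obtain ⟨a, ha⟩ := P.1.exists_rep_ne
      obtain ⟨b, hb⟩ := P.2.exists_rep_ne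
      refine ⟨_, Or.inr ⟨j, a, b, rfl⟩, contr_exc_mem ψ j P, ?_⟩
      rw [direc_exc]
      exact ⟨ha, hb⟩
  · rintro _ (⟨c, hc, rfl⟩ | ⟨j, a, b, rfl⟩) _ (⟨c', hc', rfl⟩ | ⟨j', a', b', rfl⟩)
    · exact isHolTransition_push_push hc hc'
    · exact isHolTransition_push_seg ψ L hp hc j' a' b'
    · exact isHolTransition_seg_push ψ L hp hc' j a b
    · exact isHolTransition_seg_seg ψ L hp j j' a b a' b'

end Transitions

/-! ### Properties of the resolution -/

section Resolution

variable {N n k : ℕ} {Y : Set (CP N)} {p : Fin k → CP N} {m l : Fin k → ℕ}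
  [ChartedSpace (Cn (Fin n)) ↥(Y \ range p)] [IsManifold 𝓘(ℂ, Cn (Fin n)) ω ↥(Y \ range p)]
  {ψ : ∀ j, ConeChart (n := n) Y (range p) (p j) (m j) (l j)}
  {L : ∀ j, Cn (Fin n) ≃L[ℂ] Par (m j) (l j)} {hp : Function.Injective p}
  [TopologicalSpace (Total Y p m l)] [ChartedSpace (Cn (Fin n)) (Total Y p m l)]

variable (ψ L hp) in
/-- The manifold structure has the charts `resAtlas`. -/
def HasResAtlas : Prop :=
  ∀ e, e ∈ resAtlas ψ L hp ↔ ∃ e' ∈ atlas (Cn (Fin n)) (Total Y p m l), e'.toPartialEquiv = e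

lemma HasResAtlas.exists_pushChart (hat : HasResAtlas ψ L hp)
    {c : OpenPartialHomeomorph ↥(Y \ range p) (Cn (Fin n))}
    (hc : c ∈ atlas (Cn (Fin n)) ↥(Y \ range p)) :
    ∃ e ∈ atlas (Cn (Fin n)) (Total Y p m l), e.toPartialEquiv = pushChart c :=
  (hat _).1 (Or.inl ⟨c, hc, rfl⟩)

lemma HasResAtlas.exists_segChart (hat : HasResAtlas ψ L hp) (j : Fin k) (a : Fin (m j + 1))
    (b : Fin (l j + 1)) :
    ∃ e ∈ atlas (Cn (Fin n)) (Total Y p m l), e.toPartialEquiv = segChart ψ L hp j a b :=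
  (hat _).1 (Or.inr ⟨j, a, b, rfl⟩)

/-- Near a point of the regular part, the inclusion is the identity in suitable charts. -/
lemma HasResAtlas.exists_chart_reg (hat : HasResAtlas ψ L hp) (y : ↥(Y \ range p)) :
    ∃ e ∈ atlas (Cn (Fin n)) (Total Y p m l), Total.reg y ∈ e.source ∧
      (∀ y' ∈ (chartAt (Cn (Fin n)) y).source, Total.reg y' ∈ e.source ∧
        e (Total.reg y') = chartAt (Cn (Fin n)) y y' ∧
        e.symm (chartAt (Cn (Fin n)) y y') = Total.reg y') ∧
      e.source ⊆ range Total.reg := by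
  obtain ⟨e, he, hec⟩ := hat.exists_pushChart (chart_mem_atlas (Cn (Fin n)) y)
  have hsrc : e.source = Total.reg '' (chartAt (Cn (Fin n)) y).source :=
    congrArg PartialEquiv.source hec
  have h1 : ∀ y', e (Total.reg y') = chartAt (Cn (Fin n)) y y' := fun y' =>
    congrFun (congrArg (fun e : PartialEquiv _ _ => (e : _ → _)) hec) (Total.reg y')
  have h2 : ∀ z, e.symm z = Total.reg ((chartAt (Cn (Fin n)) y).symm z) := fun z =>
    congrFun (congrArg (fun e : PartialEquiv _ _ => (e.symm : _ → _)) hec) z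
  refine ⟨e, he, ?_, fun y' hy' => ⟨?_, h1 y', ?_⟩, ?_⟩
  · rw [hsrc]; exact ⟨y, mem_chart_source _ y, rfl⟩
  · rw [hsrc]; exact ⟨y', hy', rfl⟩
  · rw [h2, (chartAt (Cn (Fin n)) y).left_inv hy']
  · rw [hsrc]; exact image_subset_range _ _

lemma HasResAtlas.map_nhds_reg (hat : HasResAtlas ψ L hp) (y : ↥(Y \ range p)) :
    map Total.reg (𝓝 y) = 𝓝 (Total.reg y : Total Y p m l) := by
  obtain ⟨e, he, hs, h, -⟩ := hat.exists_chart_reg y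
  set c := chartAt (Cn (Fin n)) y with hc
  have hys : y ∈ c.source := mem_chart_source _ y
  have h1 : Total.reg =ᶠ[𝓝 y] fun y' => e.symm (c y') := by
    filter_upwards [c.open_source.mem_nhds hys] with y' hy' using (h y' hy').2.2.symm
  rw [Filter.map_congr h1]
  change map (e.symm ∘ c) (𝓝 y) = _
  rw [← Filter.map_map, c.map_nhds_eq hys, ← (h y hys).2.1,
    e.symm.map_nhds_eq (e.map_source hs), e.left_inv hs]

lemma HasResAtlas.isOpenEmbedding_reg (hat : HasResAtlas ψ L hp) :
    IsOpenEmbedding (Total.reg : _ → Total Y p m l) := by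
  refine .of_continuous_injective_isOpenMap ?_ Total.reg_injective ?_
  · exact continuous_iff_continuousAt.2 fun y => (hat.map_nhds_reg y).le
  · exact IsOpenMap.of_nhds_le fun y => (hat.map_nhds_reg y).ge

/-- Every point over the domain of a cone chart is in the domain of an affine chart of the blow-up. -/
lemma HasResAtlas.exists_chart_seg (hat : HasResAtlas ψ L hp) {j : Fin k} {a : Fin (m j + 1)}
    {b : Fin (l j + 1)} {x : Total Y p m l} (h : x ∈ (segChart ψ L hp j a b).source) :
    ∃ e ∈ atlas (Cn (Fin n)) (Total Y p m l), x ∈ e.source ∧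
      e.target = (segChart ψ L hp j a b).target ∧ (∀ z, e.symm z = segInv ψ L j a b z) ∧
      (∀ x, e x = segChart ψ L hp j a b x) ∧ e.source = (segChart ψ L hp j a b).source := by
  obtain ⟨e, he, hec⟩ := hat.exists_segChart j a b
  refine ⟨e, he, ?_, congrArg PartialEquiv.target hec, fun z =>
    congrFun (congrArg (fun e : PartialEquiv _ _ => (e.symm : _ → _)) hec) z, fun x =>
    congrFun (congrArg (fun e : PartialEquiv _ _ => (e : _ → _)) hec) x,
    congrArg PartialEquiv.source hec⟩
  have : e.source = _ := congrArg PartialEquiv.source hec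
  rw [this]; exact h

lemma exists_mem_segChart_source {j : Fin k} {x : Total Y p m l}
    (h : contr ψ x ∈ (ψ j).toHomeo.source) : ∃ a b, x ∈ (segChart ψ L hp j a b).source := by
  obtain ⟨a, ha⟩ := (direc ψ j x).1.exists_rep_ne
  obtain ⟨b, hb⟩ := (direc ψ j x).2.exists_rep_ne
  exact ⟨a, b, h, ha, hb⟩

variable [IsManifold 𝓘(ℂ, Cn (Fin n)) ω (Total Y p m l)]

lemma HasResAtlas.contMDiff_reg (hat : HasResAtlas ψ L hp) :
    ContMDiff 𝓘(ℂ, Cn (Fin n)) 𝓘(ℂ, Cn (Fin n)) ω (Total.reg : _ → Total Y p m l) := by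
  intro y
  obtain ⟨e, he, hs, h, -⟩ := hat.exists_chart_reg y
  have hys : y ∈ (chartAt (Cn (Fin n)) y).source := mem_chart_source _ y
  have h1 : Total.reg =ᶠ[𝓝 y] fun y' => e.symm (chartAt (Cn (Fin n)) y y') := by
    filter_upwards [(chartAt (Cn (Fin n)) y).open_source.mem_nhds hys] with y' hy'
      using (h y' hy').2.2.symm
  refine ContMDiffAt.congr_of_eventuallyEq ?_ h1
  exact (contMDiffAt_atlas_symm he (by rw [← (h y hys).2.1]; exact e.map_source hs)).comp y
    (contMDiffAt_atlas (chart_mem_atlas (Cn (Fin n)) y) hys)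

/-- The inverse of the inclusion of the regular part. -/
def unreg (y₀ : ↥(Y \ range p)) : Total Y p m l → ↥(Y \ range p) := Sum.elim id fun _ => y₀

@[simp] lemma unreg_reg (y₀ y : ↥(Y \ range p)) :
    unreg y₀ (Total.reg y : Total Y p m l) = y := rfl

lemma HasResAtlas.contMDiffOn_unreg (hat : HasResAtlas ψ L hp) (y₀ : ↥(Y \ range p)) :
    ContMDiffOn 𝓘(ℂ, Cn (Fin n)) 𝓘(ℂ, Cn (Fin n)) ω (unreg y₀ : Total Y p m l → _)
      (range Total.reg) := by
  rintro _ ⟨y, rfl⟩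
  refine ContMDiffAt.contMDiffWithinAt ?_
  obtain ⟨e, he, hs, h, hr⟩ := hat.exists_chart_reg y
  set c := chartAt (Cn (Fin n)) y with hc
  have hys : y ∈ c.source := mem_chart_source _ y
  have h1 : unreg y₀ =ᶠ[𝓝 (Total.reg y : Total Y p m l)] fun x => c.symm (e x) := by
    rw [← hat.map_nhds_reg y]
    change ∀ᶠ y' in 𝓝 y, _
    filter_upwards [c.open_source.mem_nhds hys] with y' hy'
    rw [(h y' hy').2.1, c.left_inv hy', unreg_reg]
  refine ContMDiffAt.congr_of_eventuallyEq ?_ h1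
  exact (contMDiffAt_atlas_symm (chart_mem_atlas (Cn (Fin n)) y)
    (by rw [(h y hys).2.1]; exact c.map_source hys)).comp _ (contMDiffAt_atlas he hs)

lemma HasResAtlas.continuous_contr (hat : HasResAtlas ψ L hp) : Continuous (contr ψ) := by
  rw [continuous_iff_continuousAt]
  intro x
  induction x using Total.cases with
  | h1 y =>
    have h := (continuous_incl (S := range p)).continuousAt (x := y)
    rw [ContinuousAt, ← hat.map_nhds_reg y, tendsto_map'_iff]
    exact h
  | h2 j P =>
    obtain ⟨a, b, hab⟩ := exists_mem_segChart_source (L := L) (hp := hp) (contr_exc_mem ψ j P)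
    obtain ⟨e, he, hx, ht, hsymm, -⟩ := hat.exists_chart_seg hab
    have h1 : contr ψ =ᶠ[𝓝 (Total.exc j P)] fun x => contr ψ (segInv ψ L j a b (e x)) := by
      filter_upwards [e.open_source.mem_nhds hx] with x' hx'
      rw [← hsymm, e.left_inv hx']
    refine ContinuousAt.congr ?_ h1.symm
    exact ContinuousAt.comp (g := fun z => contr ψ (segInv ψ L j a b z)) (f := e)
      (continuousAt_contr_segInv ψ L hp (by rw [← ht]; exact e.map_source hx)) (e.continuousAt hx)

lemma HasResAtlas.continuousAt_direc (hat : HasResAtlas ψ L hp) {j : Fin k} {x : Total Y p m l}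
    (h : contr ψ x ∈ (ψ j).toHomeo.source) : ContinuousAt (direc ψ j) x := by
  obtain ⟨a, b, hab⟩ := exists_mem_segChart_source (L := L) (hp := hp) h
  obtain ⟨e, he, hx, ht, hsymm, -⟩ := hat.exists_chart_seg hab
  have h1 : direc ψ j =ᶠ[𝓝 x] fun x =>
      (CP.ofAffine a (L j (e x)).2.1, CP.ofAffine b (L j (e x)).2.2) := by
    filter_upwards [e.open_source.mem_nhds hx] with x' hx'
    have h2 := direc_segInv ψ hp (z := e x')
      (show e x' ∈ (segChart ψ L hp j a b).target by rw [← ht]; exact e.map_source hx')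
    rwa [← hsymm, e.left_inv hx'] at h2
  refine ContinuousAt.congr ?_ h1.symm
  have h3 : ContinuousAt (fun x => L j (e x)) x :=
    ContinuousAt.comp (g := L j) (L j).continuous.continuousAt (e.continuousAt hx)
  refine ContinuousAt.prodMk ?_ ?_
  · exact ContinuousAt.comp (g := CP.ofAffine a) (CP.continuous_ofAffine a).continuousAt h3.snd.fst
  · exact ContinuousAt.comp (g := CP.ofAffine b) (CP.continuous_ofAffine b).continuousAt h3.snd.snd

lemma HasResAtlas.t2Space (hat : HasResAtlas ψ L hp) : T2Space (Total Y p m l) := by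
  rw [t2Space_iff_disjoint_nhds]
  intro x x' hne
  by_cases h : contr ψ x = contr ψ x'
  · have key : ∀ j, contr ψ x ∈ (ψ j).toHomeo.source → Disjoint (𝓝 x) (𝓝 x') := by
      intro j hj
      refine Tendsto.disjoint (hat.continuousAt_direc hj)
        (disjoint_nhds_nhds.2 fun h2 => hne (Total.ext_of_contr ψ hp hj h h2))
        (hat.continuousAt_direc (by rw [← h]; exact hj))
    induction x using Total.cases with
    | h1 y =>
      induction x' using Total.cases with
      | h1 y' => exact absurd (congrArg Total.reg (incl_injective h)) hne
      | h2 j P => exact absurd h (contr_reg_ne_exc ψ y j P)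
    | h2 j P => exact key j (contr_exc_mem ψ j P)
  · exact Tendsto.disjoint hat.continuous_contr.continuousAt (disjoint_nhds_nhds.2 h)
      hat.continuous_contr.continuousAt

lemma dense_ne_zero (j : Fin k) : Dense {z | (L j z).1 ≠ 0} :=
  (dense_compl_singleton (0 : ℂ)).preimage (f := fun z => (L j z).1)
    (isOpenMap_fst.comp (L j).toHomeomorph.isOpenMap)

lemma HasResAtlas.dense_range_reg (hat : HasResAtlas ψ L hp) :
    Dense (range (Total.reg : _ → Total Y p m l)) := by
  intro x
  induction x using Total.cases with
  | h1 y => exact subset_closure ⟨y, rfl⟩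
  | h2 j P =>
    obtain ⟨a, b, hab⟩ := exists_mem_segChart_source (L := L) (hp := hp) (contr_exc_mem ψ j P)
    obtain ⟨e, he, hx, ht, hsymm, -⟩ := hat.exists_chart_seg hab
    rw [mem_closure_iff_frequently]
    have h1 := mem_closure_iff_frequently.1 (dense_ne_zero (L := L) j (e (Total.exc j P)))
    have h2 := e.symm.map_nhds_eq (e.map_source hx)
    rw [e.left_inv hx] at h2
    rw [← h2, frequently_map]
    refine (h1.and_eventually (e.open_target.mem_nhds (e.map_source hx))).mono fun z hz => ?_
    rw [hsymm]
    exact (segInv_mem_range_iff ψ hp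
      (show z ∈ (segChart ψ L hp j a b).target by rw [← ht]; exact hz.2)).2 hz.1

lemma exists_radius (j : Fin k) : ∃ r : ℝ, 0 < r ∧ ∀ x : ↥(cone (m j) (l j)),
    (∀ c, ‖(x : SegreSpace (m j) (l j)) c‖ ≤ r) → x ∈ (ψ j).toHomeo.target := by
  obtain ⟨hq, h1, h2⟩ := (ψ j).center
  have h0 := (ψ j).toHomeo.map_source h1
  obtain ⟨O, hO, hOt⟩ := isOpen_induced_iff.1 (ψ j).toHomeo.open_target
  have hc : Continuous fun f : Fin (m j + 1) × Fin (l j + 1) → ℂ =>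
      (WithLp.toLp 2 f : SegreSpace (m j) (l j)) := PiLp.continuous_toLp 2 _
  have hmem : (0 : Fin (m j + 1) × Fin (l j + 1) → ℂ) ∈
      (fun f => (WithLp.toLp 2 f : SegreSpace (m j) (l j))) ⁻¹' O := by
    have h3 : ((ψ j).toHomeo ⟨p j, hq⟩ : SegreSpace (m j) (l j)) ∈ O := by
      rw [← hOt] at h0; exact h0
    rw [h2] at h3
    exact h3
  obtain ⟨r, hr, hrO⟩ := Metric.nhds_basis_closedBall.mem_iff.1 ((hO.preimage hc).mem_nhds hmem)
  refine ⟨r, hr, fun x hx => ?_⟩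
  rw [← hOt]
  have h4 : (WithLp.ofLp (x : SegreSpace (m j) (l j))) ∈ Metric.closedBall (0 : Fin (m j + 1) × Fin (l j + 1) → ℂ) r := by
    rw [mem_closedBall_zero_iff, pi_norm_le_iff_of_nonneg hr.le]
    exact hx
  exact hrO h4

lemma norm_insOne_le {m : ℕ} (a : Fin (m + 1)) {ζ : Fin m → ℂ} (h : ‖ζ‖ ≤ 1) (c : Fin (m + 1)) :
    ‖insOne a ζ c‖ ≤ 1 := by
  refine Fin.succAboveCases a ?_ (fun i => ?_) c
  · simp
  · rw [insOne_succAbove]; exact (norm_le_pi_norm ζ i).trans h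

lemma CP.exists_norm_coords_le {N : ℕ} (P : CP N) : ∃ a, P.rep a ≠ 0 ∧ ‖CP.coords a P‖ ≤ 1 := by
  obtain ⟨a, ha⟩ := Finite.exists_max fun a => ‖P.rep a‖
  obtain ⟨b, hb⟩ := P.exists_rep_ne
  have h0 : 0 < ‖P.rep a‖ := (norm_pos_iff.2 hb).trans_le (ha b)
  refine ⟨a, norm_pos_iff.1 h0, (pi_norm_le_iff_of_nonneg zero_le_one).2 fun i => ?_⟩
  rw [CP.coords, CP.affine, norm_div, div_le_one h0]
  exact ha _

lemma HasResAtlas.compactSpace (hat : HasResAtlas ψ L hp) (hY : IsClosed Y) :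
    CompactSpace (Total Y p m l) := by
  have : CompactSpace ↥Y := isCompact_iff_compactSpace.1 hY.isCompact
  choose r hr hrt using exists_radius (ψ := ψ)
  set K : ∀ j : Fin k, Set (Cn (Fin n)) := fun j =>
    L j ⁻¹' (Metric.closedBall 0 (r j) ×ˢ Metric.closedBall 0 1) with hK
  have hKc : ∀ j, IsCompact (K j) := fun j =>
    (L j).toHomeomorph.isCompact_preimage.2
      ((isCompact_closedBall _ _).prod (isCompact_closedBall _ _))
  have hKt : ∀ j a b, K j ⊆ (segChart ψ L hp j a b).target := by
    intro j a b z hz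
    refine hrt j _ fun c => ?_
    obtain ⟨h1, h2⟩ := hz
    rw [mem_closedBall_zero_iff] at h1 h2
    change ‖(L j z).1 * (insOne a (L j z).2.1 c.1 * insOne b (L j z).2.2 c.2)‖ ≤ r j
    rw [norm_mul, norm_mul]
    have e1 := norm_insOne_le a ((norm_fst_le _).trans h2) c.1
    have e2 := norm_insOne_le b ((norm_snd_le _).trans h2) c.2
    have e3 := (hr j).le
    calc _ ≤ r j * (1 * 1) := by gcongr
      _ = r j := by ring
  have him : ∀ j a b, IsCompact (segInv ψ L j a b '' K j) := by
    intro j a b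
    obtain ⟨e, he, hec⟩ := hat.exists_segChart j a b
    have h1 : ∀ z, e.symm z = segInv ψ L j a b z := fun z =>
      congrFun (congrArg (fun e : PartialEquiv _ _ => (e.symm : _ → _)) hec) z
    have h2 : e.target = (segChart ψ L hp j a b).target := congrArg PartialEquiv.target hec
    rw [← image_congr fun z _ => h1 z]
    exact (hKc j).image_of_continuousOn (e.continuousOn_symm.mono (by rw [h2]; exact hKt j a b))
  set U : Fin k → Set ↥Y := fun j => (ψ j).toHomeo.source ∩ (ψ j).toHomeo ⁻¹'
    {x | ∀ c, ‖(x : SegreSpace (m j) (l j)) c‖ < r j} with hU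
  have hUo : ∀ j, IsOpen (U j) := by
    intro j
    refine (ψ j).toHomeo.continuousOn.isOpen_inter_preimage (ψ j).toHomeo.open_source ?_
    rw [ofPred_forall]
    exact isOpen_iInter_of_finite fun c => isOpen_lt (continuous_emb_entry c).norm continuous_const
  have hUx : ∀ j (x : Total Y p m l), contr ψ x ∈ U j → ∃ a b, x ∈ segInv ψ L j a b '' K j := by
    intro j x hx
    obtain ⟨a, ha, ha'⟩ := (direc ψ j x).1.exists_norm_coords_le
    obtain ⟨b, hb, hb'⟩ := (direc ψ j x).2.exists_norm_coords_le
    have hs : x ∈ (segChart ψ L hp j a b).source := ⟨hx.1, ha, hb⟩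
    refine ⟨a, b, segChart ψ L hp j a b x, ?_, (segChart ψ L hp j a b).left_inv hs⟩
    change L j ((L j).symm _) ∈ Metric.closedBall 0 (r j) ×ˢ Metric.closedBall 0 1
    rw [ContinuousLinearEquiv.apply_symm_apply]
    refine ⟨mem_closedBall_zero_iff.2 (hx.2 (a, b)).le, mem_closedBall_zero_iff.2 ?_⟩
    exact norm_prod_le_iff.2 ⟨ha', hb'⟩
  set C : Set ↥Y := (⋃ j, U j)ᶜ with hC
  have hCc : IsCompact C := (isOpen_iUnion hUo).isClosed_compl.isCompact
  have hCr : C ⊆ range (incl : ↥(Y \ range p) → ↥Y) := by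
    intro y hy
    by_cases h : (y : CP N) ∈ range p
    · obtain ⟨j, hj⟩ := h
      refine absurd (mem_iUnion.2 ⟨j, ?_⟩) hy
      have h1 : contr ψ (Total.exc j (CP.ofAffine 0 0, CP.ofAffine 0 0)) = y := Subtype.ext hj
      rw [← h1]
      refine ⟨contr_exc_mem ψ j _, fun c => ?_⟩
      have h2 := emb_contr_exc ψ j (CP.ofAffine 0 0, CP.ofAffine 0 0)
      rw [ConeChart.emb] at h2
      rw [h2]
      simpa using hr j
    · exact ⟨⟨y, y.2, h⟩, rfl⟩
  have hregC : IsCompact ((Total.reg : _ → Total Y p m l) '' (incl ⁻¹' C)) :=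
    (isInducing_incl.isCompact_preimage_iff hCr |>.2 hCc).image hat.isOpenEmbedding_reg.continuous
  have hun : (univ : Set (Total Y p m l)) = (Total.reg '' (incl ⁻¹' C)) ∪
      ⋃ j, ⋃ a, ⋃ b, segInv ψ L j a b '' K j := by
    symm
    rw [eq_univ_iff_forall]
    intro x
    by_cases hx : contr ψ x ∈ C
    · left
      induction x using Total.cases with
      | h1 y => exact ⟨y, hx, rfl⟩
      | h2 j P =>
        obtain ⟨y, hy⟩ := hCr hx
        exact absurd hy (contr_reg_ne_exc ψ y j P)
    · right
      obtain ⟨j, hj⟩ := mem_iUnion.1 (notMem_compl_iff.1 hx)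
      obtain ⟨a, b, h⟩ := hUx j x hj
      exact mem_iUnion.2 ⟨j, mem_iUnion₂.2 ⟨a, b, h⟩⟩
  refine ⟨?_⟩
  rw [hun]
  exact hregC.union (isCompact_iUnion fun j => isCompact_iUnion fun a => isCompact_iUnion fun b =>
    him j a b)

end Resolution

section Resolution

variable {N n k : ℕ} {Y : Set (CP N)} {p : Fin k → CP N} {m l : Fin k → ℕ}
  [ChartedSpace (Cn (Fin n)) ↥(Y \ range p)] [IsManifold 𝓘(ℂ, Cn (Fin n)) ω ↥(Y \ range p)]
  {ψ : ∀ j, ConeChart (n := n) Y (range p) (p j) (m j) (l j)}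
  {L : ∀ j, Cn (Fin n) ≃L[ℂ] Par (m j) (l j)} {hp : Function.Injective p}
  [TopologicalSpace (Total Y p m l)] [ChartedSpace (Cn (Fin n)) (Total Y p m l)]
  [IsManifold 𝓘(ℂ, Cn (Fin n)) ω (Total Y p m l)]

lemma mfderiv_chart_injective {M : Type} [TopologicalSpace M] [ChartedSpace (Cn (Fin n)) M]
    [IsManifold 𝓘(ℂ, Cn (Fin n)) ω M] {φ : OpenPartialHomeomorph M (Cn (Fin n))}
    (hφ : φ ∈ atlas (Cn (Fin n)) M) {x : M} (hx : x ∈ φ.source) :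
    Function.Injective (mfderiv 𝓘(ℂ, Cn (Fin n)) 𝓘(ℂ, Cn (Fin n)) φ x) := by
  obtain ⟨z, hz, rfl⟩ : ∃ z ∈ φ.target, φ.symm z = x := ⟨φ x, φ.map_source hx, φ.left_inv hx⟩
  intro v w h
  obtain ⟨v', rfl⟩ := surjective_mder_symm hφ hz v
  obtain ⟨w', rfl⟩ := surjective_mder_symm hφ hz w
  have h1 := mfderiv_chart_mder_symm hφ hz v'
  have h2 := mfderiv_chart_mder_symm hφ hz w'
  have h3 : v' = w' := h1.symm.trans ((show _ = _ from h).trans h2)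
  rw [h3]

lemma HasResAtlas.isBlowUp (hat : HasResAtlas ψ L hp) (j : Fin k) : (ψ j).IsBlowUp (contr ψ) := by
  refine ⟨direc ψ j, fun x hx => (hat.continuousAt_direc hx).continuousWithinAt,
    ⟨fun x hx => ⟨mem_blowUp_direc ψ hp hx, _, (ψ j).toHomeo.map_source hx, rfl⟩, ?_, ?_⟩, ?_⟩
  · intro x hx x' hx' h
    exact Total.ext_of_contr ψ hp hx (emb_injOn ψ j hx hx' (congrArg Prod.fst h))
      (congrArg Prod.snd h)
  · rintro ⟨x, Θ⟩ ⟨hb, t, ht, hx⟩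
    obtain ⟨a, ha⟩ := Θ.1.exists_rep_ne
    obtain ⟨b, hb'⟩ := Θ.2.exists_rep_ne
    have h1 := segPar_of_mem_blowUp hb ha hb'
    set z := (L j).symm (x (a, b), CP.coords a Θ.1, CP.coords b Θ.2) with hz
    have hLz : L j z = (x (a, b), CP.coords a Θ.1, CP.coords b Θ.2) := (L j).apply_symm_apply _
    have hzt : segCone a b (L j z) ∈ (ψ j).toHomeo.target := by
      have : segCone a b (L j z) = t := Subtype.ext (by rw [hLz]; exact h1.trans hx.symm)
      rwa [this]
    refine ⟨segInv ψ L j a b z, contr_segInv_mem ψ hzt, Prod.ext ?_ ?_⟩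
    · change (ψ j).emb _ = x
      rw [emb_contr_segInv ψ hzt, hLz, h1]
    · change direc ψ j _ = Θ
      rw [direc_segInv ψ hp hzt, hLz]
      exact Prod.ext (CP.ofAffine_coords ha) (CP.ofAffine_coords hb')
  · intro a b
    set F : Total Y p m l → SegreSpace (m j) (l j) × (Fin (m j + 1) → ℂ) × (Fin (l j + 1) → ℂ) :=
      fun x => ((ψ j).emb (contr ψ x), CP.affine a (direc ψ j x).1, CP.affine b (direc ψ j x).2)
      with hF
    set G : Cn (Fin n) → SegreSpace (m j) (l j) × (Fin (m j + 1) → ℂ) × (Fin (l j + 1) → ℂ) :=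
      fun z => (segPar a b (L j z), insOne a (L j z).2.1, insOne b (L j z).2.2) with hG
    have hGs : ContDiff ℂ ω G := (contDiff_segPar (L j) a b).prodMk
      ((contDiff_pi.2 fun c => contDiff_insOne_L1 (L j) a c).prodMk
        (contDiff_pi.2 fun c => contDiff_insOne_L2 (L j) b c))
    set P : SegreSpace (m j) (l j) × (Fin (m j + 1) → ℂ) × (Fin (l j + 1) → ℂ) → Cn (Fin n) :=
      fun q => (L j).symm (q.1 (a, b), (fun i => q.2.1 (a.succAbove i)), fun i => q.2.2 (b.succAbove i))
      with hP
    have hPs : ContDiff ℂ ω P := by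
      refine (L j).symm.contDiff.comp (ContDiff.prodMk ?_ (ContDiff.prodMk ?_ ?_))
      · exact (coordCLM (a, b)).contDiff.comp contDiff_fst
      · exact contDiff_pi.2 fun i => (contDiff_apply ℂ ℂ (a.succAbove i)).comp
          (contDiff_fst.comp contDiff_snd)
      · exact contDiff_pi.2 fun i => (contDiff_apply ℂ ℂ (b.succAbove i)).comp
          (contDiff_snd.comp contDiff_snd)
    have key : ∀ x ∈ (segChart ψ L hp j a b).source,
        ContMDiffAt 𝓘(ℂ, Cn (Fin n))
          𝓘(ℂ, SegreSpace (m j) (l j) × (Fin (m j + 1) → ℂ) × (Fin (l j + 1) → ℂ)) ω F x ∧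
        Function.Injective (mfderiv 𝓘(ℂ, Cn (Fin n))
          𝓘(ℂ, SegreSpace (m j) (l j) × (Fin (m j + 1) → ℂ) × (Fin (l j + 1) → ℂ)) F x) := by
      intro x hx
      obtain ⟨e, he, hxe, ht, hsymm, hfun, hsrc⟩ := hat.exists_chart_seg hx
      have h1 : F =ᶠ[𝓝 x] G ∘ e := by
        filter_upwards [e.open_source.mem_nhds hxe] with x' hx'
        have hz : e x' ∈ (segChart ψ L hp j a b).target := by rw [← ht]; exact e.map_source hx'
        have h2 := emb_contr_segInv ψ hz
        have h3 := direc_segInv ψ hp hz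
        rw [← hsymm, e.left_inv hx'] at h2 h3
        simp only [hF, hG, Function.comp, h2, h3, CP.affine_ofAffine, insOne_same, div_one]
      have hFx : ContMDiffAt 𝓘(ℂ, Cn (Fin n))
          𝓘(ℂ, SegreSpace (m j) (l j) × (Fin (m j + 1) → ℂ) × (Fin (l j + 1) → ℂ)) ω F x :=
        ContMDiffAt.congr_of_eventuallyEq
          (hGs.contMDiff.contMDiffAt.comp x (contMDiffAt_atlas he hxe)) h1
      refine ⟨hFx, ?_⟩
      have h4 : P ∘ F = e := by
        funext x'
        rw [hfun]
        rfl
      have h5 := mfderiv_comp x (g := P) (f := F) (hPs.contMDiff.mdifferentiableAt (by simp))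
        (hFx.mdifferentiableAt (by simp))
      have h6 := mfderiv_chart_injective he hxe
      rw [← h4, h5] at h6
      exact Function.Injective.of_comp (f := mfderiv _ 𝓘(ℂ, Cn (Fin n)) P (F x)) h6
    exact ⟨fun x hx => (key x hx).1.contMDiffWithinAt, fun x hx => (key x hx).2⟩

lemma HasResAtlas.isResolution (hat : HasResAtlas ψ L hp) :
    IsResolution ψ (contr ψ) (Total.reg : _ → Total Y p m l) where
  continuous := hat.continuous_contr
  section_eq y := rfl
  range_eq := by
    ext x
    induction x using Total.cases with
    | h1 y => exact ⟨fun _ => y.2.2, fun _ => ⟨y, rfl⟩⟩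
    | h2 j P => exact ⟨fun h => absurd h (Total.exc_notMem j P), fun h => absurd ⟨j, rfl⟩ h⟩
  isOpenEmbedding := hat.isOpenEmbedding_reg
  biholomorphic := by
    refine ⟨hat.contMDiff_reg.contMDiffOn, fun y _ => ?_⟩
    have h1 := mfderiv_comp y (g := unreg y) (f := (Total.reg : _ → Total Y p m l))
      (((hat.contMDiffOn_unreg y).contMDiffAt
        (hat.isOpenEmbedding_reg.isOpen_range.mem_nhds ⟨y, rfl⟩)).mdifferentiableAt (by simp))
      (hat.contMDiff_reg.mdifferentiableAt (by simp))
    have h2 : (unreg y ∘ (Total.reg : _ → Total Y p m l)) = id := rfl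
    rw [h2, mfderiv_id] at h1
    have h3 : Function.Injective (ContinuousLinearMap.id ℂ (TangentSpace 𝓘(ℂ, Cn (Fin n)) y)) :=
      Function.injective_id
    rw [h1] at h3
    exact Function.Injective.of_comp (f := mfderiv 𝓘(ℂ, Cn (Fin n)) 𝓘(ℂ, Cn (Fin n)) (unreg y)
      (Total.reg y : Total Y p m l)) h3
  blowUp := hat.isBlowUp

/-- The local extensions of the metric and of its Ricci form exist everywhere on the resolution. -/
lemma HasResAtlas.exists_isLocalExtension (hat : HasResAtlas ψ L hp) (hm : ∀ j, 1 ≤ m j)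
    (hl : ∀ j, 1 ≤ l j) {g : SesqField n ↥(Y \ range p)} (hg : IsKahler g)
    (hgp : ∀ j, (ψ j).IsRestriction g) (y₀ : ↥(Y \ range p))
    {φ : OpenPartialHomeomorph (Total Y p m l) (Cn (Fin n))}
    (hφ : φ ∈ atlas (Cn (Fin n)) (Total Y p m l)) {z : Cn (Fin n)} (hz : z ∈ φ.target) :
    ∃ A B, IsLocalExtension g (fun w => unreg y₀ (φ.symm w)) (φ.symm ⁻¹' range Total.reg) z A B := by
  have hr := hat.contMDiffOn_unreg y₀
  have ho := hat.isOpenEmbedding_reg.isOpen_range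
  by_cases hzr : φ.symm z ∈ range Total.reg
  · exact ⟨_, _, isLocalExtension_of_mem_range hg hat.contMDiff_reg hr (unreg_reg y₀) ho hφ hz hzr⟩
  · rcases (hat _).2 ⟨φ, hφ, rfl⟩ with ⟨c, hc, h⟩ | ⟨j, a, b, h⟩
    · refine absurd ?_ hzr
      have h1 : φ.symm z = (pushChart c).symm z :=
        congrFun (congrArg (fun e : PartialEquiv _ _ => (e.symm : _ → _)) h) z
      exact ⟨_, h1.symm⟩
    · have hs : ∀ w, φ.symm w = segInv ψ L j a b w := fun w =>
        congrFun (congrArg (fun e : PartialEquiv _ _ => (e.symm : _ → _)) h) w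
      have ht : φ.target = (segChart ψ L hp j a b).target := congrArg PartialEquiv.target h
      have hzt : segCone a b (L j z) ∈ (ψ j).toHomeo.target := by rw [ht] at hz; exact hz
      have hev : ∀ᶠ w in 𝓝 z, segCone a b (L j w) ∈ (ψ j).toHomeo.target :=
        eventually_mem_segChart_target ψ L hp (show z ∈ (segChart ψ L hp j a b).target from hzt)
      have hrange : ∀ w, segCone a b (L j w) ∈ (ψ j).toHomeo.target →
          (w ∈ φ.symm ⁻¹' range Total.reg ↔ (L j w).1 ≠ 0) := fun w hw => by
        rw [mem_preimage, hs]; exact segInv_mem_range_iff ψ hp hw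
      refine (ψ j).exists_isLocalExtension (hm j) (hl j) (hgp j) (L j) a b ?_
        (hev.mono hrange) ?_ ?_
      · by_contra h0
        exact hzr ((hrange z hzt).2 h0)
      · filter_upwards [φ.open_target.mem_nhds hz] with w hw hwr
        exact contMDiffAt_retract_symm hr ho hφ hw hwr
      · filter_upwards [hev] with w hw hwr
        obtain ⟨y, hy⟩ := hwr
        have h1 : incl (unreg y₀ (φ.symm w)) = contr ψ (φ.symm w) := by rw [← hy]; rfl
        rw [h1, hs]
        exact ⟨contr_segInv_mem ψ hw, emb_contr_segInv ψ hw⟩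

lemma HasResAtlas.nonempty_reg (hat : HasResAtlas ψ L hp) (hY : Y.Nonempty) :
    Nonempty ↥(Y \ range p) := by
  obtain ⟨y, hy⟩ := hY
  have : Nonempty (Total Y p m l) := by
    by_cases h : y ∈ range p
    · obtain ⟨j, -⟩ := h
      exact ⟨Total.exc j (CP.ofAffine 0 0, CP.ofAffine 0 0)⟩
    · exact ⟨Total.reg ⟨y, hy, h⟩⟩
  obtain ⟨_, ⟨y, rfl⟩⟩ := hat.dense_range_reg.nonempty
  exact ⟨y⟩

end Resolution

/-! ### The Riemannian distance of a Hermitian metric -/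

section Real

variable {n : ℕ} {A B : Type} [TopologicalSpace A] [ChartedSpace (Cn (Fin n)) A]
  [TopologicalSpace B] [ChartedSpace (Cn (Fin n)) B]

lemma hasMFDerivAt_real {f : A → B} {x : A}
    (h : MDifferentiableAt 𝓘(ℂ, Cn (Fin n)) 𝓘(ℂ, Cn (Fin n)) f x) :
    HasMFDerivAt 𝓘(ℝ, Cn (Fin n)) 𝓘(ℝ, Cn (Fin n)) f x
      ((mfderiv 𝓘(ℂ, Cn (Fin n)) 𝓘(ℂ, Cn (Fin n)) f x :
        Cn (Fin n) →L[ℂ] Cn (Fin n)).restrictScalars ℝ) :=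
  ⟨h.hasMFDerivAt.1, HasFDerivWithinAt.restrictScalars ℝ (𝕜' := ℂ) h.hasMFDerivAt.2⟩

lemma contMDiffAt_real {f : A → B} {x : A}
    (h : ContMDiffAt 𝓘(ℂ, Cn (Fin n)) 𝓘(ℂ, Cn (Fin n)) ω f x) :
    ContMDiffAt 𝓘(ℝ, Cn (Fin n)) 𝓘(ℝ, Cn (Fin n)) 1 f x := by
  rw [contMDiffAt_iff] at h ⊢
  exact ⟨h.1, ((h.2.restrict_scalars ℝ).of_le le_top)⟩

/-- The velocity of a path. -/
def vel (γ : ℝ → A) (t : ℝ) : Cn (Fin n) := mfderiv 𝓘(ℝ, ℝ) 𝓘(ℝ, Cn (Fin n)) γ t (1 : ℝ)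

lemma vel_comp {f : A → B} {γ : ℝ → A} {t : ℝ} (hγ : MDifferentiableAt 𝓘(ℝ, ℝ) 𝓘(ℝ, Cn (Fin n)) γ t)
    (hf : MDifferentiableAt 𝓘(ℂ, Cn (Fin n)) 𝓘(ℂ, Cn (Fin n)) f (γ t)) :
    vel (fun s => f (γ s)) t
      = (mfderiv 𝓘(ℂ, Cn (Fin n)) 𝓘(ℂ, Cn (Fin n)) f (γ t) : Cn (Fin n) →L[ℂ] Cn (Fin n))
        (vel γ t) := by
  have h := ((hasMFDerivAt_real hf).comp t hγ.hasMFDerivAt).mfderiv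
  exact congrArg (fun L : ℝ →L[ℝ] Cn (Fin n) => L 1) h

lemma vel_eq_deriv (c : ℝ → Cn (Fin n)) (t : ℝ) : vel c t = deriv c t := by
  have h : mfderiv 𝓘(ℝ, ℝ) 𝓘(ℝ, Cn (Fin n)) c t = fderiv ℝ c t := mfderiv_eq_fderiv
  exact (congrArg (fun L : ℝ →L[ℝ] Cn (Fin n) => L 1) h).trans fderiv_apply_one_eq_deriv

lemma vel_congr {γ γ' : ℝ → A} {t : ℝ} (h : γ =ᶠ[𝓝 t] γ') :
    vel (n := n) γ t = vel (n := n) γ' t := by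
  have := h.mfderiv_eq (I := 𝓘(ℝ, ℝ)) (I' := 𝓘(ℝ, Cn (Fin n)))
  exact congrArg (fun L : ℝ →L[ℝ] Cn (Fin n) => L 1) this

/-- The length of a real tangent vector. -/
def SesqField.nrm (g : SesqField n A) (x : A) (v : Cn (Fin n)) : ℝ≥0∞ :=
  ENNReal.ofReal (Real.sqrt (g.ev x v v).re)

lemma SesqField.nrm_smul (g : SesqField n A) (x : A) (c : ℝ) (v : Cn (Fin n)) :
    g.nrm x (c • v) = ‖c‖ₑ * g.nrm x v := by
  have h1 : (c • v : Cn (Fin n)) = (c : ℂ) • v := (Complex.coe_smul c v).symm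
  rw [SesqField.nrm, SesqField.nrm, h1, SesqField.ev_smul_left, SesqField.ev_smul_right,
    Complex.conj_ofReal, Complex.re_ofReal_mul, Complex.re_ofReal_mul, ← mul_assoc,
    Real.sqrt_mul (mul_self_nonneg c), Real.sqrt_mul_self_eq_abs,
    ENNReal.ofReal_mul (abs_nonneg c), ← Real.enorm_abs, Real.enorm_of_nonneg (abs_nonneg c)]

lemma enormSMulClass_herm (g : SesqField n A) (x : A) :
    letI := hermENorm g
    ENormSMulClass ℝ (TangentSpace 𝓘(ℝ, Cn (Fin n)) x) := by
  let _ := hermENorm g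
  exact ⟨fun c v => SesqField.nrm_smul g x c v⟩

/-- The length of a path. -/
def hermLength (g : SesqField n A) (γ : ℝ → A) (a b : ℝ) : ℝ≥0∞ :=
  letI := hermENorm g
  Manifold.pathELength 𝓘(ℝ, Cn (Fin n)) γ a b

lemma hermLength_eq (g : SesqField n A) (γ : ℝ → A) (a b : ℝ) :
    hermLength g γ a b = ∫⁻ t in Ioo a b, g.nrm (γ t) (vel γ t) := by
  let _ := hermENorm g
  exact Manifold.pathELength_eq_lintegral_mfderiv_Ioo

lemma hermLength_add (g : SesqField n A) (γ : ℝ → A) {a b c : ℝ} (h : a ≤ b) (h' : b ≤ c) :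
    hermLength g γ a b + hermLength g γ b c = hermLength g γ a c := by
  let _ := hermENorm g
  exact Manifold.pathELength_add h h'

lemma hermLength_mono (g : SesqField n A) (γ : ℝ → A) {a b a' b' : ℝ} (h : a' ≤ a) (h' : b ≤ b') :
    hermLength g γ a b ≤ hermLength g γ a' b' := by
  let _ := hermENorm g
  exact Manifold.pathELength_mono h h'

lemma hermDist_le_hermLength (g : SesqField n A) {γ : ℝ → A} {a b : ℝ} {x y : A}
    (hγ : ContMDiffOn 𝓘(ℝ, ℝ) 𝓘(ℝ, Cn (Fin n)) 1 γ (Icc a b)) (hx : γ a = x) (hy : γ b = y)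
    (hab : a ≤ b) : hermDist g x y ≤ hermLength g γ a b := by
  let _ := hermENorm g
  have := enormSMulClass_herm g
  exact Manifold.riemannianEDist_le_pathELength hγ hx hy hab

lemma exists_path_of_hermDist_lt {g : SesqField n A} {x y : A} {r : ℝ≥0∞} (h : hermDist g x y < r) :
    ∃ γ : ℝ → A, γ 0 = x ∧ γ 1 = y ∧ ContMDiffOn 𝓘(ℝ, ℝ) 𝓘(ℝ, Cn (Fin n)) 1 γ (Icc 0 1) ∧
      hermLength g γ 0 1 < r := by
  let _ := hermENorm g
  exact Manifold.exists_lt_of_riemannianEDist_lt h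

lemma hermDist_triangle (g : SesqField n A) (x y z : A) :
    hermDist g x z ≤ hermDist g x y + hermDist g y z := by
  let _ := hermENorm g
  have := enormSMulClass_herm g
  exact Manifold.riemannianEDist_triangle

lemma hermDist_comm (g : SesqField n A) (x y : A) : hermDist g x y = hermDist g y x := by
  let _ := hermENorm g
  have := enormSMulClass_herm g
  exact Manifold.riemannianEDist_comm

lemma mdifferentiableAt_of_mem_Ioo {γ : ℝ → A} {a b t : ℝ}
    (hγ : ContMDiffOn 𝓘(ℝ, ℝ) 𝓘(ℝ, Cn (Fin n)) 1 γ (Icc a b)) (ht : t ∈ Ioo a b) :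
    MDifferentiableAt 𝓘(ℝ, ℝ) 𝓘(ℝ, Cn (Fin n)) γ t :=
  (hγ.contMDiffAt (Icc_mem_nhds ht.1 ht.2)).mdifferentiableAt (by simp)

/-- The norm of a matrix, on real vectors. -/
def matNrm (G : Matrix (Fin n) (Fin n) ℂ) (v : Cn (Fin n)) : ℝ≥0∞ :=
  ENNReal.ofReal (Real.sqrt (sesq G v v).re)

variable [IsManifold 𝓘(ℂ, Cn (Fin n)) ω A]

/-- The length of a path in a chart. -/
lemma hermLength_chart (g : SesqField n A) {e : OpenPartialHomeomorph A (Cn (Fin n))}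
    (he : e ∈ atlas (Cn (Fin n)) A) {γ : ℝ → A} {a b : ℝ}
    (hγ : ContMDiffOn 𝓘(ℝ, ℝ) 𝓘(ℝ, Cn (Fin n)) 1 γ (Icc a b)) (hs : ∀ t ∈ Icc a b, γ t ∈ e.source) :
    hermLength g γ a b
      = ∫⁻ t in Ioo a b, matNrm (coeff g e (e (γ t))) (deriv (fun t => e (γ t)) t) := by
  rw [hermLength_eq]
  refine MeasureTheory.setLIntegral_congr_fun measurableSet_Ioo fun t ht => ?_
  have hγt := mdifferentiableAt_of_mem_Ioo hγ ht
  have hst := hs t (Ioo_subset_Icc_self ht)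
  have hc := (contMDiffAt_atlas he hst).mdifferentiableAt (n := ω) (by simp)
  have hcd : MDifferentiableAt 𝓘(ℝ, ℝ) 𝓘(ℝ, Cn (Fin n)) (fun t => e (γ t)) t :=
    ((hasMFDerivAt_real hc).comp t hγt.hasMFDerivAt).mdifferentiableAt
  have h1 : γ =ᶠ[𝓝 t] fun s => e.symm (e (γ s)) := by
    filter_upwards [Ioo_mem_nhds ht.1 ht.2] with s hs'
    exact (e.left_inv (hs s (Ioo_subset_Icc_self hs'))).symm
  have h2 : vel γ t = mder e.symm (e (γ t)) (vel (fun s => e (γ s)) t) := by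
    rw [vel_congr h1]
    exact vel_comp (f := e.symm) (γ := fun s => e (γ s)) hcd
      ((contMDiffAt_atlas_symm he (e.map_source hst)).mdifferentiableAt (by simp))
  change ENNReal.ofReal _ = ENNReal.ofReal _
  rw [coeff_eq_pb, sesq_pb, ← vel_eq_deriv, ← h2, e.left_inv hst]

lemma contDiffOn_chart_path {e : OpenPartialHomeomorph A (Cn (Fin n))}
    (he : e ∈ atlas (Cn (Fin n)) A) {γ : ℝ → A} {a b : ℝ}
    (hγ : ContMDiffOn 𝓘(ℝ, ℝ) 𝓘(ℝ, Cn (Fin n)) 1 γ (Icc a b)) (hs : ∀ t ∈ Icc a b, γ t ∈ e.source) :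
    ContDiffOn ℝ 1 (fun t => e (γ t)) (Icc a b) := by
  rw [← contMDiffOn_iff_contDiffOn]
  exact fun t ht => (contMDiffAt_real (contMDiffAt_atlas he (hs t ht))).comp_contMDiffWithinAt t (hγ t ht)

end Real

section Pullback

variable {n : ℕ} {M X : Type} [TopologicalSpace M] [ChartedSpace (Cn (Fin n)) M]
  [TopologicalSpace X] [ChartedSpace (Cn (Fin n)) X]

/-- Lengths are preserved by an isometric holomorphic map. -/
lemma hermLength_comp {g : SesqField n M} {gX : SesqField n X} {ι : M → X}
    (hι : ContMDiff 𝓘(ℂ, Cn (Fin n)) 𝓘(ℂ, Cn (Fin n)) ω ι)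
    (hpull : ∀ (y : M) (v w : Tan n M y),
        gX (ι y) (mfderiv 𝓘(ℂ, Cn (Fin n)) 𝓘(ℂ, Cn (Fin n)) ι y v)
          (mfderiv 𝓘(ℂ, Cn (Fin n)) 𝓘(ℂ, Cn (Fin n)) ι y w) = g y v w)
    {γ : ℝ → M} {a b : ℝ} (hγ : ContMDiffOn 𝓘(ℝ, ℝ) 𝓘(ℝ, Cn (Fin n)) 1 γ (Icc a b)) :
    hermLength gX (fun t => ι (γ t)) a b = hermLength g γ a b := by
  rw [hermLength_eq, hermLength_eq]
  refine MeasureTheory.setLIntegral_congr_fun measurableSet_Ioo fun t ht => ?_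
  have h := vel_comp (mdifferentiableAt_of_mem_Ioo hγ ht)
    (hι.mdifferentiableAt (x := γ t) (by simp))
  change gX.nrm (ι (γ t)) (vel (fun s => ι (γ s)) t) = g.nrm (γ t) (vel γ t)
  rw [h]
  exact congrArg (fun z : ℂ => ENNReal.ofReal (Real.sqrt z.re)) (hpull (γ t) (vel γ t) (vel γ t))

lemma hermDist_comp_le {g : SesqField n M} {gX : SesqField n X} {ι : M → X}
    (hι : ContMDiff 𝓘(ℂ, Cn (Fin n)) 𝓘(ℂ, Cn (Fin n)) ω ι)
    (hpull : ∀ (y : M) (v w : Tan n M y),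
        gX (ι y) (mfderiv 𝓘(ℂ, Cn (Fin n)) 𝓘(ℂ, Cn (Fin n)) ι y v)
          (mfderiv 𝓘(ℂ, Cn (Fin n)) 𝓘(ℂ, Cn (Fin n)) ι y w) = g y v w) (y y' : M) :
    hermDist gX (ι y) (ι y') ≤ hermDist g y y' := by
  refine le_of_forall_gt fun r hr => ?_
  obtain ⟨γ, h0, h1, hγ, hl⟩ := exists_path_of_hermDist_lt hr
  refine lt_of_le_of_lt ?_ hl
  rw [← hermLength_comp hι hpull hγ]
  refine hermDist_le_hermLength gX (fun t ht => ?_) (by rw [h0]) (by rw [h1]) zero_le_one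
  exact (contMDiffAt_real (hι (γ t))).comp_contMDiffWithinAt t (hγ t ht)

end Pullback

/-! ### Comparison of norms near a point -/

section Norms

variable {n : ℕ}

lemma eventually_pos {B : Cn (Fin n) → Matrix (Fin n) (Fin n) ℂ} {z : Cn (Fin n)}
    (hB : ∀ i j, ContinuousAt (fun z => B z i j) z)
    (h : ∀ v, v ≠ 0 → 0 < (sesq (B z) v v).re) :
    ∀ᶠ w in 𝓝 z, ∀ v, v ≠ 0 → 0 < (sesq (B w) v v).re := by
  have h1 := eventually_pos_add_smul (A := fun _ => 0) (B := B) (z := z)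
    (fun i j => continuousAt_const) hB (Eventually.of_forall fun w v => by simp [sesq])
    (fun v hv _ => h v hv)
  filter_upwards [h1.curry] with w hw v hv
  obtain ⟨ε, hε, hε0⟩ := (hw.and self_mem_nhdsWithin).exists
  have h2 := hε v hv
  rw [zero_add, sesq_smul_matrix, Complex.re_ofReal_mul] at h2
  exact (pos_iff_pos_of_mul_pos h2).1 hε0

lemma exists_sqrt {G : Matrix (Fin n) (Fin n) ℂ} (hG : G.PosDef) :
    ∃ B : Cn (Fin n) →L[ℂ] Cn (Fin n), Function.Injective B ∧
      ∀ v, (sesq G v v).re = ‖B v‖ ^ 2 := by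
  obtain ⟨C, hC⟩ : ∃ C : Matrix (Fin n) (Fin n) ℂ, G = C.conjTranspose * C := by
    open scoped MatrixOrder in
    exact CStarAlgebra.nonneg_iff_eq_star_mul_self.1 hG.posSemidef.nonneg
  let B : Cn (Fin n) →L[ℂ] Cn (Fin n) := LinearMap.toContinuousLinearMap
    { toFun := fun v => WithLp.toLp 2 fun c => ∑ a, conj (C c a) * v a
      map_add' := fun v w => by ext c; simp [mul_add, Finset.sum_add_distrib]
      map_smul' := fun r v => by
        ext c
        simp only [PiLp.smul_apply, smul_eq_mul, RingHom.id_apply, Finset.mul_sum]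
        exact Finset.sum_congr rfl fun a _ => by ring }
  have hB : ∀ v, (sesq G v v).re = ‖B v‖ ^ 2 := by
    intro v
    have h1 : sesq G v v = ∑ c, (B v c) * conj (B v c) := by
      have h2 : ∀ c, B v c = ∑ a, conj (C c a) * v a := fun c => rfl
      simp only [h2, map_sum, map_mul, Complex.conj_conj, Finset.sum_mul_sum]
      rw [sesq, hC, Finset.sum_comm' (t' := Finset.univ) (s' := fun _ => Finset.univ) (by simp)]
      simp only [Matrix.mul_apply, Matrix.conjTranspose_apply, Finset.sum_mul]
      rw [Finset.sum_comm]
      refine (Finset.sum_congr rfl fun a _ => Finset.sum_comm).trans ?_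
      rw [Finset.sum_comm]
      refine Finset.sum_congr rfl fun c _ => Finset.sum_congr rfl fun a _ =>
        Finset.sum_congr rfl fun b _ => ?_
      rw [starRingEnd_apply, starRingEnd_apply]; ring
    rw [h1, EuclideanSpace.norm_sq_eq, Complex.re_sum]
    refine Finset.sum_congr rfl fun c _ => ?_
    rw [Complex.mul_conj, Complex.ofReal_re, Complex.normSq_eq_norm_sq]
  refine ⟨B, (injective_iff_map_eq_zero B).2 fun v hv => ?_, hB⟩
  by_contra h
  have h1 := (posDef_iff_sesq.1 hG).2 v h
  rw [hB, hv] at h1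
  simp at h1

/-- Near `z`, the norm of `G` is comparable to a constant norm, with a factor arbitrarily close
to `1`. -/
lemma exists_norm_comparison {G : Cn (Fin n) → Matrix (Fin n) (Fin n) ℂ} {z : Cn (Fin n)}
    (hG : ∀ i j, ContinuousAt (fun z => G z i j) z) (hp : (G z).PosDef) {κ : ℝ} (hκ : 1 < κ) :
    ∃ B : Cn (Fin n) →L[ℂ] Cn (Fin n), Function.Injective B ∧ ∀ᶠ w in 𝓝 z, ∀ v,
      matNrm (G w) v ≤ ENNReal.ofReal κ * ‖B v‖ₑ ∧ ‖B v‖ₑ ≤ ENNReal.ofReal κ * matNrm (G w) v := by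
  obtain ⟨B, hB, hBn⟩ := exists_sqrt hp
  have hpz := (posDef_iff_sesq.1 hp).2
  have hκ2 : 1 < κ ^ 2 := by nlinarith
  have hκ0 : 0 ≤ κ := by linarith
  have h1 := eventually_pos (B := fun w => ((κ ^ 2 : ℝ) : ℂ) • G z + (-1 : ℂ) • G w) (z := z)
    (fun i j => continuousAt_const.add (continuousAt_const.mul (hG i j))) (fun v hv => by
      rw [sesq_add_matrix, sesq_smul_matrix, sesq_smul_matrix, Complex.add_re, Complex.re_ofReal_mul]
      have := hpz v hv
      simp only [neg_mul, one_mul, Complex.neg_re]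
      nlinarith)
  have h2 := eventually_pos (B := fun w => ((κ ^ 2 : ℝ) : ℂ) • G w + (-1 : ℂ) • G z) (z := z)
    (fun i j => (continuousAt_const.mul (hG i j)).add continuousAt_const) (fun v hv => by
      rw [sesq_add_matrix, sesq_smul_matrix, sesq_smul_matrix, Complex.add_re, Complex.re_ofReal_mul]
      have := hpz v hv
      simp only [neg_mul, one_mul, Complex.neg_re]
      nlinarith)
  refine ⟨B, hB, ?_⟩
  filter_upwards [h1, h2] with w w1 w2 v
  by_cases hv : v = 0
  · simp [hv, matNrm, sesq]
  have e1 := w1 v hv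
  have e2 := w2 v hv
  simp only [sesq_add_matrix, sesq_smul_matrix, Complex.add_re, Complex.re_ofReal_mul, neg_mul,
    one_mul, Complex.neg_re, hBn] at e1 e2
  rw [matNrm, ← ofReal_norm, ← ENNReal.ofReal_mul hκ0, ← ENNReal.ofReal_mul hκ0]
  constructor
  · refine ENNReal.ofReal_le_ofReal (Real.sqrt_le_iff.2 ⟨by positivity, ?_⟩)
    rw [mul_pow]; linarith
  · refine ENNReal.ofReal_le_ofReal ?_
    rw [← Real.sqrt_sq hκ0, ← Real.sqrt_mul (by positivity)]
    exact Real.le_sqrt_of_sq_le (by linarith)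

end Norms

section LocalLength

variable {n : ℕ} {X : Type} [TopologicalSpace X] [ChartedSpace (Cn (Fin n)) X]
  [IsManifold 𝓘(ℂ, Cn (Fin n)) ω X]

/-- A path from `0` to `1` in `ℂ`, close to the real segment, that avoids a given zero of an affine
function. -/
lemma exists_bend {h₁ h₂ : ℂ} (h1 : h₁ ≠ 0) (h2 : h₂ ≠ 0) {η₀ : ℝ} (hη₀ : 0 < η₀) :
    ∃ η : ℝ, 0 ≤ η ∧ η ≤ η₀ ∧
      ∀ s : ℝ, h₁ + ((s : ℂ) + Complex.I * η * s * (1 - s)) * (h₂ - h₁) ≠ 0 := by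
  by_contra! H
  obtain ⟨s, hs⟩ := H η₀ hη₀.le le_rfl
  obtain ⟨t, ht⟩ := H (η₀ / 2) (by linarith) (by linarith)
  have hd : h₂ - h₁ ≠ 0 := by
    intro h0
    rw [h0, mul_zero, add_zero] at hs
    exact h1 hs
  have he := mul_right_cancel₀ hd (add_left_cancel (hs.trans ht.symm))
  have hre := congrArg Complex.re he
  have him := congrArg Complex.im he
  have e1 : ∀ η s : ℝ, (s : ℂ) + Complex.I * η * s * (1 - s)
      = ((s : ℝ) : ℂ) + ((η * s * (1 - s) : ℝ) : ℂ) * Complex.I := by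
    intro η s; push_cast; ring
  rw [e1, e1] at hre him
  simp only [Complex.add_re, Complex.add_im, Complex.ofReal_re, Complex.ofReal_im,
    Complex.re_ofReal_mul, Complex.im_ofReal_mul, Complex.I_re, Complex.I_im] at hre him
  simp only [mul_zero, add_zero, mul_one, zero_add] at hre him
  subst hre
  have h0 : s * (1 - s) = 0 := by
    have : η₀ * (s * (1 - s)) = 0 := by linarith
    exact (mul_eq_zero.1 this).resolve_left hη₀.ne'
  rw [e1, mul_assoc, h0] at hs
  rcases mul_eq_zero.1 h0 with h | h
  · apply h1; rw [h] at hs; simpa using hs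
  · have h3 : s = 1 := by linarith
    apply h2; rw [h3] at hs; simpa using hs

/-- The bent segment from `z₁` to `z₂`. -/
def bentPath (z₁ z₂ : Cn (Fin n)) (η s : ℝ) : Cn (Fin n) :=
  z₁ + ((s : ℂ) + Complex.I * η * s * (1 - s)) • (z₂ - z₁)

lemma hasDerivAt_bentPath (z₁ z₂ : Cn (Fin n)) (η s : ℝ) :
    HasDerivAt (bentPath z₁ z₂ η) ((1 + Complex.I * η * (1 - 2 * s)) • (z₂ - z₁)) s := by
  have h0 : HasDerivAt (fun s : ℝ => (s : ℂ)) 1 s := Complex.ofRealCLM.hasDerivAt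
  have h1 : HasDerivAt (fun s : ℝ => (s : ℂ) + Complex.I * η * s * (1 - s))
      (1 + Complex.I * η * (1 - 2 * s)) s := by
    refine (h0.add ((h0.const_mul (Complex.I * η)).mul (h0.const_sub 1))).congr_deriv ?_
    ring
  exact (h1.smul_const (z₂ - z₁)).const_add z₁

lemma contDiff_bentPath (z₁ z₂ : Cn (Fin n)) (η : ℝ) : ContDiff ℝ 1 (bentPath z₁ z₂ η) := by
  have h0 : ContDiff ℝ 1 (fun s : ℝ => (s : ℂ)) := Complex.ofRealCLM.contDiff
  exact contDiff_const.add (ContDiff.smul (h0.add ((contDiff_const.mul h0).mul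
    (contDiff_const.sub h0))) contDiff_const)

lemma norm_bend_deriv_le {η s : ℝ} (hη : 0 ≤ η) (hs : s ∈ Icc (0 : ℝ) 1) :
    ‖(1 + Complex.I * η * (1 - 2 * s) : ℂ)‖ ≤ 1 + η := by
  refine (norm_add_le _ _).trans ?_
  have : (1 - 2 * s : ℂ) = ((1 - 2 * s : ℝ) : ℂ) := by push_cast; ring
  rw [norm_one, norm_mul, norm_mul, Complex.norm_I, one_mul, this, Complex.norm_real,
    Complex.norm_real, Real.norm_eq_abs, Real.norm_eq_abs, abs_of_nonneg hη]
  have h2 : |1 - 2 * s| ≤ 1 := abs_le.2 ⟨by linarith [hs.2], by linarith [hs.1]⟩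
  nlinarith

lemma bentPath_mem_ball {z₀ z₁ z₂ : Cn (Fin n)} {η s ρ : ℝ} (hη : 0 ≤ η) (hη1 : η ≤ 1)
    (hs : s ∈ Icc (0 : ℝ) 1) (h1 : z₁ ∈ Metric.ball z₀ ρ) (h2 : z₂ ∈ Metric.ball z₀ ρ) :
    bentPath z₁ z₂ η s ∈ Metric.ball z₀ (5 * ρ) := by
  rw [Metric.mem_ball, dist_eq_norm] at *
  have h3 : ‖z₂ - z₁‖ ≤ 2 * ρ := by
    have : z₂ - z₁ = (z₂ - z₀) - (z₁ - z₀) := by abel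
    rw [this]; linarith [norm_sub_le (z₂ - z₀) (z₁ - z₀)]
  have h4 : ‖(s : ℂ) + Complex.I * η * s * (1 - s)‖ ≤ 2 := by
    refine (norm_add_le _ _).trans ?_
    have : (1 - s : ℂ) = ((1 - s : ℝ) : ℂ) := by push_cast; ring
    rw [norm_mul, norm_mul, norm_mul, Complex.norm_I, one_mul, this, Complex.norm_real,
      Complex.norm_real, Complex.norm_real, Real.norm_eq_abs, Real.norm_eq_abs, Real.norm_eq_abs,
      abs_of_nonneg hη, abs_of_nonneg hs.1, abs_of_nonneg (sub_nonneg.2 hs.2)]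
    have h5 : η * s ≤ 1 := mul_le_one₀ hη1 hs.1 hs.2
    nlinarith [hs.1, hs.2, mul_nonneg hη hs.1]
  have h5 : bentPath z₁ z₂ η s - z₀
      = (z₁ - z₀) + ((s : ℂ) + Complex.I * η * s * (1 - s)) • (z₂ - z₁) := by
    rw [bentPath]; abel
  rw [h5]
  refine (norm_add_le _ _).trans_lt ?_
  rw [norm_smul]
  have := mul_le_mul h4 h3 (norm_nonneg _) (by norm_num)
  linarith

/-- The distance of two points of `M` in a chart of `X` is bounded by a constant norm. -/
lemma hermDist_le_of_chart {M : Type} [TopologicalSpace M] [ChartedSpace (Cn (Fin n)) M]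
    {g : SesqField n M} {gX : SesqField n X} {ι : M → X} {r : X → M}
    (hι : ContMDiff 𝓘(ℂ, Cn (Fin n)) 𝓘(ℂ, Cn (Fin n)) ω ι)
    (hr : ContMDiffOn 𝓘(ℂ, Cn (Fin n)) 𝓘(ℂ, Cn (Fin n)) ω r (range ι)) (hri : ∀ y, r (ι y) = y)
    (ho : IsOpen (range ι))
    (hpull : ∀ (y : M) (v w : Tan n M y),
        gX (ι y) (mfderiv 𝓘(ℂ, Cn (Fin n)) 𝓘(ℂ, Cn (Fin n)) ι y v)
          (mfderiv 𝓘(ℂ, Cn (Fin n)) 𝓘(ℂ, Cn (Fin n)) ι y w) = g y v w)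
    {e : OpenPartialHomeomorph X (Cn (Fin n))} (he : e ∈ atlas (Cn (Fin n)) X)
    {h : Cn (Fin n) → ℂ} (hh : ∀ z₁ z₂ (τ : ℂ), h (z₁ + τ • (z₂ - z₁)) = h z₁ + τ * (h z₂ - h z₁))
    {z₀ : Cn (Fin n)} {ρ κ : ℝ} (hκ : 1 < κ) {B : Cn (Fin n) →L[ℂ] Cn (Fin n)}
    (hball : ∀ w ∈ Metric.ball z₀ (5 * ρ), w ∈ e.target ∧ (e.symm w ∈ range ι ↔ h w ≠ 0) ∧
      ∀ v, matNrm (coeff gX e w) v ≤ ENNReal.ofReal κ * ‖B v‖ₑ)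
    {y₁ y₂ : M} {z₁ z₂ : Cn (Fin n)} (hz₁ : z₁ ∈ Metric.ball z₀ ρ) (hz₂ : z₂ ∈ Metric.ball z₀ ρ)
    (hy₁ : ι y₁ = e.symm z₁) (hy₂ : ι y₂ = e.symm z₂) :
    hermDist g y₁ y₂ ≤ ENNReal.ofReal κ * (ENNReal.ofReal κ * ‖B (z₂ - z₁)‖ₑ) := by
  have hρ : Metric.ball z₀ ρ ⊆ Metric.ball z₀ (5 * ρ) := by
    have := Metric.pos_of_mem_ball hz₁
    exact Metric.ball_subset_ball (by linarith)
  have h1 : h z₁ ≠ 0 := (hball z₁ (hρ hz₁)).2.1.1 ⟨y₁, hy₁⟩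
  have h2 : h z₂ ≠ 0 := (hball z₂ (hρ hz₂)).2.1.1 ⟨y₂, hy₂⟩
  obtain ⟨η, hη, hη1, hne⟩ := exists_bend h1 h2 (η₀ := min 1 (κ - 1)) (by simp [hκ])
  obtain ⟨hη1, hηκ⟩ := le_min_iff.1 hη1
  set c := bentPath z₁ z₂ η with hc
  have hcb : ∀ s ∈ Icc (0 : ℝ) 1, c s ∈ Metric.ball z₀ (5 * ρ) := fun s hs =>
    bentPath_mem_ball hη hη1 hs hz₁ hz₂
  have hct : ∀ s ∈ Icc (0 : ℝ) 1, c s ∈ e.target := fun s hs => (hball _ (hcb s hs)).1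
  have hcr : ∀ s ∈ Icc (0 : ℝ) 1, e.symm (c s) ∈ range ι := fun s hs =>
    (hball _ (hcb s hs)).2.1.2 (by rw [hc, bentPath, hh]; exact hne s)
  have hιr : ∀ s ∈ Icc (0 : ℝ) 1, ι (r (e.symm (c s))) = e.symm (c s) := fun s hs => by
    obtain ⟨y, hy⟩ := hcr s hs
    rw [← hy, hri]
  have hc0 : c 0 = z₁ := by simp [hc, bentPath]
  have hc1 : c 1 = z₂ := by simp [hc, bentPath]
  have hγ : ContMDiffOn 𝓘(ℝ, ℝ) 𝓘(ℝ, Cn (Fin n)) 1 (fun s => r (e.symm (c s))) (Icc 0 1) := by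
    intro s hs
    have i1 : ContMDiffAt 𝓘(ℝ, ℝ) 𝓘(ℝ, Cn (Fin n)) 1 c s :=
      (contDiff_bentPath z₁ z₂ η).contMDiff s
    have i2 := (contMDiffAt_real (contMDiffAt_atlas_symm he (hct s hs))).comp s i1
    exact ((contMDiffAt_real (hr.contMDiffAt (ho.mem_nhds (hcr s hs)))).comp s i2).contMDiffWithinAt
  have hγX : ContMDiffOn 𝓘(ℝ, ℝ) 𝓘(ℝ, Cn (Fin n)) 1 (fun s => ι (r (e.symm (c s)))) (Icc 0 1) :=
    fun t ht => (contMDiffAt_real (hι (r (e.symm (c t))))).comp_contMDiffWithinAt t (hγ t ht)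
  have hs : ∀ s ∈ Icc (0 : ℝ) 1, ι (r (e.symm (c s))) ∈ e.source := fun s hs => by
    rw [hιr s hs]; exact e.map_target (hct s hs)
  have hec : ∀ s ∈ Icc (0 : ℝ) 1, e (ι (r (e.symm (c s)))) = c s := fun s hs => by
    rw [hιr s hs, e.right_inv (hct s hs)]
  refine (hermDist_le_hermLength g hγ (by rw [hc0, ← hy₁, hri]) (by rw [hc1, ← hy₂, hri])
    zero_le_one).trans ?_
  rw [← hermLength_comp hι hpull hγ, hermLength_chart gX he hγX hs]
  refine (MeasureTheory.setLIntegral_mono' (g := fun _ =>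
    ENNReal.ofReal κ * (ENNReal.ofReal κ * ‖B (z₂ - z₁)‖ₑ)) measurableSet_Ioo fun s hs => ?_).trans ?_
  · have hs' := Ioo_subset_Icc_self hs
    have h3 : (fun t => e (ι (r (e.symm (c t))))) =ᶠ[𝓝 s] c := by
      filter_upwards [Ioo_mem_nhds hs.1 hs.2] with t ht using hec t (Ioo_subset_Icc_self ht)
    rw [h3.deriv_eq, hec s hs', (hasDerivAt_bentPath z₁ z₂ η s).deriv]
    refine ((hball _ (hcb s hs')).2.2 _).trans ?_
    rw [map_smul, enorm_smul]
    gcongr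
    rw [← ofReal_norm]
    exact ENNReal.ofReal_le_ofReal ((norm_bend_deriv_le hη hs').trans (by linarith))
  · simp

/-- In a chart the length of a path bounds a constant norm of the displacement. -/
lemma enorm_le_hermLength (g : SesqField n X)
    {e : OpenPartialHomeomorph X (Cn (Fin n))} (he : e ∈ atlas (Cn (Fin n)) X)
    {κ : ℝ} {B : Cn (Fin n) →L[ℂ] Cn (Fin n)} {U : Set (Cn (Fin n))}
    (hU : ∀ w ∈ U, ∀ v, ‖B v‖ₑ ≤ ENNReal.ofReal κ * matNrm (coeff g e w) v)
    {γ : ℝ → X} {a b : ℝ} (hab : a ≤ b)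
    (hγ : ContMDiffOn 𝓘(ℝ, ℝ) 𝓘(ℝ, Cn (Fin n)) 1 γ (Icc a b))
    (hs : ∀ t ∈ Icc a b, γ t ∈ e.source) (hsU : ∀ t ∈ Ioo a b, e (γ t) ∈ U) :
    ‖B (e (γ b) - e (γ a))‖ₑ ≤ ENNReal.ofReal κ * hermLength g γ a b := by
  have hc := contDiffOn_chart_path he hγ hs
  have hB : ContDiffOn ℝ 1 (fun t => B (e (γ t))) (Icc a b) :=
    (B.restrictScalars ℝ).contDiff.comp_contDiffOn hc
  rw [map_sub]
  refine (enorm_sub_le_lintegral_derivWithin_Icc_of_contDiffOn_Icc hB hab).trans ?_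
  rw [hermLength_chart g he hγ hs, ← MeasureTheory.lintegral_const_mul' _ _ ENNReal.ofReal_ne_top,
    MeasureTheory.setLIntegral_congr MeasureTheory.Ioo_ae_eq_Icc.symm]
  refine MeasureTheory.setLIntegral_mono' measurableSet_Ioo fun t ht => ?_
  have hn := Icc_mem_nhds ht.1 ht.2
  rw [derivWithin_of_mem_nhds hn]
  have hd : HasDerivAt (fun t => e (γ t)) (deriv (fun t => e (γ t)) t) t :=
    ((hc.contDiffAt hn).differentiableAt (by simp)).hasDerivAt
  have hd2 : HasDerivAt (fun t => B (e (γ t))) (B (deriv (fun t => e (γ t)) t)) t :=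
    (B.restrictScalars ℝ).hasFDerivAt.comp_hasDerivAt t hd
  rw [hd2.deriv]
  exact hU _ (hsU t ht) _

end LocalLength

section Completion

variable {n : ℕ} {M X : Type} [TopologicalSpace M] [ChartedSpace (Cn (Fin n)) M]
  [TopologicalSpace X] [ChartedSpace (Cn (Fin n)) X]

/-- Near each point the complement of the range of `ι` is, in charts, the zero locus of an affine
function (possibly a constant one). -/
def HasAffineBoundary (ι : M → X) : Prop :=
  ∀ e ∈ atlas (Cn (Fin n)) X, ∀ z ∈ e.target, ∃ h : Cn (Fin n) → ℂ,
    (∀ z₁ z₂ (τ : ℂ), h (z₁ + τ • (z₂ - z₁)) = h z₁ + τ * (h z₂ - h z₁)) ∧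
    ∀ᶠ w in 𝓝 z, (e.symm w ∈ range ι ↔ h w ≠ 0)

/-- An open holomorphic embedding `ι` with inverse `r`, that is isometric for `g` and `gX`, and whose
complement is locally a hyperplane. -/
structure IsIsometricEmbedding (g : SesqField n M) (gX : SesqField n X) (ι : M → X) (r : X → M) :
    Prop where
  contMDiff : ContMDiff 𝓘(ℂ, Cn (Fin n)) 𝓘(ℂ, Cn (Fin n)) ω ι
  contMDiffOn : ContMDiffOn 𝓘(ℂ, Cn (Fin n)) 𝓘(ℂ, Cn (Fin n)) ω r (range ι)
  left_inv : ∀ y, r (ι y) = y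
  isOpen_range : IsOpen (range ι)
  isometric : ∀ (y : M) (v w : Tan n M y),
    gX (ι y) (mfderiv 𝓘(ℂ, Cn (Fin n)) 𝓘(ℂ, Cn (Fin n)) ι y v)
      (mfderiv 𝓘(ℂ, Cn (Fin n)) 𝓘(ℂ, Cn (Fin n)) ι y w) = g y v w
  boundary : HasAffineBoundary (n := n) ι

lemma isIsometricEmbedding_id (gX : SesqField n X) : IsIsometricEmbedding gX gX id id where
  contMDiff := contMDiff_id
  contMDiffOn := contMDiffOn_id
  left_inv _ := rfl
  isOpen_range := by rw [range_id]; exact isOpen_univ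
  isometric y v w := by
    rw [mfderiv_id]; rfl
  boundary e _ z _ := ⟨fun _ => 1, fun _ _ _ => by simp, by simp⟩

variable [IsManifold 𝓘(ℂ, Cn (Fin n)) ω X] {g : SesqField n M} {gX : SesqField n X} {ι : M → X}
  {r : X → M}

lemma IsIsometricEmbedding.exists_chart (H : IsIsometricEmbedding g gX ι r) (hgX : IsKahler gX)
    (x₀ : X) {κ : ℝ} (hκ : 1 < κ) :
    ∃ e ∈ atlas (Cn (Fin n)) X, x₀ ∈ e.source ∧ ∃ B : Cn (Fin n) →L[ℂ] Cn (Fin n),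
      Function.Injective B ∧ ∃ ρ > 0, Metric.ball (e x₀) ρ ⊆ e.target ∧
      (∀ y₁ y₂, ι y₁ ∈ e.source → ι y₂ ∈ e.source → e (ι y₁) ∈ Metric.ball (e x₀) ρ →
        e (ι y₂) ∈ Metric.ball (e x₀) ρ →
        hermDist g y₁ y₂ ≤ ENNReal.ofReal κ * (ENNReal.ofReal κ * ‖B (e (ι y₂) - e (ι y₁))‖ₑ)) ∧
      ∀ w ∈ Metric.ball (e x₀) ρ, ∀ v, ‖B v‖ₑ ≤ ENNReal.ofReal κ * matNrm (coeff gX e w) v := by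
  let e := chartAt (Cn (Fin n)) x₀
  have he : e ∈ atlas (Cn (Fin n)) X := chart_mem_atlas _ _
  have hx : x₀ ∈ e.source := mem_chart_source _ _
  have hz := e.map_source hx
  obtain ⟨h, hh, hev⟩ := H.boundary e he _ hz
  have hK := hgX.isKahlerAt he hz
  obtain ⟨B, hB, hBev⟩ := exists_norm_comparison (fun i j => (hK.smooth i j).continuousAt)
    hK.posDef hκ
  obtain ⟨R, hR, hall⟩ := Metric.eventually_nhds_iff_ball.1
    ((e.open_target.eventually_mem hz).and (hev.and hBev))
  have h5 : 5 * (R / 5) = R := by ring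
  have hsub : Metric.ball (e x₀) (R / 5) ⊆ Metric.ball (e x₀) R :=
    Metric.ball_subset_ball (by linarith)
  refine ⟨e, he, hx, B, hB, R / 5, by positivity, fun w hw => (hall w (hsub hw)).1, ?_,
    fun w hw v => ((hall w (hsub hw)).2.2 v).2⟩
  intro y₁ y₂ hs₁ hs₂ hb₁ hb₂
  refine hermDist_le_of_chart H.contMDiff H.contMDiffOn H.left_inv H.isOpen_range H.isometric he hh
    hκ (z₀ := e x₀) (ρ := R / 5) (fun w hw => ?_) hb₁ hb₂ (e.left_inv hs₁).symm (e.left_inv hs₂).symm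
  rw [h5] at hw
  exact ⟨(hall w hw).1, (hall w hw).2.1, fun v => ((hall w hw).2.2 v).1⟩

lemma IsIsometricEmbedding.eventually_hermDist_le (H : IsIsometricEmbedding g gX ι r)
    (hgX : IsKahler gX) (y₀ : M) {δ : ℝ≥0∞} (hδ : 0 < δ) :
    ∀ᶠ y in comap ι (𝓝 (ι y₀)), hermDist g y₀ y ≤ δ := by
  obtain ⟨e, he, hx, B, -, ρ, hρ, -, hd, -⟩ := H.exists_chart hgX (ι y₀) one_lt_two
  have hce := e.continuousAt hx
  have h0 : Tendsto (fun x => ENNReal.ofReal 2 * (ENNReal.ofReal 2 * ‖B (e x - e (ι y₀))‖ₑ))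
      (𝓝 (ι y₀)) (𝓝 0) := by
    have h1 : Tendsto (fun x => ‖B (e x - e (ι y₀))‖ₑ) (𝓝 (ι y₀)) (𝓝 0) := by
      have h2 : ContinuousAt (fun x => ‖B (e x - e (ι y₀))‖ₑ) (ι y₀) :=
        (B.continuous.continuousAt.comp (hce.sub continuousAt_const)).enorm
      have h3 := h2.tendsto
      simpa using h3
    have h4 := ENNReal.Tendsto.const_mul (a := ENNReal.ofReal 2)
      (ENNReal.Tendsto.const_mul (a := ENNReal.ofReal 2) h1 (Or.inr ENNReal.ofReal_ne_top))
      (Or.inr ENNReal.ofReal_ne_top)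
    simpa using h4
  have hball := hce.eventually (Metric.ball_mem_nhds _ hρ)
  refine Eventually.mono (tendsto_comap.eventually
    ((ENNReal.tendsto_nhds_zero.1 h0 δ hδ).and ((e.open_source.eventually_mem hx).and hball))) ?_
  intro y hy
  exact (hd y₀ y hx hy.2.1 (Metric.mem_ball_self hρ) hy.2.2).trans hy.1

lemma eventually_hermDist_lt (hgX : IsKahler gX) (x : X) {δ : ℝ≥0∞} (hδ : 0 < δ) :
    ∀ᶠ y in 𝓝 x, hermDist gX x y < δ := by
  obtain ⟨δ', h0, h1⟩ := exists_between hδ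
  have := (isIsometricEmbedding_id gX).eventually_hermDist_le hgX x h0
  rw [comap_id] at this
  exact this.mono fun y hy => hy.trans_lt h1

/-- Propagation of a bound on the distance along a piece of a path inside a chart. -/
lemma eventually_hermDist_add (hd : Dense (range ι)) {κ : ℝ} {y₀ : M}
    {e : OpenPartialHomeomorph X (Cn (Fin n))} {B : Cn (Fin n) →L[ℂ] Cn (Fin n)}
    {z₀ : Cn (Fin n)} {ρ : ℝ}
    (hdist : ∀ y₁ y₂, ι y₁ ∈ e.source → ι y₂ ∈ e.source → e (ι y₁) ∈ Metric.ball z₀ ρ →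
        e (ι y₂) ∈ Metric.ball z₀ ρ →
        hermDist g y₁ y₂ ≤ ENNReal.ofReal κ * (ENNReal.ofReal κ * ‖B (e (ι y₂) - e (ι y₁))‖ₑ))
    {x₁ x₂ : X} (hs₁ : x₁ ∈ e.source) (hs₂ : x₂ ∈ e.source) (hb₁ : e x₁ ∈ Metric.ball z₀ ρ)
    (hb₂ : e x₂ ∈ Metric.ball z₀ ρ) {R : ℝ≥0∞}
    (hR : ∀ δ : ℝ≥0∞, 0 < δ → ∀ᶠ y in comap ι (𝓝 x₁), hermDist g y₀ y ≤ R + δ)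
    {δ : ℝ≥0∞} (hδ : 0 < δ) :
    ∀ᶠ y in comap ι (𝓝 x₂), hermDist g y₀ y
      ≤ R + ENNReal.ofReal κ * (ENNReal.ofReal κ * ‖B (e x₂ - e x₁)‖ₑ) + δ := by
  have hδ2 : 0 < δ / 2 := ENNReal.half_pos hδ.ne'
  have hc : ContinuousAt (fun q : X × X =>
      ENNReal.ofReal κ * (ENNReal.ofReal κ * ‖B (e q.2 - e q.1)‖ₑ)) (x₁, x₂) := by
    have h1 : ContinuousAt (fun q : X × X => ‖B (e q.2 - e q.1)‖ₑ) (x₁, x₂) := by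
      refine (B.continuous.continuousAt.comp (ContinuousAt.sub ?_ ?_)).enorm
      · exact ContinuousAt.comp (g := e) (f := Prod.snd) (e.continuousAt hs₂) continuousAt_snd
      · exact ContinuousAt.comp (g := e) (f := Prod.fst) (e.continuousAt hs₁) continuousAt_fst
    exact ENNReal.Tendsto.const_mul (ENNReal.Tendsto.const_mul h1 (Or.inr ENNReal.ofReal_ne_top))
      (Or.inr ENNReal.ofReal_ne_top)
  have hlt : ENNReal.ofReal κ * (ENNReal.ofReal κ * ‖B (e x₂ - e x₁)‖ₑ)
      < ENNReal.ofReal κ * (ENNReal.ofReal κ * ‖B (e x₂ - e x₁)‖ₑ) + δ / 2 :=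
    ENNReal.lt_add_right (ENNReal.mul_ne_top ENNReal.ofReal_ne_top
      (ENNReal.mul_ne_top ENNReal.ofReal_ne_top enorm_ne_top)) hδ2.ne'
  have hev := hc.eventually_lt_const hlt
  rw [nhds_prod_eq] at hev
  have hE : ∀ {x}, x ∈ e.source → e x ∈ Metric.ball z₀ ρ →
      ∀ᶠ w in 𝓝 x, w ∈ e.source ∧ e w ∈ Metric.ball z₀ ρ := fun hs hb =>
    (e.open_source.eventually_mem hs).and
      ((e.continuousAt hs).eventually (Metric.isOpen_ball.mem_nhds hb))
  have hne : (comap ι (𝓝 x₁)).NeBot := comap_neBot_iff.2 fun t ht => by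
    obtain ⟨_, h1, ⟨y, rfl⟩⟩ := mem_closure_iff_nhds.1 (hd x₁) t ht
    exact ⟨y, h1⟩
  obtain ⟨y₁, ⟨h1, h2⟩, h3⟩ := ((tendsto_comap.eventually (hev.curry.and (hE hs₁ hb₁))).and
    (hR _ hδ2)).exists
  refine Eventually.mono (tendsto_comap.eventually (h1.and (hE hs₂ hb₂))) ?_
  rintro y ⟨h4, h5, h6⟩
  refine (hermDist_triangle g y₀ y₁ y).trans ((add_le_add h3
    ((hdist y₁ y h2.1 h5 h2.2 h6).trans h4.le)).trans (le_of_eq ?_))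
  rw [add_add_add_comm, add_assoc R, add_comm (δ / 2), add_assoc, ENNReal.add_halves,
    ← add_assoc]

lemma IsIsometricEmbedding.hermDist_le (H : IsIsometricEmbedding g gX ι r) (hgX : IsKahler gX)
    (hd : Dense (range ι)) (y₀ y₁ : M) : hermDist g y₀ y₁ ≤ hermDist gX (ι y₀) (ι y₁) := by
  refine le_of_forall_gt_imp_ge_of_dense fun ℓ hℓ => ?_
  obtain ⟨γ, h0, h1, hγ, hlen⟩ := exists_path_of_hermDist_lt hℓ
  have key : ∀ κ : ℝ, 1 < κ → hermDist g y₀ y₁ ≤ ENNReal.ofReal (κ ^ 3) * ℓ := by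
    intro κ hκ
    have hκ0 : 0 ≤ κ := by linarith
    choose e he hx B hB ρ hρ hball hdist hU using fun x => H.exists_chart hgX x hκ
    let c : X → Set (Icc (0 : ℝ) 1) := fun x =>
      {t | γ t ∈ (e x).source ∩ (e x) ⁻¹' Metric.ball (e x x) (ρ x)}
    have hγc : Continuous fun t : Icc (0 : ℝ) 1 => γ t := hγ.continuousOn.domRestrict
    have hco : ∀ x, IsOpen (c x) := fun x =>
      ((e x).isOpen_inter_preimage Metric.isOpen_ball).preimage hγc
    have hcu : univ ⊆ ⋃ x, c x := fun t _ =>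
      mem_iUnion.2 ⟨γ t, hx _, Metric.mem_ball_self (hρ _)⟩
    obtain ⟨t, ht0, hmono, ⟨m, hm⟩, ht⟩ :=
      exists_monotone_Icc_subset_open_cover_Icc zero_le_one hco hcu
    have hP : ∀ k : ℕ, ∀ δ : ℝ≥0∞, 0 < δ → ∀ᶠ y in comap ι (𝓝 (γ (t k))),
        hermDist g y₀ y ≤ ENNReal.ofReal (κ ^ 3) * hermLength gX γ 0 (t k) + δ := by
      intro k
      induction k with
      | zero =>
        intro δ hδ
        rw [ht0, h0]
        exact (H.eventually_hermDist_le hgX y₀ hδ).mono fun y hy => hy.trans le_add_self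
      | succ k ih =>
        intro δ hδ
        obtain ⟨x, hxc⟩ := ht k
        have hle : t k ≤ t (k + 1) := hmono k.le_succ
        have hin : ∀ s ∈ Icc (t k : ℝ) (t (k + 1)),
            γ s ∈ (e x).source ∧ e x (γ s) ∈ Metric.ball (e x x) (ρ x) := fun s hs =>
          hxc (show (⟨s, (t k).2.1.trans hs.1, hs.2.trans (t (k + 1)).2.2⟩ : Icc (0 : ℝ) 1) ∈
            Icc (t k) (t (k + 1)) from ⟨hs.1, hs.2⟩)
        have hl := hin _ (left_mem_Icc.2 hle)
        have hr' := hin _ (right_mem_Icc.2 hle)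
        have hsub : Icc (t k : ℝ) (t (k + 1)) ⊆ Icc 0 1 := Icc_subset_Icc (t k).2.1 (t (k + 1)).2.2
        have hlow := enorm_le_hermLength gX (he x) (hU x) hle (hγ.mono hsub)
          (fun s hs => (hin s hs).1) (fun s hs => (hin s (Ioo_subset_Icc_self hs)).2)
        refine (eventually_hermDist_add hd (hdist x) hl.1 hr'.1 hl.2 hr'.2 ih hδ).mono fun y hy =>
          hy.trans ?_
        rw [← hermLength_add gX γ (t k).2.1 hle, mul_add]
        refine add_le_add (add_le_add le_rfl ?_) le_rfl
        calc _ ≤ ENNReal.ofReal κ * (ENNReal.ofReal κ * (ENNReal.ofReal κ *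
              hermLength gX γ (t k) (t (k + 1)))) := by gcongr
          _ = _ := by
            rw [← mul_assoc, ← mul_assoc, ← ENNReal.ofReal_mul hκ0,
              ← ENNReal.ofReal_mul (by positivity)]
            congr 2; ring
    have hfin := hP m
    rw [hm m le_rfl, h1] at hfin
    refine le_trans (ENNReal.le_of_forall_pos_le_add fun δ hδ _ => ?_) (mul_le_mul_right hlen.le _)
    obtain ⟨t, ht, hsub⟩ := mem_comap.1 (hfin δ (by exact_mod_cast hδ))
    exact hsub (mem_of_mem_nhds ht : ι y₁ ∈ t)
  have hlim : Tendsto (fun κ : ℝ => ENNReal.ofReal (κ ^ 3) * ℓ) (𝓝[>] 1)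
      (𝓝 (ENNReal.ofReal (1 ^ 3) * ℓ)) := by
    refine ENNReal.Tendsto.mul_const ?_ (Or.inl (by simp))
    exact ((ENNReal.continuous_ofReal.comp (continuous_id.pow 3)).tendsto 1).mono_left inf_le_left
  rw [one_pow, ENNReal.ofReal_one, one_mul] at hlim
  exact ge_of_tendsto hlim (eventually_mem_nhdsWithin.mono fun κ hκ => key κ hκ)

lemma hermDist_pos [T2Space X] (hgX : IsKahler gX) {x₀ x : X} (h : hermDist gX x₀ x = 0) :
    x₀ = x := by
  by_contra hne
  obtain ⟨e, he, hx, B, hB, ρ, hρ, hball, -, hU⟩ :=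
    (isIsometricEmbedding_id gX).exists_chart hgX x₀ one_lt_two
  obtain ⟨ρ', hρ', hlt, hxn⟩ : ∃ ρ' : ℝ, 0 < ρ' ∧ ρ' < ρ ∧
      x ∉ e.symm '' Metric.ball (e x₀) ρ' := by
    by_cases hxs : x ∈ e.source
    · have hd : 0 < dist (e x) (e x₀) :=
        dist_pos.2 fun h => hne (e.injOn hx hxs h.symm)
      refine ⟨min (ρ / 2) (dist (e x) (e x₀)), by positivity,
        (min_le_left _ _).trans_lt (by linarith), ?_⟩
      rintro ⟨z, hz, rfl⟩
      have hz' : z ∈ Metric.ball (e x₀) ρ :=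
        Metric.ball_subset_ball ((min_le_left _ _).trans (half_le_self hρ.le)) hz
      rw [e.right_inv (hball hz')] at hz
      exact absurd (lt_of_lt_of_le (Metric.mem_ball.1 hz) (min_le_right _ _)) (lt_irrefl _)
    · refine ⟨ρ / 2, by positivity, by linarith, ?_⟩
      rintro ⟨z, hz, rfl⟩
      exact hxs (e.map_target (hball (Metric.ball_subset_ball (by linarith) hz)))
  have hcb : Metric.closedBall (e x₀) ρ' ⊆ Metric.ball (e x₀) ρ :=
    Metric.closedBall_subset_ball hlt
  have hbo : IsOpen (e.symm '' Metric.ball (e x₀) ρ') :=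
    e.symm.isOpen_image_of_subset_source Metric.isOpen_ball
      ((Metric.ball_subset_closedBall.trans hcb).trans hball)
  have hbc : IsClosed (e.symm '' Metric.closedBall (e x₀) ρ') :=
    ((isCompact_closedBall _ _).image_of_continuousOn
      (e.symm.continuousOn.mono (hcb.trans hball))).isClosed
  obtain ⟨K, hK, hBK⟩ := LinearMap.exists_antilipschitzWith (B : Cn (Fin n) →ₗ[ℂ] Cn (Fin n))
    (LinearMap.ker_eq_bot.2 hB)
  have hc : (0 : ℝ≥0∞) < ENNReal.ofReal ρ' / (K * 2) :=
    ENNReal.div_pos (by simpa using hρ') (ENNReal.mul_ne_top (by simp) (by simp))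
  obtain ⟨γ, h0, h1, hγ, hlen⟩ := exists_path_of_hermDist_lt (h ▸ hc)
  have hγc : ContinuousOn γ (Icc 0 1) := hγ.continuousOn
  obtain ⟨T, hT, hTm⟩ : ∃ T, IsLeast (Icc (0 : ℝ) 1 ∩ γ ⁻¹' (e.symm '' Metric.ball (e x₀) ρ')ᶜ) T :=
    (isCompact_Icc.of_isClosed_subset (hγc.preimage_isClosed_of_isClosed isClosed_Icc
      hbo.isClosed_compl) inter_subset_left).exists_isLeast ⟨1, by simp, by simpa [h1] using hxn⟩
  have hT0 : 0 < T := by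
    refine lt_of_le_of_ne hT.1.1 fun h => hT.2 ?_
    rw [← h, h0]
    exact ⟨e x₀, Metric.mem_ball_self hρ', e.left_inv hx⟩
  have hin : ∀ s ∈ Ico 0 T, γ s ∈ e.symm '' Metric.ball (e x₀) ρ' := fun s hs => by
    by_contra hn
    exact absurd (hTm ⟨⟨hs.1, hs.2.le.trans hT.1.2⟩, hn⟩) (not_le.2 hs.2)
  have hTc : γ T ∈ e.symm '' Metric.closedBall (e x₀) ρ' := by
    have hTcl : T ∈ closure (Ico 0 T) := by
      rw [closure_Ico hT0.ne]; exact right_mem_Icc.2 hT0.le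
    have hmap : MapsTo γ (Ico 0 T) (e.symm '' Metric.closedBall (e x₀) ρ') := fun s hs =>
      image_mono Metric.ball_subset_closedBall (hin s hs)
    have := ((hγc T hT.1).mono (s := Ico 0 T) fun s hs =>
      ⟨hs.1, hs.2.le.trans hT.1.2⟩).mem_closure hTcl hmap
    rwa [hbc.closure_eq] at this
  obtain ⟨z, hz, hzT⟩ := hTc
  have hzρ : ρ' ≤ dist z (e x₀) := by
    by_contra hlt
    exact hT.2 ⟨z, Metric.mem_ball.2 (not_le.1 hlt), hzT⟩
  have hsub : Icc 0 T ⊆ Icc (0 : ℝ) 1 := Icc_subset_Icc_right hT.1.2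
  have hsrc : ∀ s ∈ Icc 0 T, γ s ∈ e.source ∧ e (γ s) ∈ Metric.ball (e x₀) ρ := by
    have : ∀ w ∈ Metric.closedBall (e x₀) ρ', e.symm w ∈ e.source ∧
        e (e.symm w) ∈ Metric.ball (e x₀) ρ := fun w hw =>
      ⟨e.map_target (hball (hcb hw)), by rw [e.right_inv (hball (hcb hw))]; exact hcb hw⟩
    intro s hs
    rcases hs.2.lt_or_eq with h | h
    · obtain ⟨w, hw, hws⟩ := hin s ⟨hs.1, h⟩
      rw [← hws]
      exact this w (Metric.ball_subset_closedBall hw)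
    · rw [h, ← hzT]
      exact this z hz
  have hlow := enorm_le_hermLength gX he hU hT0.le (hγ.mono hsub) (fun s hs => (hsrc s hs).1)
    (fun s hs => (hsrc s (Ioo_subset_Icc_self hs)).2)
  rw [h0, ← hzT, e.right_inv (hball (hcb hz))] at hlow
  have hanti := hBK z (e x₀)
  rw [edist_dist, edist_eq_enorm_sub] at hanti
  have h2 : ENNReal.ofReal ρ' ≤ K * 2 * hermLength gX γ 0 1 := by
    calc ENNReal.ofReal ρ' ≤ ENNReal.ofReal (dist z (e x₀)) := ENNReal.ofReal_le_ofReal hzρ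
      _ ≤ K * ‖B (z - e x₀)‖ₑ := by rw [map_sub]; exact hanti
      _ ≤ K * (ENNReal.ofReal 2 * hermLength gX γ 0 T) := by gcongr
      _ ≤ K * (ENNReal.ofReal 2 * hermLength gX γ 0 1) := by
        gcongr; exact hermLength_mono gX γ le_rfl hT.1.2
      _ = _ := by rw [mul_assoc]; simp
  have h3 := ENNReal.div_le_of_le_mul' h2
  exact absurd (h3.trans_lt hlen) (lt_irrefl _)

/-- A compact extension is the metric completion. -/
theorem IsIsometricEmbedding.isMetricCompletion [T2Space X] [CompactSpace X]
    (H : IsIsometricEmbedding g gX ι r) (hgX : IsKahler gX) (hd : Dense (range ι)) :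
    IsMetricCompletion (hermDist g) (hermDist gX) ι where
  isometric y y' := le_antisymm (hermDist_comp_le H.contMDiff H.isometric y y')
    (H.hermDist_le hgX hd y y')
  dense b δ hδ := by
    obtain ⟨_, h1, ⟨a, rfl⟩⟩ := mem_closure_iff_nhds.1 (hd b) _ (eventually_hermDist_lt hgX b hδ)
    exact ⟨a, h1⟩
  separated b b' h := hermDist_pos hgX h
  complete u hu := by
    obtain ⟨b, hb⟩ := exists_clusterPt_of_compactSpace (map u atTop)
    refine ⟨b, ENNReal.tendsto_nhds_zero.2 fun δ hδ => ?_⟩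
    have hδ2 : 0 < δ / 2 := ENNReal.half_pos hδ.ne'
    obtain ⟨K, hK⟩ := hu _ hδ2
    have hf := MapClusterPt.frequently hb (eventually_hermDist_lt hgX b hδ2)
    obtain ⟨q, hq, hqK⟩ := (hf.and_eventually (eventually_ge_atTop K)).exists
    filter_upwards [eventually_ge_atTop K] with p hp
    refine (hermDist_triangle gX _ (u q) _).trans ?_
    rw [hermDist_comm gX (u q) b, ← ENNReal.add_halves δ]
    exact add_le_add (hK p hp q hqK).le hq.le

end Completion

section Resolution

variable {N n k : ℕ} {Y : Set (CP N)} {p : Fin k → CP N} {m l : Fin k → ℕ}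
  [ChartedSpace (Cn (Fin n)) ↥(Y \ range p)]
  [IsManifold 𝓘(ℂ, Cn (Fin n)) ω ↥(Y \ range p)]
  {ψ : ∀ j, ConeChart (n := n) Y (range p) (p j) (m j) (l j)}
  {L : ∀ j, Cn (Fin n) ≃L[ℂ] Par (m j) (l j)} {hp : Function.Injective p}
  [TopologicalSpace (Total Y p m l)] [ChartedSpace (Cn (Fin n)) (Total Y p m l)]

/-- In the charts of the resolution the exceptional divisor is a coordinate hyperplane. -/
lemma HasResAtlas.hasAffineBoundary [IsManifold 𝓘(ℂ, Cn (Fin n)) ω (Total Y p m l)]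
    (hat : HasResAtlas ψ L hp) :
    HasAffineBoundary (n := n) (Total.reg : ↥(Y \ range p) → Total Y p m l) := by
  intro φ hφ z hz
  by_cases hzr : φ.symm z ∈ range Total.reg
  · refine ⟨fun _ => 1, fun _ _ _ => by simp, ?_⟩
    filter_upwards [(φ.symm.continuousAt hz).eventually
      (hat.isOpenEmbedding_reg.isOpen_range.mem_nhds hzr)] with w hw
    exact ⟨fun _ => one_ne_zero, fun _ => hw⟩
  · rcases (hat _).2 ⟨φ, hφ, rfl⟩ with ⟨c, hc, h⟩ | ⟨j, a, b, h⟩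
    · refine absurd ?_ hzr
      have h1 : φ.symm z = (pushChart c).symm z :=
        congrFun (congrArg (fun e : PartialEquiv _ _ => (e.symm : _ → _)) h) z
      exact ⟨_, h1.symm⟩
    · have hs : ∀ w, φ.symm w = segInv ψ L j a b w := fun w =>
        congrFun (congrArg (fun e : PartialEquiv _ _ => (e.symm : _ → _)) h) w
      have ht : φ.target = (segChart ψ L hp j a b).target := congrArg PartialEquiv.target h
      have hev : ∀ᶠ w in 𝓝 z, segCone a b (L j w) ∈ (ψ j).toHomeo.target :=
        eventually_mem_segChart_target ψ L hp (ht ▸ hz)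
      refine ⟨fun w => (L j w).1, fun z₁ z₂ τ => by simp, hev.mono fun w hw => ?_⟩
      rw [hs]
      exact segInv_mem_range_iff ψ hp hw

end Resolution

/-- Coordinates on the parameter space of the affine charts of `blowUp m l`. -/
lemma nonempty_par_equiv {n m l : ℕ} (h : m + l + 1 = n) : Nonempty (Cn (Fin n) ≃L[ℂ] Par m l) :=
  ⟨ContinuousLinearEquiv.ofFinrankEq (by simp [Par]; omega)⟩

end SegreCone
end

theorem mainTheorem7 {N n k : ℕ} (Y : Set (SegreCone.CP N))
    (hY : SegreCone.IsProjectiveVariety Y)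
    (p : Fin k → SegreCone.CP N) (hp : Function.Injective p)
    [ChartedSpace (SegreCone.Cn (Fin n)) ↥(Y \ range p)]
    [IsManifold 𝓘(ℂ, SegreCone.Cn (Fin n)) ω ↥(Y \ range p)]
    (hreg : SegreCone.IsComplexSubmanifold n (Y \ range p))
    (m l : Fin k → ℕ) (hm : ∀ j, 1 ≤ m j) (hl : ∀ j, 1 ≤ l j) (hn : ∀ j, m j + l j + 1 = n)
    (ψ : ∀ j, SegreCone.ConeChart (n := n) Y (range p) (p j) (m j) (l j))
    (g : SegreCone.SesqField n ↥(Y \ range p)) (hg : SegreCone.IsKahler g)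
    (hgp : ∀ j, (ψ j).IsRestriction g) :
    ∃ (X : Type) (_ : TopologicalSpace X) (_ : T2Space X) (_ : CompactSpace X)
      (_ : ChartedSpace (SegreCone.Cn (Fin n)) X)
      (_ : IsManifold 𝓘(ℂ, SegreCone.Cn (Fin n)) ω X)
      (φ : X → ↥Y) (ι : ↥(Y \ range p) → X),
      SegreCone.IsResolution ψ φ ι ∧
      ∃ ε₀ : ℝ, 0 < ε₀ ∧ ∀ ε : ℝ, 0 < ε → ε < ε₀ →
        SegreCone.IsKahler (SegreCone.subRicci g ε) ∧
        ∃ gX : SegreCone.SesqField n X, SegreCone.IsKahler gX ∧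
          (∀ (y : ↥(Y \ range p)) (v w : SegreCone.Tan n ↥(Y \ range p) y),
            gX (ι y)
              (mfderiv 𝓘(ℂ, SegreCone.Cn (Fin n)) 𝓘(ℂ, SegreCone.Cn (Fin n)) ι y v)
              (mfderiv 𝓘(ℂ, SegreCone.Cn (Fin n)) 𝓘(ℂ, SegreCone.Cn (Fin n)) ι y w)
            = SegreCone.subRicci g ε y v w) ∧
          SegreCone.IsMetricCompletion (SegreCone.hermDist (SegreCone.subRicci g ε))
            (SegreCone.hermDist gX) ι := by
  let L := fun j => (SegreCone.nonempty_par_equiv (hn j)).some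
  obtain ⟨_, _, _, hat⟩ := SegreCone.exists_manifold_resAtlas ψ L hp
  replace hat : SegreCone.HasResAtlas ψ L hp := hat
  have hclosed := hY.isClosed
  have := hat.t2Space
  have := hat.compactSpace hclosed
  obtain ⟨y₀⟩ := hat.nonempty_reg hY.1
  refine ⟨_, _, inferInstance, inferInstance, _, inferInstance, SegreCone.contr ψ,
    SegreCone.Total.reg, hat.isResolution, ?_⟩
  have hr := hat.contMDiffOn_unreg y₀
  have ho := hat.isOpenEmbedding_reg.isOpen_range
  obtain ⟨ε₀, hε₀, H⟩ := SegreCone.exists_extension hg hat.contMDiff_reg hr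
    (SegreCone.unreg_reg y₀) ho hat.dense_range_reg
    fun φ hφ z hz => hat.exists_isLocalExtension hm hl hg hgp y₀ hφ hz
  refine ⟨ε₀, hε₀, fun ε h0 h1 => ?_⟩
  obtain ⟨hK, gX, hgX, hpull⟩ := H ε h0 h1
  exact ⟨hK, gX, hgX, hpull, SegreCone.IsIsometricEmbedding.isMetricCompletion
    ⟨hat.contMDiff_reg, hr, SegreCone.unreg_reg y₀, ho, hpull, hat.hasAffineBoundary⟩ hgX
    hat.dense_range_reg⟩
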